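/- Let $d\in\mathbb N$, let $V\in L^\infty(\mathbb R^d;\mathbb R)$ and let $H=-\Delta+V$, the self-adjoint operator on $\mathcal H=L^2(\mathbb R^d;\mathbb C)$ with domain $H^2(\mathbb R^d)$. Let $Q\psi=(q_1\psi,\dots,q_d\psi)\in\mathcal H^d$ be the position operator with domain $D(Q)=\{\psi\in\mathcal H:\|Q\psi\|<\infty\}$, let $|Q|$ and $Q^2$ be multiplication by the Euclidean norm $|q|$ and by $|q|^2$, and put $Q(t)=e^{itH}Qe^{-itH}$ (componentwise) and $|Q|(t)=e^{itH}|Q|e^{-itH}$. Let $A=[Q^2,H]$, that is, the closure of the commutator $Q^2H-HQ^2$ on its natural domain; it satisfies $A^*=-A$. Let $I\subset\mathbb R$ be an interval. For $\alpha>0$ say that the strict Mourre estimate with constant $\alpha$ holds on $I$ if $$\chi_I(H)\,[H,A]\,\chi_I(H)\ \ge\ \alpha\,\chi_I(H)$$ in the sense of quadratic forms: for every $\varphi\in\mathcal H$ such that $\phi=\chi_I(H)\varphi$ lies in $D(H)\cap D(A)$, $$\langle H\phi,A\phi\rangle+\langle A\phi,H\phi\rangle\ \ge\ \alpha\,\langle\varphi,\chi_I(H)\varphi\rangle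 .$$ Suppose that the strict Mourre estimate holds on $I$ with some constant $\alpha>0$. Then for every nonzero $\psi\in\chi_I(H)\mathcal H\cap D(Q)\cap H^1(\mathbb R^d)$: 1. There is a constant $C>0$ (depending on $\psi$, $V$ and $I$) such that, for every $\alpha>0$ with which the strict Mourre estimate holds on $I$ and every $t\ge 0$, one has $\psi\in D(Q(t))$ and $$\|Q(t)\psi\|\ \ge\ C\alpha t .$$ 2. $\psi$ exhibits ballistic transport in the norm-growth sense: there are constants $c,C'>0$ such that for all $t\ge 1$ one has $\psi\in D(|Q|(t))$ and $$c\,t^2\ \le\ \||Q|(t)\psi\|^2\ \le\ C'\,t^2 .$$ -/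

import Mathlib

open MeasureTheory Filter Topology
open scoped ENNReal SchwartzMap Laplacian ComplexInnerProductSpace

noncomputable section

/-! ### Unbounded operators on a Hilbert space -/

section Operators

variable {K : Type*} [NormedAddCommGroup K] [InnerProductSpace ℂ K]

/-- The product `S T` of two unbounded operators, on its natural domain
`{ψ ∈ D(T) : T ψ ∈ D(S)}`. -/
def opComp (S T : K →ₗ.[ℂ] K) : K →ₗ.[ℂ] K where
  domain :=
    { carrier := {ψ | ∃ h : ψ ∈ T.domain, T ⟨ψ, h⟩ ∈ S.domain}
      zero_mem' := ⟨T.domain.zero_mem, by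
        have h : (⟨0, T.domain.zero_mem⟩ : T.domain) = 0 := rfl
        rw [h, T.map_zero]
        exact S.domain.zero_mem⟩
      add_mem' := by
        rintro a b ⟨ha, ha'⟩ ⟨hb, hb'⟩
        refine ⟨T.domain.add_mem ha hb, ?_⟩
        have h : (⟨a + b, T.domain.add_mem ha hb⟩ : T.domain) = ⟨a, ha⟩ + ⟨b, hb⟩ := rfl
        rw [h, T.map_add]
        exact S.domain.add_mem ha' hb'
      smul_mem' := by
        rintro c a ⟨ha, ha'⟩
        refine ⟨T.domain.smul_mem c ha, ?_⟩
        have h : (⟨c • a, T.domain.smul_mem c ha⟩ : T.domain) = c • ⟨a, ha⟩ := rfl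
        rw [h, T.map_smul]
        exact S.domain.smul_mem c ha' }
  toFun :=
    { toFun := fun ψ => S ⟨T ⟨ψ.1, ψ.2.choose⟩, ψ.2.choose_spec⟩
      map_add' := by
        rintro ⟨a, ha⟩ ⟨b, hb⟩
        rw [← S.map_add]
        congr 1
        ext1
        exact T.map_add ⟨a, ha.choose⟩ ⟨b, hb.choose⟩
      map_smul' := by
        rintro c ⟨a, ha⟩
        rw [RingHom.id_apply, ← S.map_smul]
        congr 1
        ext1
        exact T.map_smul c ⟨a, ha.choose⟩ }

/-- The commutator `[S, T] = S T - T S` on its natural domain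
`{ψ ∈ D(S) ∩ D(T) : T ψ ∈ D(S), S ψ ∈ D(T)}`. -/
def opCommutator (S T : K →ₗ.[ℂ] K) : K →ₗ.[ℂ] K :=
  opComp S T - opComp T S

/-- The operator `ψ ↦ (B₁ ψ, …, B_d ψ)` from `K` to the Hilbert space `K ^ d`, with domain
`D(B₁) ∩ … ∩ D(B_d)`. -/
def tupleOp {d : ℕ} (B : Fin d → K →ₗ.[ℂ] K) : K →ₗ.[ℂ] PiLp 2 (fun _ : Fin d => K) where
  domain := ⨅ j, (B j).domain
  toFun :=
    { toFun := fun ψ =>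
        WithLp.toLp 2 fun j => B j ⟨ψ.1, (Submodule.mem_iInf _).1 ψ.2 j⟩
      map_add' := by
        rintro ⟨a, ha⟩ ⟨b, hb⟩
        ext1 j
        exact (B j).map_add ⟨a, (Submodule.mem_iInf _).1 ha j⟩ ⟨b, (Submodule.mem_iInf _).1 hb j⟩
      map_smul' := by
        rintro c ⟨a, ha⟩
        ext1 j
        exact (B j).map_smul c ⟨a, (Submodule.mem_iInf _).1 ha j⟩ }

/-- The bounded Borel functions `ℝ → ℂ`. -/
def IsBoundedBorel (f : ℝ → ℂ) : Prop :=
  Measurable f ∧ ∃ M : ℝ, ∀ x, ‖f x‖ ≤ M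

/-- `Φ` is the bounded Borel functional calculus `f ↦ f(H)` of the operator `H`: a unital
`*`-homomorphism on the bounded Borel functions which turns bounded pointwise convergence into
strong convergence, and which sends `x ↦ (x - z)⁻¹` to the resolvent `(H - z)⁻¹` for every
non-real `z`. By the spectral theorem there is such a `Φ` when `H` is self-adjoint, and its values
on bounded Borel functions are then uniquely determined; the values of `Φ` on other functions are
never used. -/
structure IsBorelFunctionalCalculus [CompleteSpace K] (H : K →ₗ.[ℂ] K)
    (Φ : (ℝ → ℂ) → K →L[ℂ] K) : Prop where
  map_one : Φ (fun _ => 1) = 1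
  map_add : ∀ f g, IsBoundedBorel f → IsBoundedBorel g → Φ (fun x => f x + g x) = Φ f + Φ g
  map_smul : ∀ (c : ℂ) f, IsBoundedBorel f → Φ (fun x => c * f x) = c • Φ f
  map_mul : ∀ f g, IsBoundedBorel f → IsBoundedBorel g → Φ (fun x => f x * g x) = Φ f * Φ g
  map_conj : ∀ f, IsBoundedBorel f →
    Φ (fun x => (starRingEnd ℂ) (f x)) = ContinuousLinearMap.adjoint (Φ f)
  tendsto : ∀ (f : ℕ → ℝ → ℂ) (g : ℝ → ℂ) (M : ℝ), (∀ n, Measurable (f n)) →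
    (∀ n x, ‖f n x‖ ≤ M) → (∀ x, Tendsto (fun n => f n x) atTop (𝓝 (g x))) →
    ∀ ψ : K, Tendsto (fun n => Φ (f n) ψ) atTop (𝓝 (Φ g ψ))
  resolvent_right : ∀ z : ℂ, z.im ≠ 0 → ∀ ψ : K,
    ∃ h : Φ (fun x => ((x : ℂ) - z)⁻¹) ψ ∈ H.domain,
      H ⟨Φ (fun x => ((x : ℂ) - z)⁻¹) ψ, h⟩ - z • Φ (fun x => ((x : ℂ) - z)⁻¹) ψ = ψ
  resolvent_left : ∀ z : ℂ, z.im ≠ 0 → ∀ φ : H.domain,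
    Φ (fun x => ((x : ℂ) - z)⁻¹) (H φ - z • (φ : K)) = φ

open Classical in
/-- The operator `f(H)`, for a self-adjoint operator `H` and a bounded Borel function `f`, given by
the Borel functional calculus (the value is `0` by convention if `H` has no such calculus, which
does not happen for self-adjoint `H`). -/
def borelCalc [CompleteSpace K] (H : K →ₗ.[ℂ] K) (f : ℝ → ℂ) : K →L[ℂ] K :=
  if h : ∃ Φ : (ℝ → ℂ) → K →L[ℂ] K, IsBorelFunctionalCalculus H Φ then h.choose f else 0

/-- The propagator `e^{-itH}`. -/
def propagator [CompleteSpace K] (H : K →ₗ.[ℂ] K) (t : ℝ) : K →L[ℂ] K :=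
  borelCalc H fun x => Complex.exp (-(Complex.I * t * x))

/-- The spectral projection `χ_I(H)`. -/
def spectralProj [CompleteSpace K] (H : K →ₗ.[ℂ] K) (I : Set ℝ) : K →L[ℂ] K :=
  borelCalc H (I.indicator fun _ => 1)

/-- The Heisenberg-evolved operator `B(t) = e^{itH} B e^{-itH}`, with domain
`{ψ : e^{-itH} ψ ∈ D(B)}`. -/
def heisenberg [CompleteSpace K] (H B : K →ₗ.[ℂ] K) (t : ℝ) : K →ₗ.[ℂ] K where
  domain := B.domain.comap (propagator H t).toLinearMap
  toFun :=
    { toFun := fun ψ => propagator H (-t) (B ⟨propagator H t ψ.1, ψ.2⟩)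
      map_add' := by
        rintro ⟨a, ha⟩ ⟨b, hb⟩
        rw [← _root_.map_add, ← B.map_add]
        congr 2
        ext1
        exact (propagator H t).map_add a b
      map_smul' := by
        rintro c ⟨a, ha⟩
        rw [RingHom.id_apply, ← _root_.map_smul, ← B.map_smul]
        congr 2
        ext1
        exact (propagator H t).map_smul c a }

end Operators

/-! ### Schrödinger operators on `L²(ℝ^d)` -/

/-- `L²(ℝ^d; ℂ)`. -/
abbrev L2 (d : ℕ) : Type :=
  Lp ℂ 2 (volume : Measure (EuclideanSpace ℝ (Fin d)))

/-- The Sobolev space `H^s(ℝ^d)`, as a subspace of `L²(ℝ^d)`. -/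
def sobolevSpace (d : ℕ) (s : ℝ) : Submodule ℂ (L2 d) where
  carrier := {ψ | TemperedDistribution.MemSobolev s 2
    (Lp.toTemperedDistributionCLM ℂ (volume : Measure (EuclideanSpace ℝ (Fin d))) 2 ψ)}
  zero_mem' := by
    simp only [Set.mem_ofPred_eq, _root_.map_zero]
    exact TemperedDistribution.memSobolev_fun_zero _ _ s 2
  add_mem' := by
    intro a b ha hb
    simp only [Set.mem_ofPred_eq, _root_.map_add] at ha hb ⊢
    exact ha.add hb
  smul_mem' := by
    intro c a ha
    simp only [Set.mem_ofPred_eq, _root_.map_smul] at ha ⊢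
    exact ha.smul c

/-- For `ψ ∈ H²(ℝ^d)` the distribution `-Δψ` is represented by a function in `L²(ℝ^d)`. -/
theorem exists_neg_laplacian {d : ℕ} (ψ : sobolevSpace d 2) :
    ∃ η : L2 d,
      Lp.toTemperedDistributionCLM ℂ (volume : Measure (EuclideanSpace ℝ (Fin d))) 2 η =
      -Δ (Lp.toTemperedDistributionCLM ℂ (volume : Measure (EuclideanSpace ℝ (Fin d))) 2
        (ψ : L2 d)) := by
  have h := TemperedDistribution.MemSobolev.laplacian ψ.2
  rw [sub_self, TemperedDistribution.memSobolev_zero_iff] at h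
  obtain ⟨η, hη⟩ := h
  refine ⟨-η, ?_⟩
  rw [_root_.map_neg, hη]
  rfl

theorem toTemperedDistribution_injective (d : ℕ) : Function.Injective
    (Lp.toTemperedDistributionCLM ℂ (volume : Measure (EuclideanSpace ℝ (Fin d))) 2) :=
  LinearMap.ker_eq_bot.1 Lp.ker_toTemperedDistributionCLM_eq_bot

/-- The free Hamiltonian `H₀ = -Δ` (distributional Laplacian) with domain `H²(ℝ^d)`. -/
def freeHamiltonian (d : ℕ) : L2 d →ₗ.[ℂ] L2 d where
  domain := sobolevSpace d 2
  toFun :=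
    { toFun := fun ψ => (exists_neg_laplacian ψ).choose
      map_add' := by
        intro a b
        apply toTemperedDistribution_injective d
        rw [_root_.map_add, (exists_neg_laplacian (a + b)).choose_spec,
          (exists_neg_laplacian a).choose_spec, (exists_neg_laplacian b).choose_spec]
        simp only [Submodule.coe_add, _root_.map_add]
        rw [← TemperedDistribution.laplacianCLM_apply, _root_.map_add, neg_add,
          TemperedDistribution.laplacianCLM_apply, TemperedDistribution.laplacianCLM_apply]
      map_smul' := by
        intro c a
        apply toTemperedDistribution_injective d
        rw [RingHom.id_apply, _root_.map_smul, (exists_neg_laplacian (c • a)).choose_spec,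
          (exists_neg_laplacian a).choose_spec]
        simp only [Submodule.coe_smul, _root_.map_smul]
        rw [← TemperedDistribution.laplacianCLM_apply, _root_.map_smul, ← smul_neg,
          TemperedDistribution.laplacianCLM_apply] }

/-- The maximal domain `{ψ ∈ L² : g ψ ∈ L²}` of multiplication by the real function `g`. -/
def mulDomain {d : ℕ} (g : EuclideanSpace ℝ (Fin d) → ℝ) : Submodule ℂ (L2 d) where
  carrier := {ψ | MemLp (fun x => (g x : ℂ) * ψ x) 2 volume}
  zero_mem' := by
    refine MemLp.ae_eq ?_ (MemLp.zero (p := 2) (μ := volume))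
    filter_upwards [Lp.coeFn_zero ℂ 2 (volume : Measure (EuclideanSpace ℝ (Fin d)))] with x hx
    rw [hx, Pi.zero_apply, mul_zero]
  add_mem' := by
    intro a b ha hb
    refine MemLp.ae_eq ?_ (MemLp.add ha hb)
    filter_upwards [Lp.coeFn_add a b] with x hx
    rw [hx, Pi.add_apply, Pi.add_apply, mul_add]
  smul_mem' := by
    intro c a ha
    refine MemLp.ae_eq ?_ (MemLp.const_smul ha c)
    filter_upwards [Lp.coeFn_smul c a] with x hx
    rw [hx, Pi.smul_apply, Pi.smul_apply, smul_eq_mul, smul_eq_mul, mul_left_comm]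

theorem mulDomain_memLp {d : ℕ} {g : EuclideanSpace ℝ (Fin d) → ℝ} (ψ : mulDomain g) :
    MemLp (fun x => (g x : ℂ) * (ψ : L2 d) x) 2 volume := ψ.2

/-- The operator of multiplication by the real function `g`, on its maximal domain. -/
def mulOp {d : ℕ} (g : EuclideanSpace ℝ (Fin d) → ℝ) : L2 d →ₗ.[ℂ] L2 d where
  domain := mulDomain g
  toFun :=
    { toFun := fun ψ => (mulDomain_memLp ψ).toLp _
      map_add' := by
        intro a b
        rw [← MemLp.toLp_add, MemLp.toLp_eq_toLp_iff]
        filter_upwards [Lp.coeFn_add (a : L2 d) (b : L2 d)] with x hx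
        rw [Submodule.coe_add, hx, Pi.add_apply, Pi.add_apply, mul_add]
      map_smul' := by
        intro c a
        rw [RingHom.id_apply, ← MemLp.toLp_const_smul, MemLp.toLp_eq_toLp_iff]
        filter_upwards [Lp.coeFn_smul c (a : L2 d)] with x hx
        rw [Submodule.coe_smul, hx, Pi.smul_apply, Pi.smul_apply, smul_eq_mul, smul_eq_mul,
          mul_left_comm] }

/-- The Hamiltonian `H = -Δ + V`; for bounded `V` its domain is `H²(ℝ^d)`. -/
def hamiltonian {d : ℕ} (V : EuclideanSpace ℝ (Fin d) → ℝ) : L2 d →ₗ.[ℂ] L2 d :=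
  freeHamiltonian d + mulOp V

/-- The position operator `Q ψ = (q₁ ψ, …, q_d ψ)` on `D(Q) = {ψ : ‖Q ψ‖ < ∞}`. -/
def position (d : ℕ) : L2 d →ₗ.[ℂ] PiLp 2 (fun _ : Fin d => L2 d) :=
  tupleOp fun j => mulOp fun x => x j

/-- The Heisenberg-evolved position operator `Q(t) = (Q₁(t), …, Q_d(t))`,
`Q_j(t) = e^{itH} Q_j e^{-itH}`. -/
def positionAt {d : ℕ} (V : EuclideanSpace ℝ (Fin d) → ℝ) (t : ℝ) :
    L2 d →ₗ.[ℂ] PiLp 2 (fun _ : Fin d => L2 d) :=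
  tupleOp fun j => heisenberg (hamiltonian V) (mulOp fun x => x j) t

/-- `A = [Q², H]`: the closure of the commutator of `Q²` (multiplication by `|q|²`) and `H`. -/
def conjugateOp {d : ℕ} (V : EuclideanSpace ℝ (Fin d) → ℝ) : L2 d →ₗ.[ℂ] L2 d :=
  (opCommutator (mulOp fun x => ‖x‖ ^ 2) (hamiltonian V)).closure

/-- The strict Mourre estimate `χ_I(H) [H, A] χ_I(H) ≥ α χ_I(H)`, `A = [Q², H]`, in the sense of
quadratic forms. As usual the commutator is the form on `D(H) ∩ D(A)` given by
`⟨φ, [H, A] φ⟩ = ⟨H φ, A φ⟩ - ⟨A* φ, H φ⟩ = ⟨H φ, A φ⟩ + ⟨A φ, H φ⟩`, since `A* = -A`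
(`A` is a commutator of two symmetric operators). -/
def StrictMourre {d : ℕ} (V : EuclideanSpace ℝ (Fin d) → ℝ) (I : Set ℝ) (α : ℝ) : Prop :=
  ∀ (φ : L2 d) (hH : spectralProj (hamiltonian V) I φ ∈ (hamiltonian V).domain)
    (hA : spectralProj (hamiltonian V) I φ ∈ (conjugateOp V).domain),
    α * (⟪φ, spectralProj (hamiltonian V) I φ⟫).re ≤
      (⟪hamiltonian V ⟨_, hH⟩, conjugateOp V ⟨_, hA⟩⟫ +
        ⟪conjugateOp V ⟨_, hA⟩, hamiltonian V ⟨_, hH⟩⟫).re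

/-- Ballistic transport of the state `ψ` in the norm-growth sense:
`c t² ≤ ‖|Q|(t) ψ‖² ≤ C t²` for `t ≥ 1`, with constants `c, C > 0`. -/
def NormGrowthBallistic {d : ℕ} (V : EuclideanSpace ℝ (Fin d) → ℝ) (ψ : L2 d) : Prop :=
  ∃ c C : ℝ, 0 < c ∧ 0 < C ∧ ∀ t : ℝ, 1 ≤ t →
    ∃ h : ψ ∈ (heisenberg (hamiltonian V) (mulOp fun x => ‖x‖) t).domain,
      c * t ^ 2 ≤ ‖heisenberg (hamiltonian V) (mulOp fun x => ‖x‖) t ⟨ψ, h⟩‖ ^ 2 ∧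
      ‖heisenberg (hamiltonian V) (mulOp fun x => ‖x‖) t ⟨ψ, h⟩‖ ^ 2 ≤ C * t ^ 2

end

set_option linter.unusedSectionVars false

/-! ### Graphs of unbounded operators -/

section Graphs

variable {K : Type*} [NormedAddCommGroup K] [InnerProductSpace ℂ K]

/-! Write `φ_t = e^{-itH} φ` and `f(t) = ‖Q φ_t‖²`. For regular `φ`, `f' = -i⟨φ_t, A φ_t⟩` and `f''
= ⟨H φ_t, A φ_t⟩ + ⟨A φ_t, H φ_t⟩`. The flow preserves the range of `χ_I(H)`, so there the Mourre
estimate gives `f'' ≥ α‖φ‖²`, and two integrations give `f(t) ≥ f(0) + t f'(0) + α‖φ‖² t²/2`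
(`growth_of_commutator_bound`). Linear growth from above comes from the Heisenberg equation
`dQ_j(t)/dt = 2 P_j(t)` (`flow_mem_position`): energy is conserved and `V` is bounded, so the
momenta of `φ_t` stay bounded (`exists_position_flow_le`).

The difficulty is domains, since `ψ` in `D(Q) ∩ H¹` need not lie in `D(H)` or `D(A)`. It is replaced
by `J_r² ψ` with `J_r = (1 + iH/r)⁻¹`. This operator commutes with the flow and with `χ_I(H)`, keeps
`D(Q_j)` up to an error of order `1/r`, and raises the kinetic energy by a bounded amount only. All
constants are thus uniform in `r`, and `r → ∞` gives `‖Q ψ_t‖² ≥ α‖ψ‖² t²/2 - B t`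
(`exists_quadratic_lower_bound`). On the range of the resolvent `A` acts as `∑ (4i P_j Q_j - 2)`,
and `P_j (H - ir)⁻¹` is bounded; this puts `φ_t` in `D(A)` at every time, with `A φ_t` continuous in
`t` (`closure_commutator_of_res`). Position enters through the unitary groups `e^{i s q_j}`: its
domain consists of the vectors with bounded difference quotients, and these groups move `H` and
`P_j` by explicit terms.

The constant `B` does not depend on `α`, which settles large times. For small times, `‖min(|q|, 1)
ψ_t‖` is continuous and never zero. The upper bound at `t = 1` bounds every admissible `α`, so a
bound linear in `α` follows from one that is free of `α` (`exists_ballistic_bounds`). `PhaseSpace`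
collects the relations used, and `phaseSpace_hamiltonian` verifies them by the Fourier transform. -/

theorem mem_graph_opComp {S T : K →ₗ.[ℂ] K} {a b c : K} (hT : (a, b) ∈ T.graph)
    (hS : (b, c) ∈ S.graph) : (a, c) ∈ (opComp S T).graph := by
  obtain ⟨⟨a', ha'⟩, ha, hb⟩ := (LinearPMap.mem_graph_iff T).1 hT
  obtain ⟨⟨b', hb'⟩, hb2, hc⟩ := (LinearPMap.mem_graph_iff S).1 hS
  dsimp only at ha hb hb2 hc
  subst ha hb2 hb
  exact (LinearPMap.mem_graph_iff _).2 ⟨⟨a', ha', hb'⟩, rfl, hc⟩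

theorem exists_of_mem_graph_opComp {S T : K →ₗ.[ℂ] K} {a c : K}
    (h : (a, c) ∈ (opComp S T).graph) : ∃ b, (a, b) ∈ T.graph ∧ (b, c) ∈ S.graph := by
  obtain ⟨⟨a', ha'⟩, ha, hc⟩ := (LinearPMap.mem_graph_iff _).1 h
  dsimp only at ha hc
  subst ha
  refine ⟨T ⟨a', ha'.choose⟩, T.mem_graph ⟨a', ha'.choose⟩, ?_⟩
  rw [← hc]
  exact S.mem_graph ⟨T ⟨a', ha'.choose⟩, ha'.choose_spec⟩

theorem mem_graph_sub {S T : K →ₗ.[ℂ] K} {a b c : K} (hS : (a, b) ∈ S.graph)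
    (hT : (a, c) ∈ T.graph) : (a, b - c) ∈ (S - T).graph := by
  obtain ⟨⟨a', ha'⟩, ha, hb⟩ := (LinearPMap.mem_graph_iff S).1 hS
  obtain ⟨⟨a'', ha''⟩, ha2, hc⟩ := (LinearPMap.mem_graph_iff T).1 hT
  dsimp only at ha hb ha2 hc
  subst ha ha2 hb hc
  exact (LinearPMap.mem_graph_iff _).2 ⟨⟨a'', ha', ha''⟩, rfl, LinearPMap.sub_apply _ _ _⟩

theorem exists_of_mem_graph_sub {S T : K →ₗ.[ℂ] K} {a d : K} (h : (a, d) ∈ (S - T).graph) :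
    ∃ b c, (a, b) ∈ S.graph ∧ (a, c) ∈ T.graph ∧ d = b - c := by
  obtain ⟨⟨a', ha'⟩, ha, hc⟩ := (LinearPMap.mem_graph_iff _).1 h
  dsimp only at ha hc
  subst ha
  exact ⟨S ⟨a', ha'.1⟩, T ⟨a', ha'.2⟩, S.mem_graph ⟨a', ha'.1⟩, T.mem_graph ⟨a', ha'.2⟩,
    hc.symm.trans (LinearPMap.sub_apply _ _ _)⟩

theorem mem_graph_add {S T : K →ₗ.[ℂ] K} {a b c : K} (hS : (a, b) ∈ S.graph)
    (hT : (a, c) ∈ T.graph) : (a, b + c) ∈ (S + T).graph := by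
  obtain ⟨⟨a', ha'⟩, ha, hb⟩ := (LinearPMap.mem_graph_iff S).1 hS
  obtain ⟨⟨a'', ha''⟩, ha2, hc⟩ := (LinearPMap.mem_graph_iff T).1 hT
  dsimp only at ha hb ha2 hc
  subst ha ha2 hb hc
  exact (LinearPMap.mem_graph_iff _).2 ⟨⟨a'', ha', ha''⟩, rfl, LinearPMap.add_apply _ _ _⟩

theorem exists_of_mem_graph_add {S T : K →ₗ.[ℂ] K} {a d : K} (h : (a, d) ∈ (S + T).graph) :
    ∃ b c, (a, b) ∈ S.graph ∧ (a, c) ∈ T.graph ∧ d = b + c := by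
  obtain ⟨⟨a', ha'⟩, ha, hc⟩ := (LinearPMap.mem_graph_iff _).1 h
  dsimp only at ha hc
  subst ha
  exact ⟨S ⟨a', ha'.1⟩, T ⟨a', ha'.2⟩, S.mem_graph ⟨a', ha'.1⟩, T.mem_graph ⟨a', ha'.2⟩,
    hc.symm.trans (LinearPMap.add_apply _ _ _)⟩

/-- `S` and `T` are formally adjoint up to the scalar `c`. -/
def GraphAdjoint (c : ℂ) (G : Submodule ℂ (K × K)) : Prop :=
  ∀ a b a' b', (a, b) ∈ G → (a', b') ∈ G → ⟪b, a'⟫ = c * ⟪a, b'⟫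

/-- The relation is continuous in each of the two pairs separately, so it passes to the closure one
pair at a time. -/
theorem GraphAdjoint.topologicalClosure {c : ℂ} {G : Submodule ℂ (K × K)}
    (h : GraphAdjoint c G) : GraphAdjoint c G.topologicalClosure := by
  have h1 : ∀ a b, (a, b) ∈ G → ∀ p ∈ G.topologicalClosure, ⟪b, p.1⟫ = c * ⟪a, p.2⟫ := by
    intro a b hab p hp
    have hcl : IsClosed {p : K × K | ⟪b, p.1⟫ = c * ⟪a, p.2⟫} :=
      isClosed_eq (by fun_prop) (by fun_prop)
    exact hcl.closure_subset_iff.2 (fun q hq => h _ _ _ _ hab hq) hp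
  intro a b a' b' hab hab'
  have hcl : IsClosed {p : K × K | ⟪p.2, a'⟫ = c * ⟪p.1, b'⟫} :=
    isClosed_eq (by fun_prop) (by fun_prop)
  exact hcl.closure_subset_iff.2 (fun q hq => h1 _ _ hq _ hab') hab

/-- If `(0, w)` is a limit of points of the graph, the adjointness relation makes `w` orthogonal to
the domain, and density forces `w = 0`. -/
theorem GraphAdjoint.isClosable {c : ℂ} {T : K →ₗ.[ℂ] K} (h : GraphAdjoint c T.graph)
    (hd : Dense (T.domain : Set K)) : T.IsClosable := by
  refine ⟨T.graph.topologicalClosure.toLinearPMap, ?_⟩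
  symm
  apply Submodule.toLinearPMap_graph_eq
  rintro ⟨a, w⟩ hx (rfl : a = 0)
  have hcl : IsClosed {p : K × K | ∀ q ∈ T.graph, ⟪q.2, p.1⟫ = c * ⟪q.1, p.2⟫} := by
    simp only [Set.ofPred_forall]
    exact isClosed_biInter fun q _ => isClosed_eq (by fun_prop) (by fun_prop)
  have h2 := hcl.closure_subset_iff.2 (fun q hq r hr => h _ _ _ _ hr hq) hx
  have hcl' : IsClosed {p : K × K | ∀ q ∈ T.graph, ⟪p.2, q.1⟫ = c * ⟪p.1, q.2⟫} := by
    simp only [Set.ofPred_forall]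
    exact isClosed_biInter fun q _ => isClosed_eq (by fun_prop) (by fun_prop)
  have h3 := hcl'.closure_subset_iff.2 (fun q hq r hr => h _ _ _ _ hq hr) hx
  have h4 : ∀ q ∈ T.domain, ⟪w, q⟫ = 0 := by
    intro q hq
    simpa using h3 (q, T ⟨q, hq⟩) (T.mem_graph ⟨q, hq⟩)
  exact hd.eq_zero_of_inner_left ℂ h4

end Graphs

/-! ### Consequences of the Borel functional calculus -/

section Resolvent

theorem isBoundedBorel_resolvent {z : ℂ} (hz : z.im ≠ 0) :
    IsBoundedBorel fun x : ℝ => ((x : ℂ) - z)⁻¹ := by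
  refine ⟨by fun_prop, |z.im|⁻¹, fun x => ?_⟩
  rw [norm_inv]
  refine inv_anti₀ (abs_pos.2 hz) ?_
  have := Complex.abs_im_le_norm ((x : ℂ) - z)
  simpa using this

theorem isBoundedBorel_exp (t : ℝ) :
    IsBoundedBorel fun x : ℝ => Complex.exp (-(Complex.I * t * x)) := by
  refine ⟨by fun_prop, 1, fun x => ?_⟩
  rw [Complex.norm_exp]
  simp

theorem isBoundedBorel_indicator {I : Set ℝ} (hI : MeasurableSet I) :
    IsBoundedBorel (I.indicator fun _ => 1) := by
  refine ⟨measurable_const.indicator hI, 1, fun x => ?_⟩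
  refine (norm_indicator_le_norm_self _ _).trans ?_
  simp

variable {K : Type*} [NormedAddCommGroup K] [InnerProductSpace ℂ K] [CompleteSpace K]
  {H : K →ₗ.[ℂ] K} {Φ : (ℝ → ℂ) → K →L[ℂ] K}

namespace IsBorelFunctionalCalculus

theorem comm (h : IsBorelFunctionalCalculus H Φ) {f g : ℝ → ℂ} (hf : IsBoundedBorel f)
    (hg : IsBoundedBorel g) (a : K) : Φ f (Φ g a) = Φ g (Φ f a) := by
  have h1 := h.map_mul f g hf hg
  have h2 := h.map_mul g f hg hf
  simp only [mul_comm (g _)] at h2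
  rw [h1] at h2
  exact congrArg (fun T : K →L[ℂ] K => T a) h2

theorem resolvent_mem_graph (h : IsBorelFunctionalCalculus H Φ) {z : ℂ} (hz : z.im ≠ 0) (a : K) :
    (Φ (fun x => ((x : ℂ) - z)⁻¹) a, a + z • Φ (fun x => ((x : ℂ) - z)⁻¹) a) ∈ H.graph := by
  obtain ⟨h1, h2⟩ := h.resolvent_right z hz a
  refine (LinearPMap.mem_graph_iff _).2 ⟨⟨_, h1⟩, rfl, ?_⟩
  exact eq_add_of_sub_eq h2

theorem resolvent_of_mem_graph (h : IsBorelFunctionalCalculus H Φ) {z : ℂ} (hz : z.im ≠ 0)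
    {a b : K} (hab : (a, b) ∈ H.graph) : Φ (fun x => ((x : ℂ) - z)⁻¹) (b - z • a) = a := by
  obtain ⟨⟨a', ha'⟩, ha, hb⟩ := (LinearPMap.mem_graph_iff _).1 hab
  dsimp only at ha hb
  subst ha hb
  exact h.resolvent_left z hz ⟨a', ha'⟩

/-- A vector of `D(H)` is the resolvent applied to some vector, and `Φ f` commutes with the
resolvent. -/
theorem map_mem_graph (h : IsBorelFunctionalCalculus H Φ) {f : ℝ → ℂ} (hf : IsBoundedBorel f)
    {a b : K} (hab : (a, b) ∈ H.graph) : (Φ f a, Φ f b) ∈ H.graph := by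
  have hz : Complex.I.im ≠ 0 := by simp
  have h1 := h.resolvent_of_mem_graph hz hab
  have h2 := h.resolvent_mem_graph hz (Φ f (b - Complex.I • a))
  rw [← h.comm hf (isBoundedBorel_resolvent hz), h1] at h2
  simpa using h2

/-- Symmetry of `H` is read off from the calculus: by `map_conj` the resolvents at `i` and `-i` are
adjoint to each other. -/
theorem graphAdjoint (h : IsBorelFunctionalCalculus H Φ) : GraphAdjoint 1 H.graph := by
  intro a b c e hab hce
  have hz : Complex.I.im ≠ 0 := by simp
  have hz' : ((starRingEnd ℂ) Complex.I).im ≠ 0 := by simp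
  have h1 := h.resolvent_of_mem_graph hz hab
  have h2 := h.resolvent_of_mem_graph hz' hce
  have h3 := h.map_conj _ (isBoundedBorel_resolvent hz)
  simp only [map_inv₀, map_sub, Complex.conj_ofReal] at h3
  have h4 : ⟪a, e - (starRingEnd ℂ) Complex.I • c⟫ = ⟪b - Complex.I • a, c⟫ := by
    conv_lhs => rw [← h1]
    conv_rhs => rw [← h2]
    rw [h3, ContinuousLinearMap.adjoint_inner_right]
  rw [inner_sub_left, inner_sub_right, inner_smul_left, inner_smul_right] at h4
  linear_combination -h4

end IsBorelFunctionalCalculus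

/-- The unitary group `e^{-itH}` of a functional calculus. -/
noncomputable def flow (Φ : (ℝ → ℂ) → K →L[ℂ] K) (t : ℝ) : K →L[ℂ] K :=
  Φ fun x => Complex.exp (-(Complex.I * t * x))

/-- The resolvent `(H - ir)⁻¹` of a functional calculus. -/
noncomputable def res (Φ : (ℝ → ℂ) → K →L[ℂ] K) (r : ℝ) : K →L[ℂ] K :=
  Φ fun x => ((x : ℂ) - r * Complex.I)⁻¹

/-- The Yosida approximation `(1 + iH/r)⁻¹` of the identity. -/
noncomputable def yosida (Φ : (ℝ → ℂ) → K →L[ℂ] K) (r : ℝ) : K →L[ℂ] K :=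
  (-(r * Complex.I)) • res Φ r

theorem isBoundedBorel_res {r : ℝ} (hr : r ≠ 0) :
    IsBoundedBorel fun x : ℝ => ((x : ℂ) - r * Complex.I)⁻¹ :=
  isBoundedBorel_resolvent (by simpa using hr)

namespace IsBorelFunctionalCalculus

theorem flow_mem_graph (h : IsBorelFunctionalCalculus H Φ) (t : ℝ) {a b : K}
    (hab : (a, b) ∈ H.graph) : (flow Φ t a, flow Φ t b) ∈ H.graph :=
  h.map_mem_graph (isBoundedBorel_exp t) hab

theorem res_mem_graph (h : IsBorelFunctionalCalculus H Φ) {r : ℝ} (hr : r ≠ 0) (a : K) :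
    (res Φ r a, a + (r * Complex.I) • res Φ r a) ∈ H.graph :=
  h.resolvent_mem_graph (by simpa using hr) a

theorem res_of_mem_graph (h : IsBorelFunctionalCalculus H Φ) {r : ℝ} (hr : r ≠ 0)
    {a b : K} (hab : (a, b) ∈ H.graph) : res Φ r (b - (r * Complex.I) • a) = a :=
  h.resolvent_of_mem_graph (by simpa using hr) hab

theorem res_flow (h : IsBorelFunctionalCalculus H Φ) {r : ℝ} (hr : r ≠ 0) (t : ℝ) (a : K) :
    res Φ r (flow Φ t a) = flow Φ t (res Φ r a) :=
  h.comm (isBoundedBorel_res hr) (isBoundedBorel_exp t) a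

theorem yosida_flow (h : IsBorelFunctionalCalculus H Φ) {r : ℝ} (hr : r ≠ 0) (t : ℝ) (a : K) :
    yosida Φ r (flow Φ t a) = flow Φ t (yosida Φ r a) := by
  simp [yosida, h.res_flow hr]

theorem yosida_mem_graph (h : IsBorelFunctionalCalculus H Φ) {r : ℝ} (hr : r ≠ 0) (a : K) :
    (yosida Φ r a, (-(r * Complex.I)) • (a - yosida Φ r a)) ∈ H.graph := by
  have := H.graph.smul_mem (-(r * Complex.I)) (h.res_mem_graph hr a)
  convert this using 1
  simp only [yosida, Prod.smul_mk, smul_apply]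
  congr 1
  module

/-- The calculus carries no norm estimate, so symmetry is used instead: for `c = J_r a` one has `H c
= -ir(a - c)`, and reality of `⟨H c, c⟩` gives `Re⟨a, c⟩ = ‖c‖²`. Cauchy-Schwarz finishes. -/
theorem norm_yosida_le (h : IsBorelFunctionalCalculus H Φ) {r : ℝ} (hr : r ≠ 0) (a : K) :
    ‖yosida Φ r a‖ ≤ ‖a‖ := by
  have h1 := h.yosida_mem_graph hr a
  set c := yosida Φ r a
  have h2 := h.graphAdjoint _ _ _ _ h1 h1
  rw [inner_smul_left, inner_smul_right, one_mul, inner_sub_left, inner_sub_right] at h2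
  have h3 : (⟪a, c⟫ + ⟪c, a⟫ : ℂ) = 2 * ⟪c, c⟫ := by
    have : (r * Complex.I : ℂ) ≠ 0 := by simpa using hr
    apply mul_left_cancel₀ this
    simp only [map_neg, _root_.map_mul, Complex.conj_ofReal, Complex.conj_I] at h2
    linear_combination h2
  have h4 := congrArg Complex.re h3
  rw [inner_self_eq_norm_sq_to_K] at h4
  have h5 : (⟪a, c⟫ : ℂ).re ≤ ‖a‖ * ‖c‖ := (Complex.re_le_norm _).trans (norm_inner_le_norm _ _)
  have h6 : (⟪c, a⟫ : ℂ).re ≤ ‖c‖ * ‖a‖ := (Complex.re_le_norm _).trans (norm_inner_le_norm _ _)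
  have h7 : ((2 : ℂ) * (((‖c‖ : ℝ) : ℂ)) ^ 2).re = 2 * ‖c‖ ^ 2 := by
    rw [← Complex.ofReal_pow, two_mul, two_mul, Complex.add_re, Complex.ofReal_re]
  rw [Complex.add_re] at h4
  have h8 : 2 * ‖c‖ ^ 2 ≤ 2 * (‖a‖ * ‖c‖) := by
    rw [← h7]; refine h4.symm.le.trans ?_; linarith
  by_contra! hlt
  nlinarith [norm_nonneg a, norm_nonneg c]

/-- The symbols `-ir/(x - ir)` are bounded by `1` and converge pointwise to `1`. -/
theorem tendsto_yosida (h : IsBorelFunctionalCalculus H Φ) (a : K) :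
    Tendsto (fun n : ℕ => yosida Φ ((n : ℝ) + 1) a) atTop (𝓝 a) := by
  have hr : ∀ n : ℕ, ((n : ℝ) + 1) ≠ 0 := fun n => by positivity
  have h1 := h.tendsto (fun (n : ℕ) (x : ℝ) => (-((((n : ℝ) + 1 : ℝ) : ℂ) * Complex.I)) *
    ((x : ℂ) - (((n : ℝ) + 1 : ℝ) : ℂ) * Complex.I)⁻¹) (fun _ => 1) 1 (fun n => by fun_prop) ?_ ?_ a
  · rw [h.map_one] at h1
    refine h1.congr fun n => ?_
    rw [h.map_smul _ _ (isBoundedBorel_res (hr n))]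
    rfl
  · intro n x
    rw [norm_mul, norm_inv, norm_neg, norm_mul, Complex.norm_I, mul_one, Complex.norm_real,
      ← div_eq_mul_inv]
    apply div_le_one_of_le₀ _ (norm_nonneg _)
    have := Complex.abs_im_le_norm ((x : ℂ) - (((n : ℝ) + 1 : ℝ) : ℂ) * Complex.I)
    rwa [Complex.sub_im, Complex.ofReal_im, Complex.im_ofReal_mul, Complex.I_im, mul_one, zero_sub,
      abs_neg] at this
  · intro x
    have h2 : Tendsto (fun n : ℕ => (1 + Complex.I * ((x * ((n : ℝ) + 1)⁻¹ : ℝ) : ℂ))⁻¹) atTop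
        (𝓝 (1 + Complex.I * ((x * 0 : ℝ) : ℂ))⁻¹) := by
      refine Tendsto.inv₀ ?_ (by simp)
      refine tendsto_const_nhds.add (tendsto_const_nhds.mul ?_)
      refine (Complex.continuous_ofReal.tendsto _).comp (tendsto_const_nhds.mul ?_)
      simpa [one_div] using tendsto_one_div_add_atTop_nhds_zero_nat (𝕜 := ℝ)
    simp only [mul_zero, Complex.ofReal_zero, add_zero, inv_one] at h2
    refine h2.congr fun n => ?_
    have h3 : (((n : ℝ) + 1 : ℝ) : ℂ) ≠ 0 := by exact_mod_cast hr n
    have h4 : ((x : ℂ) - (((n : ℝ) + 1 : ℝ) : ℂ) * Complex.I) ≠ 0 := by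
      intro h0
      have := congrArg Complex.im h0
      rw [Complex.sub_im, Complex.ofReal_im, Complex.im_ofReal_mul, Complex.I_im, mul_one, zero_sub,
        Complex.zero_im, neg_eq_zero] at this
      exact hr n this
    have h5 : (1 + Complex.I * ((x * ((n : ℝ) + 1)⁻¹ : ℝ) : ℂ)) =
        ((x : ℂ) - (((n : ℝ) + 1 : ℝ) : ℂ) * Complex.I) *
          (-((((n : ℝ) + 1 : ℝ) : ℂ) * Complex.I))⁻¹ := by
      rw [← neg_mul, mul_inv, Complex.inv_I, inv_neg, neg_mul_neg]
      push_cast at h3 ⊢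
      field_simp
      linear_combination ((n : ℂ) + 1) * Complex.I_sq
    rw [h5, mul_inv, inv_inv, mul_comm]

/-! ### The unitary group `e^{-itH}`. -/

theorem adjoint_flow (h : IsBorelFunctionalCalculus H Φ) (t : ℝ) :
    ContinuousLinearMap.adjoint (flow Φ t) = flow Φ (-t) := by
  rw [flow, ← h.map_conj _ (isBoundedBorel_exp t), flow]
  congr 1
  ext x
  rw [← Complex.exp_conj]
  simp

theorem flow_add (h : IsBorelFunctionalCalculus H Φ) (s t : ℝ) (a : K) :
    flow Φ (s + t) a = flow Φ s (flow Φ t a) := by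
  rw [flow, flow, flow, ← mul_apply_eq_comp,
    ← h.map_mul _ _ (isBoundedBorel_exp s) (isBoundedBorel_exp t)]
  congr 2
  ext x
  rw [← Complex.exp_add]
  push_cast
  ring_nf

theorem flow_zero (h : IsBorelFunctionalCalculus H Φ) (a : K) : flow Φ 0 a = a := by
  have := h.map_one
  simp [flow, this]

theorem flow_neg_flow (h : IsBorelFunctionalCalculus H Φ) (t : ℝ) (a : K) :
    flow Φ (-t) (flow Φ t a) = a := by
  rw [← h.flow_add, neg_add_cancel, h.flow_zero]

theorem flow_flow_neg (h : IsBorelFunctionalCalculus H Φ) (t : ℝ) (a : K) :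
    flow Φ t (flow Φ (-t) a) = a := by
  rw [← h.flow_add, add_neg_cancel, h.flow_zero]

theorem inner_flow_flow (h : IsBorelFunctionalCalculus H Φ) (t : ℝ) (a b : K) :
    ⟪flow Φ t a, flow Φ t b⟫ = ⟪a, b⟫ := by
  rw [← ContinuousLinearMap.adjoint_inner_right, h.adjoint_flow, h.flow_neg_flow]

theorem norm_flow (h : IsBorelFunctionalCalculus H Φ) (t : ℝ) (a : K) :
    ‖flow Φ t a‖ = ‖a‖ := by
  rw [@norm_eq_sqrt_re_inner ℂ, h.inner_flow_flow, ← @norm_eq_sqrt_re_inner ℂ]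

theorem continuous_flow (h : IsBorelFunctionalCalculus H Φ) (a : K) :
    Continuous fun t => flow Φ t a := by
  refine continuous_iff_seqContinuous.2 fun u t hu => ?_
  refine h.tendsto _ _ 1 (fun n => (isBoundedBorel_exp (u n)).1) (fun n x => ?_) (fun x => ?_) a
  · rw [Complex.norm_exp]
    simp
  · have : Continuous fun s : ℝ => Complex.exp (-(Complex.I * s * x)) := by fun_prop
    exact (this.tendsto t).comp hu

theorem tendsto_flow_apply (h : IsBorelFunctionalCalculus H Φ) {ι : Type*} {l : Filter ι}
    {s : ι → ℝ} {t : ℝ} (hs : Tendsto s l (𝓝 t)) {a : ι → K} {b : K}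
    (ha : Tendsto a l (𝓝 b)) : Tendsto (fun i => flow Φ (s i) (a i)) l (𝓝 (flow Φ t b)) := by
  have h1 : Tendsto (fun i => flow Φ (s i) (a i - b)) l (𝓝 0) := by
    rw [tendsto_zero_iff_norm_tendsto_zero]
    simp only [h.norm_flow]
    rw [← tendsto_zero_iff_norm_tendsto_zero, ← sub_self b]
    exact ha.sub tendsto_const_nhds
  have h2 := h1.add (((h.continuous_flow b).tendsto t).comp hs)
  rw [zero_add] at h2
  refine h2.congr fun i => ?_
  simp

theorem continuous_flow_apply (h : IsBorelFunctionalCalculus H Φ) {s : ℝ → ℝ}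
    (hs : Continuous s) {a : ℝ → K} (ha : Continuous a) :
    Continuous fun t => flow Φ (s t) (a t) :=
  continuous_iff_continuousAt.2 fun t => h.tendsto_flow_apply (hs.tendsto t) (ha.tendsto t)

/-- Write `a = (H - i)⁻¹ η`. The difference quotient is then the calculus of `u⁻¹(e^{-iux} - 1)(x -
i)⁻¹` applied to `η`. This symbol is bounded by `1`, because `|e^{iy} - 1| ≤ |y|` and `|x| ≤ |x -
i|`, and it tends to `-ix/(x - i)`. -/
theorem hasDerivAt_flow_zero (h : IsBorelFunctionalCalculus H Φ) {a b : K}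
    (hab : (a, b) ∈ H.graph) : HasDerivAt (fun t => flow Φ t a) (-Complex.I • b) 0 := by
  have h1 := h.res_of_mem_graph one_ne_zero hab
  have hR := isBoundedBorel_res one_ne_zero
  rw [hasDerivAt_iff_tendsto_slope]
  refine tendsto_of_seq_tendsto fun u hu => ?_
  have hu0 : Tendsto u atTop (𝓝 0) := hu.mono_right nhdsWithin_le_nhds
  have hune : ∀ᶠ n in atTop, u n ≠ 0 := hu.eventually self_mem_nhdsWithin
  set η := b - ((1 : ℝ) * Complex.I) • a
  -- The constant is kept as `(-1) * 1` so that `map_smul` followed by `map_one` evaluates it.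
  have hbd : ∀ s : ℝ, IsBoundedBorel fun x : ℝ =>
      ((s : ℂ)⁻¹ * (Complex.exp (-(Complex.I * s * x)) + (-1) * 1)) := by
    intro s
    refine ⟨by fun_prop, ‖(s : ℂ)⁻¹‖ * 2, fun x => ?_⟩
    rw [norm_mul]
    gcongr
    refine (norm_add_le _ _).trans ?_
    rw [Complex.norm_exp]
    simp
    norm_num
  have hx : ∀ x : ℝ, ((x : ℂ) - (1 : ℝ) * Complex.I) ≠ 0 := by
    intro x h0
    have := congrArg Complex.im h0
    simp at this
  have key := h.tendsto (fun n x => ((u n : ℂ)⁻¹ * (Complex.exp (-(Complex.I * u n * x)) + (-1) * 1)) *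
    ((x : ℂ) - (1 : ℝ) * Complex.I)⁻¹)
    (fun x => (-Complex.I) * (1 + ((1 : ℝ) * Complex.I) * ((x : ℂ) - (1 : ℝ) * Complex.I)⁻¹)) 1
    (fun n => (hbd _).1.mul hR.1) ?_ ?_ η
  · have h2 : Φ (fun x => (-Complex.I) *
        (1 + ((1 : ℝ) * Complex.I) * ((x : ℂ) - (1 : ℝ) * Complex.I)⁻¹)) η = -Complex.I • b := by
      have hb1 : IsBoundedBorel fun _ : ℝ => (1 : ℂ) := ⟨measurable_const, 1, by simp⟩
      have hb2 : IsBoundedBorel fun x : ℝ =>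
          ((1 : ℝ) * Complex.I) * ((x : ℂ) - (1 : ℝ) * Complex.I)⁻¹ := by
        obtain ⟨M, hM⟩ := hR.2
        refine ⟨hR.1.const_mul _, M, fun x => ?_⟩
        rw [norm_mul]
        simpa using hM x
      have hb3 : IsBoundedBorel fun x : ℝ =>
          (1 + ((1 : ℝ) * Complex.I) * ((x : ℂ) - (1 : ℝ) * Complex.I)⁻¹) := by
        obtain ⟨M, hM⟩ := hb2.2
        refine ⟨hb2.1.const_add _, 1 + M, fun x => (norm_add_le _ _).trans ?_⟩
        rw [norm_one]
        gcongr
        exact hM x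
      rw [h.map_smul _ _ hb3, h.map_add _ _ hb1 hb2, h.map_smul _ _ hR, h.map_one]
      have h1' : Φ (fun x : ℝ => ((x : ℂ) - (1 : ℝ) * Complex.I)⁻¹) η = a := h1
      simp only [smul_apply, add_apply, h1',
        one_apply_eq_self]
      congr 1
      exact sub_add_cancel _ _
    rw [h2] at key
    refine key.congr' ?_
    filter_upwards [hune] with n hn
    have hb1 : IsBoundedBorel fun _ : ℝ => (1 : ℂ) := ⟨measurable_const, 1, by simp⟩
    have hb2 : IsBoundedBorel fun _ : ℝ => (-1 : ℂ) * 1 := ⟨measurable_const, 1, by simp⟩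
    have hb3 : IsBoundedBorel fun x : ℝ => (Complex.exp (-(Complex.I * u n * x)) + (-1) * 1) := by
      refine ⟨by fun_prop, 2, fun x => ?_⟩
      refine (norm_add_le _ _).trans ?_
      rw [Complex.norm_exp]
      simp
      norm_num
    rw [h.map_mul _ _ (hbd _) hR, h.map_smul _ _ hb3, h.map_add _ _ (isBoundedBorel_exp (u n)) hb2,
      h.map_smul _ _ hb1, h.map_one]
    have h1' : Φ (fun x : ℝ => ((x : ℂ) - (1 : ℝ) * Complex.I)⁻¹) η = a := h1
    rw [mul_apply_eq_comp, h1', Function.comp_apply, slope_def_module, h.flow_zero]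
    simp only [smul_apply, add_apply,
      one_apply_eq_self, sub_zero, flow]
    rw [← Complex.coe_smul, Complex.ofReal_inv, neg_one_smul, ← sub_eq_add_neg]
  · intro n x
    rw [norm_mul, norm_mul]
    by_cases hn : u n = 0
    · simp [hn]
    have h3 : ‖Complex.exp (-(Complex.I * u n * x)) + (-1) * 1‖ ≤ |u n| * |x| := by
      have := Real.norm_exp_I_mul_ofReal_sub_one_le (x := -(u n * x))
      rw [norm_neg, norm_mul] at this
      refine le_trans (le_of_eq ?_) this
      congr 1
      push_cast
      ring_nf
    have h4 : |x| ≤ ‖(x : ℂ) - (1 : ℝ) * Complex.I‖ := by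
      have := Complex.abs_re_le_norm ((x : ℂ) - (1 : ℝ) * Complex.I)
      simpa using this
    rw [norm_inv, norm_inv, Complex.norm_real, Real.norm_eq_abs]
    have h5 : 0 < |u n| := abs_pos.2 hn
    have h6 : 0 < ‖(x : ℂ) - (1 : ℝ) * Complex.I‖ := norm_pos_iff.2 (hx x)
    rw [← div_eq_mul_inv, div_le_one h6, inv_mul_le_iff₀ h5]
    exact h3.trans (by gcongr)
  · intro x
    have h3 : HasDerivAt (fun s : ℝ => Complex.exp (-(Complex.I * s * x))) (-(Complex.I * x)) 0 := by
      have h4 : HasDerivAt (fun s : ℝ => (-(Complex.I * s * x))) (-(Complex.I * x)) 0 := by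
        have := ((Complex.ofRealCLM.hasDerivAt (x := (0 : ℝ))).const_mul Complex.I).mul_const (x : ℂ)
        convert! this.neg using 1; simp
      simpa using h4.cexp
    rw [hasDerivAt_iff_tendsto_slope] at h3
    have h5 := (h3.comp hu).mul_const ((x : ℂ) - (1 : ℝ) * Complex.I)⁻¹
    have h6 : -(Complex.I * x) * ((x : ℂ) - (1 : ℝ) * Complex.I)⁻¹ =
        (-Complex.I) * (1 + ((1 : ℝ) * Complex.I) * ((x : ℂ) - (1 : ℝ) * Complex.I)⁻¹) := by
      have := hx x
      simp only [Complex.ofReal_one, one_mul] at this ⊢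
      field_simp
      ring
    rw [h6] at h5
    refine h5.congr fun n => ?_
    rw [Function.comp_apply, slope_def_module, sub_zero, ← Complex.coe_smul, Complex.ofReal_inv,
      smul_eq_mul]
    simp [sub_eq_add_neg]

theorem hasDerivAt_flow (h : IsBorelFunctionalCalculus H Φ) {a b : K} (hab : (a, b) ∈ H.graph)
    (t : ℝ) : HasDerivAt (fun t => flow Φ t a) (-Complex.I • flow Φ t b) t := by
  have h1 := ((flow Φ t).restrictScalars ℝ).hasFDerivAt.comp_hasDerivAt (0 : ℝ)
    (h.hasDerivAt_flow_zero hab)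
  have h2 : HasDerivAt (fun s => s - t) 1 t := (hasDerivAt_id t).sub_const t
  have h3 := HasDerivAt.scomp_of_eq t h1 h2 (by simp)
  simp only [one_smul] at h3
  convert! h3 using 1
  · ext s
    simp [← h.flow_add]
  · simp

end IsBorelFunctionalCalculus

end Resolvent

/-! ### Position and momentum through the modulation groups -/

section PhaseSpace

variable {K : Type*} [NormedAddCommGroup K] [InnerProductSpace ℂ K] [CompleteSpace K] {d : ℕ}

/-- The relations between a Hamiltonian `H`, the position operators `X j`, the momentum operators
`P j`, the square `S` of the position, the modulation groups `M j s = e^{i s X j}` and cut-offs `T n`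
in position which are used in the proof of ballistic transport. -/
structure PhaseSpace (H S : K →ₗ.[ℂ] K) (X P : Fin d → K →ₗ.[ℂ] K)
    (M : Fin d → ℝ → K →L[ℂ] K) (T : ℕ → K →L[ℂ] K) (v : ℝ) : Prop where
  norm_modulation : ∀ j s a, ‖M j s a‖ = ‖a‖
  tendsto_modulation : ∀ j a, Tendsto (fun s => M j s a) (𝓝 0) (𝓝 a)
  mem_position_iff : ∀ j a b, (a, b) ∈ (X j).graph ↔
    Tendsto (fun s : ℝ => (s : ℂ)⁻¹ • (M j s a - a)) (𝓝[≠] 0) (𝓝 (Complex.I • b))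
  norm_modulation_sub_le : ∀ j a b, (a, b) ∈ (X j).graph → ∀ s, ‖M j s a - a‖ ≤ |s| * ‖b‖
  position_of_bound : ∀ j a C, (∀ s, ‖M j s a - a‖ ≤ |s| * C) →
    ∃ b, (a, b) ∈ (X j).graph ∧ ‖b‖ ≤ C
  hamiltonian_modulation : ∀ j a b p, (a, b) ∈ H.graph → (a, p) ∈ (P j).graph → ∀ s : ℝ,
    (M j s a, M j s (b + (2 * s : ℂ) • p + (s ^ 2 : ℂ) • a)) ∈ H.graph
  momentum_modulation : ∀ i j a p, (a, p) ∈ (P i).graph → ∀ s : ℝ,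
    (M j s a, M j s (p + if i = j then (s : ℂ) • a else 0)) ∈ (P i).graph
  domain_le : ∀ j, H.domain ≤ (P j).domain
  adjoint_momentum : ∀ j, GraphAdjoint 1 (P j).graph
  energy : ∀ a b c (p q : Fin d → K), (a, b) ∈ H.graph → (∀ j, (a, p j) ∈ (P j).graph) →
    (∀ j, (c, q j) ∈ (P j).graph) → ‖⟪b, c⟫ - ∑ j, ⟪p j, q j⟫‖ ≤ v * ‖a‖ * ‖c‖
  tendsto_cutoff : ∀ a, Tendsto (fun n => T n a) atTop (𝓝 a)
  cutoff_position : ∀ n j a b, (a, b) ∈ (X j).graph → (T n a, T n b) ∈ (X j).graph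
  cutoff_domain : ∀ n j a, ∃ b c, (T n a, b) ∈ (X j).graph ∧ (b, c) ∈ (X j).graph
  square : ∀ a (b c : Fin d → K), (∀ j, (a, b j) ∈ (X j).graph) →
    (∀ j, (b j, c j) ∈ (X j).graph) → (a, ∑ j, c j) ∈ S.graph
  adjoint_square : GraphAdjoint 1 S.graph

namespace PhaseSpace

variable {H S : K →ₗ.[ℂ] K} {X P : Fin d → K →ₗ.[ℂ] K} {M : Fin d → ℝ → K →L[ℂ] K}
  {T : ℕ → K →L[ℂ] K} {v : ℝ} {Φ : (ℝ → ℂ) → K →L[ℂ] K}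

theorem exists_momentum (hp : PhaseSpace H S X P M T v) {a b : K} (hab : (a, b) ∈ H.graph)
    (j : Fin d) : ∃ p, (a, p) ∈ (P j).graph :=
  LinearPMap.mem_domain_iff.1 (hp.domain_le j (LinearPMap.mem_domain_of_mem_graph hab))

/-! ### Control of the momenta by the Hamiltonian. -/

theorem sum_norm_momentum_sq_le (hp : PhaseSpace H S X P M T v) {a b : K} {p : Fin d → K}
    (hab : (a, b) ∈ H.graph) (hap : ∀ j, (a, p j) ∈ (P j).graph) :
    ∑ j, ‖p j‖ ^ 2 ≤ (⟪b, a⟫).re + v * ‖a‖ ^ 2 := by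
  have h1 := hp.energy a b a p p hab hap hap
  have h2 := (neg_le_abs _).trans ((Complex.abs_re_le_norm _).trans h1)
  have h3 : (∑ j, ⟪p j, p j⟫).re = ∑ j, ‖p j‖ ^ 2 := by
    rw [Complex.re_sum]
    exact Finset.sum_congr rfl fun j _ => inner_self_eq_norm_sq (𝕜 := ℂ) (p j)
  rw [Complex.sub_re, h3] at h2
  nlinarith

theorem le_sum_norm_momentum_sq (hp : PhaseSpace H S X P M T v) {a b : K} {p : Fin d → K}
    (hab : (a, b) ∈ H.graph) (hap : ∀ j, (a, p j) ∈ (P j).graph) :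
    (⟪b, a⟫).re ≤ ∑ j, ‖p j‖ ^ 2 + v * ‖a‖ ^ 2 := by
  have h1 := hp.energy a b a p p hab hap hap
  have h2 := (le_abs_self _).trans ((Complex.abs_re_le_norm _).trans h1)
  have h3 : (∑ j, ⟪p j, p j⟫).re = ∑ j, ‖p j‖ ^ 2 := by
    rw [Complex.re_sum]
    exact Finset.sum_congr rfl fun j _ => inner_self_eq_norm_sq (𝕜 := ℂ) (p j)
  rw [Complex.sub_re, h3] at h2
  nlinarith

theorem norm_momentum_sq_le (hp : PhaseSpace H S X P M T v) {a b p : K} {j : Fin d}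
    (hab : (a, b) ∈ H.graph) (hap : (a, p) ∈ (P j).graph) :
    ‖p‖ ^ 2 ≤ ‖b‖ * ‖a‖ + v * ‖a‖ ^ 2 := by
  choose q hq using hp.exists_momentum hab
  have h1 := hp.sum_norm_momentum_sq_le hab hq
  obtain rfl : p = q j := (P j).mem_graph_snd_inj hap (hq j) rfl
  have h2 := Finset.single_le_sum (f := fun j => ‖q j‖ ^ 2) (fun i _ => sq_nonneg _)
    (Finset.mem_univ j)
  have h3 : (⟪b, a⟫ : ℂ).re ≤ ‖b‖ * ‖a‖ := (Complex.re_le_norm _).trans (norm_inner_le_norm _ _)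
  linarith [h2]

/-- Momentum is continuous for the graph norm of `H`: apply the form bound `‖P_j a‖² ≤ ‖H a‖‖a‖ +
v‖a‖²` to differences. -/
theorem tendsto_momentum (hp : PhaseSpace H S X P M T v) {ι : Type*} {l : Filter ι}
    {a b p : ι → K} {a₀ b₀ p₀ : K} {j : Fin d} (hab : ∀ i, (a i, b i) ∈ H.graph)
    (hab₀ : (a₀, b₀) ∈ H.graph) (hap : ∀ i, (a i, p i) ∈ (P j).graph)
    (hap₀ : (a₀, p₀) ∈ (P j).graph) (ha : Tendsto a l (𝓝 a₀)) (hb : Tendsto b l (𝓝 b₀)) :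
    Tendsto p l (𝓝 p₀) := by
  have h1 : ∀ i, ‖p i - p₀‖ ^ 2 ≤ ‖b i - b₀‖ * ‖a i - a₀‖ + v * ‖a i - a₀‖ ^ 2 := fun i =>
    hp.norm_momentum_sq_le (H.graph.sub_mem (hab i) hab₀) ((P j).graph.sub_mem (hap i) hap₀)
  have ha' : Tendsto (fun i => ‖a i - a₀‖) l (𝓝 0) := tendsto_iff_norm_sub_tendsto_zero.1 ha
  have hb' : Tendsto (fun i => ‖b i - b₀‖) l (𝓝 0) := tendsto_iff_norm_sub_tendsto_zero.1 hb
  have h2 := (hb'.mul ha').add ((ha'.pow 2).const_mul v)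
  have h3 : Tendsto (fun i => ‖p i - p₀‖ ^ 2) l (𝓝 0) :=
    squeeze_zero (fun i => sq_nonneg _) h1 (by simpa using h2)
  rw [tendsto_iff_norm_sub_tendsto_zero]
  have h4 := (Real.continuous_sqrt.tendsto 0).comp h3
  rw [Real.sqrt_zero] at h4
  refine h4.congr fun i => ?_
  simp [Real.sqrt_sq]

/-- Sequential continuity of `P_j (H - ir)⁻¹`. Every later passage to the limit in a momentum rests
on it. -/
theorem tendsto_momentum_res (hp : PhaseSpace H S X P M T v)
    (hΦ : IsBorelFunctionalCalculus H Φ) {r : ℝ} (hr : r ≠ 0) {ι : Type*} {l : Filter ι}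
    {a p : ι → K} {a₀ p₀ : K} {j : Fin d} (hap : ∀ i, (res Φ r (a i), p i) ∈ (P j).graph)
    (hap₀ : (res Φ r a₀, p₀) ∈ (P j).graph) (ha : Tendsto a l (𝓝 a₀)) : Tendsto p l (𝓝 p₀) := by
  have h1 : Tendsto (fun i => res Φ r (a i)) l (𝓝 (res Φ r a₀)) :=
    ((res Φ r).continuous.tendsto _).comp ha
  exact hp.tendsto_momentum (fun i => hΦ.res_mem_graph hr (a i)) (hΦ.res_mem_graph hr a₀) hap hap₀
    h1 (ha.add (h1.const_smul _))

theorem tendsto_modulation_apply (hp : PhaseSpace H S X P M T v) (j : Fin d) {a : ℝ → K} {a₀ : K}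
    {l : Filter ℝ} (hl : l ≤ 𝓝 0) (ha : Tendsto a l (𝓝 a₀)) :
    Tendsto (fun s => M j s (a s)) l (𝓝 a₀) := by
  have h1 : Tendsto (fun s => M j s (a s - a₀)) l (𝓝 0) := by
    rw [tendsto_zero_iff_norm_tendsto_zero]
    simp only [hp.norm_modulation]
    exact tendsto_iff_norm_sub_tendsto_zero.1 ha
  have h2 := h1.add ((hp.tendsto_modulation j a₀).mono_left hl)
  rw [zero_add] at h2
  refine h2.congr fun i => ?_
  simp

/-- With `φ = (H - ir)⁻¹ a`, the shift of `H` under modulation gives `(H - ir) M_s φ = M_s a + s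
M_s(2p + sφ)`. Apply the resolvent, subtract `φ` and divide by `s`. -/
theorem modulation_res (hp : PhaseSpace H S X P M T v) (hΦ : IsBorelFunctionalCalculus H Φ)
    {r : ℝ} (hr : r ≠ 0) {j : Fin d} {a p : K} (hap : (res Φ r a, p) ∈ (P j).graph) {s : ℝ}
    (hs : s ≠ 0) : (s : ℂ)⁻¹ • (M j s (res Φ r a) - res Φ r a) =
      res Φ r ((s : ℂ)⁻¹ • (M j s a - a) + M j s ((2 : ℂ) • p + (s : ℂ) • res Φ r a)) := by
  have hs' : (s : ℂ) ≠ 0 := by exact_mod_cast hs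
  have h1 := hp.hamiltonian_modulation j _ _ _ (hΦ.res_mem_graph hr a) hap s
  have h2 := hΦ.res_of_mem_graph hr h1
  have h3 : M j s (a + ((r : ℂ) * Complex.I) • res Φ r a + (2 * s : ℂ) • p +
      (s ^ 2 : ℂ) • res Φ r a) - ((r : ℂ) * Complex.I) • M j s (res Φ r a) =
      M j s a + (s : ℂ) • M j s ((2 : ℂ) • p + (s : ℂ) • res Φ r a) := by
    simp only [_root_.map_add, _root_.map_smul]
    module
  rw [h3] at h2
  have h4 : (s : ℂ)⁻¹ • (M j s a - a) + M j s ((2 : ℂ) • p + (s : ℂ) • res Φ r a) =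
      (s : ℂ)⁻¹ • (M j s a + (s : ℂ) • M j s ((2 : ℂ) • p + (s : ℂ) • res Φ r a) - a) := by
    rw [smul_sub, smul_sub, smul_add, inv_smul_smul₀ hs']
    abel
  rw [h4, _root_.map_smul, _root_.map_sub, h2]

theorem tendsto_modulation_res (hp : PhaseSpace H S X P M T v) {j : Fin d} {a b p c : K}
    (hab : (a, b) ∈ (X j).graph) :
    Tendsto (fun s : ℝ => (s : ℂ)⁻¹ • (M j s a - a) + M j s ((2 : ℂ) • p + (s : ℂ) • c)) (𝓝[≠] 0)
      (𝓝 (Complex.I • (b - (2 * Complex.I) • p))) := by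
  have h1 := (hp.mem_position_iff j a b).1 hab
  have h2 : Tendsto (fun s : ℝ => (2 : ℂ) • p + (s : ℂ) • c) (𝓝[≠] 0) (𝓝 ((2 : ℂ) • p)) := by
    have : Continuous fun s : ℝ => (2 : ℂ) • p + (s : ℂ) • c := by fun_prop
    have h := (this.tendsto 0).mono_left (nhdsWithin_le_nhds (s := {0}ᶜ))
    simpa using h
  have h3 := h1.add (hp.tendsto_modulation_apply j nhdsWithin_le_nhds h2)
  convert h3 using 2
  rw [smul_sub, smul_smul, sub_eq_add_neg, ← neg_smul]
  congr 2
  linear_combination -2 * Complex.I_sq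

/-- The resolvent preserves the domain of the position operators. -/
theorem res_mem_position (hp : PhaseSpace H S X P M T v) (hΦ : IsBorelFunctionalCalculus H Φ)
    {r : ℝ} (hr : r ≠ 0) {j : Fin d} {a b p : K} (hab : (a, b) ∈ (X j).graph)
    (hap : (res Φ r a, p) ∈ (P j).graph) :
    (res Φ r a, res Φ r (b - (2 * Complex.I) • p)) ∈ (X j).graph := by
  rw [hp.mem_position_iff, ← _root_.map_smul]
  have h1 := ((res Φ r).continuous.tendsto _).comp
    (hp.tendsto_modulation_res (p := p) (c := res Φ r a) hab)
  refine h1.congr' ?_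
  filter_upwards [self_mem_nhdsWithin] with s hs
  exact (hp.modulation_res hΦ hr hap hs).symm

/-- The canonical commutation relations on the range of the resolvent. -/
theorem momentum_mem_position (hp : PhaseSpace H S X P M T v)
    (hΦ : IsBorelFunctionalCalculus H Φ) {r : ℝ} (hr : r ≠ 0) {i j : Fin d} {a b p q w : K}
    (hab : (a, b) ∈ (X j).graph) (hap : (res Φ r a, p) ∈ (P j).graph)
    (haq : (res Φ r a, q) ∈ (P i).graph)
    (hw : (res Φ r (b - (2 * Complex.I) • p), w) ∈ (P i).graph) :
    (q, w + if i = j then Complex.I • res Φ r a else 0) ∈ (X j).graph := by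
  rw [hp.mem_position_iff]
  set δ : ℂ := if i = j then 1 else 0 with hδ
  have hw' : (res Φ r (Complex.I • (b - (2 * Complex.I) • p)), Complex.I • w) ∈ (P i).graph := by
    rw [_root_.map_smul]
    exact (P i).graph.smul_mem _ hw
  have h1 : ∀ s : ℝ, ∃ u, (res Φ r ((s : ℂ)⁻¹ • (M j s a - a) +
      M j s ((2 : ℂ) • p + (s : ℂ) • res Φ r a)), u) ∈ (P i).graph := fun s =>
    hp.exists_momentum (hΦ.res_mem_graph hr _) i
  choose u hu using h1
  -- The difference quotients of `res Φ r a` are resolvents of convergent vectors, so their momenta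
  -- converge too.
  have h2 : Tendsto u (𝓝[≠] 0) (𝓝 (Complex.I • w)) :=
    hp.tendsto_momentum_res hΦ hr hu hw' (hp.tendsto_modulation_res hab)
  -- Modulation in direction `j` shifts `P_i` by `s` exactly when `i = j`; after division by `s`
  -- this leaves the `δ` term.
  have h3 := h2.sub (((hp.tendsto_modulation j (res Φ r a)).mono_left
    (nhdsWithin_le_nhds (s := {0}ᶜ))).const_smul δ)
  have h4 : Complex.I • w - δ • res Φ r a =
      Complex.I • (w + if i = j then Complex.I • res Φ r a else 0) := by
    rw [hδ]
    split_ifs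
    · rw [smul_add, smul_smul, Complex.I_mul_I]
      module
    · simp
  rw [h4] at h3
  refine h3.congr' ?_
  filter_upwards [self_mem_nhdsWithin] with s hs
  have hs' : (s : ℂ) ≠ 0 := by exact_mod_cast hs
  have h5 := (P i).graph.smul_mem ((s : ℂ)⁻¹)
    ((P i).graph.sub_mem (hp.momentum_modulation i j _ _ haq s) haq)
  rw [Prod.mk_sub_mk, Prod.smul_mk, hp.modulation_res hΦ hr hap hs] at h5
  have h6 := (P i).mem_graph_snd_inj (hu s) h5 rfl
  rw [h6, hδ]
  split_ifs
  · simp only [_root_.map_add, _root_.map_smul, smul_sub, smul_add, smul_smul,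
      inv_mul_cancel₀ hs']
    abel
  · simp

/-- On the range of the resolvent the commutator is `∑ (4i P_j X_j - 2)`, since `w j` is `P_j X_j φ`
for `φ = res Φ r a`. Two powers of position on `a` ensure that both products are defined at `φ`:
`res_mem_position` is applied twice for `H S`, and `H φ = a + irφ` is used for `S H`. -/
theorem commutator_of_res (hp : PhaseSpace H S X P M T v) (hΦ : IsBorelFunctionalCalculus H Φ)
    {r : ℝ} (hr : r ≠ 0) {a : K} {b c p w : Fin d → K} (hab : ∀ j, (a, b j) ∈ (X j).graph)
    (hbc : ∀ j, (b j, c j) ∈ (X j).graph) (hap : ∀ j, (res Φ r a, p j) ∈ (P j).graph)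
    (hw : ∀ j, (res Φ r (b j - (2 * Complex.I) • p j), w j) ∈ (P j).graph) :
    (res Φ r a, ∑ j, ((4 * Complex.I) • w j - (2 : ℂ) • res Φ r a)) ∈
      (opCommutator S H).graph := by
  set φ := res Φ r a with hφ
  set z : ℂ := r * Complex.I
  have h1 : ∀ j, (φ, res Φ r (b j - (2 * Complex.I) • p j)) ∈ (X j).graph := fun j =>
    hp.res_mem_position hΦ hr (hab j) (hap j)
  have h2 : ∀ j, (p j, w j + Complex.I • φ) ∈ (X j).graph := fun j => by
    simpa using hp.momentum_mem_position hΦ hr (hab j) (hap j) (hap j) (hw j)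
  have h3 : ∀ j, (b j - (2 * Complex.I) • p j,
      c j - (2 * Complex.I) • (w j + Complex.I • φ)) ∈ (X j).graph := fun j =>
    (X j).graph.sub_mem (hbc j) ((X j).graph.smul_mem _ (h2 j))
  have h4 : ∀ j, (res Φ r (b j - (2 * Complex.I) • p j),
      res Φ r (c j - (2 * Complex.I) • (w j + Complex.I • φ) - (2 * Complex.I) • w j)) ∈
      (X j).graph := fun j => hp.res_mem_position hΦ hr (h3 j) (hw j)
  have h5 := hp.square φ _ _ h1 h4
  have h6 := H.graph.sum_mem (t := Finset.univ)
    (f := fun j => ((res Φ r (c j - (2 * Complex.I) • (w j + Complex.I • φ) -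
      (2 * Complex.I) • w j), _) : K × K)) (fun j _ => hΦ.res_mem_graph hr _)
  rw [show ∀ f g : Fin d → K, ∑ j, (f j, g j) = (∑ j, f j, ∑ j, g j) from
    fun f g => Prod.ext Prod.fst_sum Prod.snd_sum] at h6
  have h7 : ∀ j, (a + z • φ, b j + z • res Φ r (b j - (2 * Complex.I) • p j)) ∈ (X j).graph :=
    fun j => (X j).graph.add_mem (hab j) ((X j).graph.smul_mem _ (h1 j))
  have h8 := hp.square _ _ _ h7
    fun j => (X j).graph.add_mem (hbc j) ((X j).graph.smul_mem z (h4 j))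
  have h9 := mem_graph_sub (mem_graph_opComp (hΦ.res_mem_graph hr a) h8) (mem_graph_opComp h5 h6)
  rw [← Finset.sum_sub_distrib] at h9
  rw [opCommutator]
  convert h9 using 2
  refine Finset.sum_congr rfl fun j _ => ?_
  have e : (2 * Complex.I) • (w j + Complex.I • φ) = (2 * Complex.I) • w j - (2 : ℂ) • φ := by
    rw [smul_add, smul_smul, mul_assoc, Complex.I_mul_I]
    module
  simp only [e, Prod.smul_mk]
  module

/-! ### Antisymmetry and closure of the commutator. -/

theorem graphAdjoint_commutator (hp : PhaseSpace H S X P M T v)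
    (hΦ : IsBorelFunctionalCalculus H Φ) : GraphAdjoint (-1) (opCommutator S H).graph := by
  intro a b a' b' hab hab'
  obtain ⟨b₁, b₂, h1, h2, rfl⟩ := exists_of_mem_graph_sub hab
  obtain ⟨b₁', b₂', h1', h2', rfl⟩ := exists_of_mem_graph_sub hab'
  obtain ⟨c₁, h3, h4⟩ := exists_of_mem_graph_opComp h1
  obtain ⟨c₂, h5, h6⟩ := exists_of_mem_graph_opComp h2
  obtain ⟨c₁', h3', h4'⟩ := exists_of_mem_graph_opComp h1'
  obtain ⟨c₂', h5', h6'⟩ := exists_of_mem_graph_opComp h2'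
  have e1 := hp.adjoint_square _ _ _ _ h4 h5'
  have e2 := hΦ.graphAdjoint _ _ _ _ h3 h6'
  have e3 := hΦ.graphAdjoint _ _ _ _ h6 h3'
  have e4 := hp.adjoint_square _ _ _ _ h5 h4'
  rw [inner_sub_left, inner_sub_right]
  linear_combination e1 + e2 - e3 - e4

/-- Only density of the domain is at stake. It contains the resolvents of all cut-off vectors, which
are dense in the range of `(H - i)⁻¹`; the orthogonal complement of that range is the kernel of `(H
+ i)⁻¹`, which is zero. -/
theorem isClosable_commutator (hp : PhaseSpace H S X P M T v)
    (hΦ : IsBorelFunctionalCalculus H Φ) : (opCommutator S H).IsClosable := by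
  refine (hp.graphAdjoint_commutator hΦ).isClosable ?_
  have h1 : ∀ a, res Φ 1 a ∈ closure ((opCommutator S H).domain : Set K) := by
    intro a
    refine mem_closure_of_tendsto (((res Φ 1).continuous.tendsto a).comp (hp.tendsto_cutoff a))
      (Eventually.of_forall fun n => ?_)
    choose b c hab hbc using fun j => hp.cutoff_domain n j a
    choose p hap using hp.exists_momentum (hΦ.res_mem_graph one_ne_zero (T n a))
    choose w hw using fun j => hp.exists_momentum
      (hΦ.res_mem_graph one_ne_zero (b j - (2 * Complex.I) • p j)) j
    exact LinearPMap.mem_domain_of_mem_graph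
      (hp.commutator_of_res hΦ one_ne_zero hab hbc hap hw)
  rw [Submodule.dense_iff_topologicalClosure_eq_top, Submodule.topologicalClosure_eq_top_iff,
    Submodule.eq_bot_iff]
  intro w hw
  have h2 : ∀ a, ⟪res Φ 1 a, w⟫ = 0 := by
    intro a
    have hcl : IsClosed {u : K | ⟪u, w⟫ = 0} := isClosed_eq (by fun_prop) (by fun_prop)
    exact hcl.closure_subset_iff.2 (fun u hu => (Submodule.mem_orthogonal _ w).1 hw u hu) (h1 a)
  have h3 : res Φ (-1) w = 0 := by
    have h4 := hΦ.map_conj _ (isBoundedBorel_res one_ne_zero)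
    simp only [map_inv₀, _root_.map_sub, _root_.map_mul, Complex.conj_ofReal, Complex.conj_I] at h4
    have h5 : res Φ (-1) = ContinuousLinearMap.adjoint (res Φ 1) := by
      rw [res, res, ← h4]
      congr 1
      ext x
      push_cast
      ring
    have h6 := h2 (res Φ (-1) w)
    rw [← ContinuousLinearMap.adjoint_inner_right, ← h5] at h6
    exact inner_self_eq_zero.1 h6
  have h7 := hΦ.res_mem_graph (neg_ne_zero.2 one_ne_zero) w
  rw [h3, smul_zero, add_zero] at h7
  exact H.graph_fst_eq_zero_snd h7 rfl

theorem graphAdjoint_closure (hp : PhaseSpace H S X P M T v)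
    (hΦ : IsBorelFunctionalCalculus H Φ) :
    GraphAdjoint (-1) (opCommutator S H).closure.graph := by
  rw [← (hp.isClosable_commutator hΦ).graph_closure_eq_closure_graph]
  exact (hp.graphAdjoint_commutator hΦ).topologicalClosure

/-- In the closure one power of position on `a` is enough. The cut-offs `T n a` have two, and the
formula of `commutator_of_res` involves `a`, `X_j a` and bounded operators only, so it survives the
limit. -/
theorem closure_commutator_of_res (hp : PhaseSpace H S X P M T v)
    (hΦ : IsBorelFunctionalCalculus H Φ) {r : ℝ} (hr : r ≠ 0) {a : K} {b p w : Fin d → K}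
    (hab : ∀ j, (a, b j) ∈ (X j).graph) (hap : ∀ j, (res Φ r a, p j) ∈ (P j).graph)
    (hw : ∀ j, (res Φ r (b j - (2 * Complex.I) • p j), w j) ∈ (P j).graph) :
    (res Φ r a, ∑ j, ((4 * Complex.I) • w j - (2 : ℂ) • res Φ r a)) ∈
      (opCommutator S H).closure.graph := by
  rw [← (hp.isClosable_commutator hΦ).graph_closure_eq_closure_graph]
  have h1 : ∀ n j, ∃ c, (T n (b j), c) ∈ (X j).graph := by
    intro n j
    obtain ⟨b', c, hb', hc⟩ := hp.cutoff_domain n j a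
    obtain rfl := (X j).mem_graph_snd_inj (hp.cutoff_position n j a _ (hab j)) hb' rfl
    exact ⟨c, hc⟩
  choose c hc using h1
  choose p' hap' using fun n j => hp.exists_momentum (hΦ.res_mem_graph hr (T n a)) j
  choose w' hw' using fun n j => hp.exists_momentum
    (hΦ.res_mem_graph hr (T n (b j) - (2 * Complex.I) • p' n j)) j
  have hp' : ∀ j, Tendsto (fun n => p' n j) atTop (𝓝 (p j)) := fun j =>
    hp.tendsto_momentum_res hΦ hr (fun n => hap' n j) (hap j) (hp.tendsto_cutoff a)
  have hww : ∀ j, Tendsto (fun n => w' n j) atTop (𝓝 (w j)) := fun j =>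
    hp.tendsto_momentum_res hΦ hr (fun n => hw' n j) (hw j)
      ((hp.tendsto_cutoff (b j)).sub ((hp' j).const_smul _))
  have hφ : Tendsto (fun n => res Φ r (T n a)) atTop (𝓝 (res Φ r a)) :=
    ((res Φ r).continuous.tendsto a).comp (hp.tendsto_cutoff a)
  refine mem_closure_of_tendsto (hφ.prodMk_nhds (tendsto_finsetSum _ fun j _ =>
    ((hww j).const_smul _).sub (hφ.const_smul _))) (Eventually.of_forall fun n => ?_)
  exact hp.commutator_of_res hΦ hr (fun j => hp.cutoff_position n j a _ (hab j)) (hc n) (hap' n)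
    (hw' n)

end PhaseSpace

end PhaseSpace

/-! ### Evolution of the position operators -/

section Dynamics

variable {K : Type*} [NormedAddCommGroup K] [InnerProductSpace ℂ K] [CompleteSpace K] {d : ℕ}

namespace IsBorelFunctionalCalculus

variable {H : K →ₗ.[ℂ] K} {Φ : (ℝ → ℂ) → K →L[ℂ] K}

/-- Product rule in which the moving vector must lie in `D(H)` only at the time `t` itself. The
quotient of `c` is carried by the flow, which is jointly continuous by `tendsto_flow_apply`. -/
theorem hasDerivAt_flow_neg_apply (h : IsBorelFunctionalCalculus H Φ) {c : ℝ → K} {c' e : K}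
    {t : ℝ} (hc : HasDerivAt c c' t) (he : (c t, e) ∈ H.graph) :
    HasDerivAt (fun τ => flow Φ (-τ) (c τ)) (flow Φ (-t) (Complex.I • e + c')) t := by
  have h1 : HasDerivAt (fun τ => flow Φ (-τ) (c t)) (flow Φ (-t) (Complex.I • e)) t := by
    have h2 := HasDerivAt.scomp t (h.hasDerivAt_flow he (-t)) (hasDerivAt_neg t)
    convert! h2 using 1
    simp
  rw [hasDerivAt_iff_tendsto_slope] at h1 hc ⊢
  have hn : Tendsto (fun τ : ℝ => -τ) (𝓝[≠] t) (𝓝 (-t)) :=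
    (continuous_neg.tendsto t).mono_left nhdsWithin_le_nhds
  have h3 := h1.add (h.tendsto_flow_apply hn hc)
  rw [← _root_.map_add] at h3
  refine h3.congr fun τ => ?_
  simp only [slope_def_module, ← Complex.coe_smul, _root_.map_smul, _root_.map_sub]
  rw [← smul_add]
  congr 1
  abel

/-- The derivative of the expectation of an antisymmetric operator along the flow. -/
theorem hasDerivAt_inner_flow (h : IsBorelFunctionalCalculus H Φ) {G : Submodule ℂ (K × K)}
    (hG : GraphAdjoint (-1) G) {a b : K} (hab : (a, b) ∈ H.graph) {e : ℝ → K}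
    (he : Continuous e) (hae : ∀ t, (flow Φ t a, e t) ∈ G) (t : ℝ) :
    HasDerivAt (fun t => -Complex.I * ⟪flow Φ t a, e t⟫)
      (⟪flow Φ t b, e t⟫ + ⟪e t, flow Φ t b⟫) t := by
  have h1 := h.hasDerivAt_flow hab t
  rw [hasDerivAt_iff_tendsto_slope] at h1 ⊢
  have he' : Tendsto e (𝓝[≠] t) (𝓝 (e t)) := (he.tendsto t).mono_left nhdsWithin_le_nhds
  have h2 := ((h1.inner he').sub
    ((tendsto_const_nhds (x := e t)).inner h1 (𝕜 := ℂ))).const_mul (-Complex.I)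
  have h3 : -Complex.I * (⟪-Complex.I • flow Φ t b, e t⟫ - ⟪e t, -Complex.I • flow Φ t b⟫) =
      ⟪flow Φ t b, e t⟫ + ⟪e t, flow Φ t b⟫ := by
    rw [inner_smul_left, inner_smul_right, _root_.map_neg, Complex.conj_I]
    linear_combination (-⟪flow Φ t b, e t⟫ - ⟪e t, flow Φ t b⟫) * Complex.I_sq
  rw [h3] at h2
  refine h2.congr fun τ => ?_
  -- Antisymmetry trades the increment of `e` for an increment of the flow. This is why `e` need
  -- only be continuous.
  have h4 := hG _ _ _ _ (hae t) (G.sub_mem (hae τ) (hae t))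
  simp only [slope_def_module, ← Complex.coe_smul]
  rw [inner_smul_left, inner_smul_right, Complex.conj_ofReal, inner_sub_left]
  rw [inner_sub_right (flow Φ t a)] at h4
  dsimp only at h4
  rw [h4, smul_eq_mul]
  ring

end IsBorelFunctionalCalculus

namespace PhaseSpace

variable {H S : K →ₗ.[ℂ] K} {X P : Fin d → K →ₗ.[ℂ] K} {M : Fin d → ℝ → K →L[ℂ] K}
  {T : ℕ → K →L[ℂ] K} {v : ℝ} {Φ : (ℝ → ℂ) → K →L[ℂ] K}

theorem continuous_momentum_flow (hp : PhaseSpace H S X P M T v)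
    (hΦ : IsBorelFunctionalCalculus H Φ) {a b : K} (hab : (a, b) ∈ H.graph) {j : Fin d}
    {p : ℝ → K} (hap : ∀ t, (flow Φ t a, p t) ∈ (P j).graph) : Continuous p :=
  continuous_iff_continuousAt.2 fun t => hp.tendsto_momentum
    (fun τ => hΦ.flow_mem_graph τ hab) (hΦ.flow_mem_graph t hab) hap (hap t)
    ((hΦ.continuous_flow a).tendsto t) ((hΦ.continuous_flow b).tendsto t)

/-- The Heisenberg equation `X(t) = X + ∫ 2 P(τ) dτ`. -/
theorem flow_mem_position (hp : PhaseSpace H S X P M T v)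
    (hΦ : IsBorelFunctionalCalculus H Φ) {a b x : K} (hab : (a, b) ∈ H.graph) {j : Fin d}
    (hax : (a, x) ∈ (X j).graph) {p : ℝ → K} (hap : ∀ t, (flow Φ t a, p t) ∈ (P j).graph)
    (t : ℝ) :
    (flow Φ t a, flow Φ t (x + ∫ τ in (0 : ℝ)..t, (2 : ℂ) • flow Φ (-τ) (p τ))) ∈
      (X j).graph := by
  have hpc := hp.continuous_momentum_flow hΦ hab hap
  have hac := hΦ.continuous_flow a
  -- The derivative in `τ` of the difference quotient of `e^{iτH} M_s e^{-iτH} a`. The two terms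
  -- containing `H` cancel, so it stays bounded as `s → 0`.
  set q' : ℝ → ℝ → K := fun s τ =>
    flow Φ (-τ) (M j s (Complex.I • ((2 : ℂ) • p τ + (s : ℂ) • flow Φ τ a))) with hq'
  have hq'c : ∀ s, Continuous (q' s) := fun s =>
    hΦ.continuous_flow_apply continuous_neg ((M j s).continuous.comp (by fun_prop))
  have hder : ∀ s : ℝ, s ≠ 0 → ∀ τ, HasDerivAt
      (fun τ => (s : ℂ)⁻¹ • (flow Φ (-τ) (M j s (flow Φ τ a)) - a)) (q' s τ) τ := by
    intro s hs τ
    have hs' : (s : ℂ) ≠ 0 := by exact_mod_cast hs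
    have h1 : HasDerivAt (fun τ => M j s (flow Φ τ a)) (M j s (-Complex.I • flow Φ τ b)) τ :=
      ((M j s).restrictScalars ℝ).hasFDerivAt.comp_hasDerivAt τ (hΦ.hasDerivAt_flow hab τ)
    have h2 := hΦ.hasDerivAt_flow_neg_apply h1
      (hp.hamiltonian_modulation j _ _ _ (hΦ.flow_mem_graph τ hab) (hap τ) s)
    have h3 := (h2.sub_const a).const_smul ((s : ℂ)⁻¹)
    convert! h3 using 1
    rw [hq', ← _root_.map_smul (flow Φ (-τ))]
    dsimp only
    congr 1
    rw [← _root_.map_smul (M j s), ← _root_.map_add (M j s), ← _root_.map_smul (M j s)]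
    congr 1
    have e1 : Complex.I • (flow Φ τ b + (2 * s : ℂ) • p τ + (s ^ 2 : ℂ) • flow Φ τ a) +
        -Complex.I • flow Φ τ b =
        (s : ℂ) • Complex.I • ((2 : ℂ) • p τ + (s : ℂ) • flow Φ τ a) := by module
    rw [e1, inv_smul_smul₀ hs']
  have hint : ∀ s : ℝ, s ≠ 0 → (s : ℂ)⁻¹ • (M j s (flow Φ t a) - flow Φ t a) =
      flow Φ t ((s : ℂ)⁻¹ • (M j s a - a) + ∫ τ in (0 : ℝ)..t, q' s τ) := by
    intro s hs
    rw [intervalIntegral.integral_eq_sub_of_hasDerivAt (fun τ _ => hder s hs τ)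
      ((hq'c s).intervalIntegrable _ _), neg_zero, hΦ.flow_zero, hΦ.flow_zero, add_sub_cancel,
      _root_.map_smul, _root_.map_sub, hΦ.flow_flow_neg]
  -- The integrated identity passes to `s → 0` by dominated convergence, and `mem_position_iff`
  -- turns the limit into membership in the domain together with the value.
  have hlim : Tendsto (fun s : ℝ => ∫ τ in (0 : ℝ)..t, q' s τ) (𝓝[≠] 0)
      (𝓝 (∫ τ in (0 : ℝ)..t, Complex.I • (2 : ℂ) • flow Φ (-τ) (p τ))) := by
    refine intervalIntegral.tendsto_integral_filter_of_dominated_convergence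
      (fun τ => 2 * ‖p τ‖ + ‖a‖) ?_ ?_ ?_ ?_
    · exact Eventually.of_forall fun s => (hq'c s).aestronglyMeasurable
    · have : ∀ᶠ s : ℝ in 𝓝[≠] 0, |s| ≤ 1 := by
        have h1 : ∀ᶠ s : ℝ in 𝓝 0, |s| < 1 :=
          (continuous_abs.tendsto (0 : ℝ)).eventually_lt_const (by simp)
        exact (h1.filter_mono nhdsWithin_le_nhds).mono fun s hs => hs.le
      filter_upwards [this] with s hs
      refine Eventually.of_forall fun τ _ => ?_
      rw [hq']
      dsimp only
      rw [hΦ.norm_flow, hp.norm_modulation, norm_smul, Complex.norm_I, one_mul]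
      refine (norm_add_le _ _).trans ?_
      rw [norm_smul, norm_smul, hΦ.norm_flow, Complex.norm_real, Real.norm_eq_abs]
      have : |s| * ‖a‖ ≤ ‖a‖ := mul_le_of_le_one_left (norm_nonneg _) hs
      simpa using this
    · exact Continuous.intervalIntegrable (by fun_prop) _ _
    · refine Eventually.of_forall fun τ _ => ?_
      rw [← _root_.map_smul, ← _root_.map_smul]
      refine ((flow Φ (-τ)).continuous.tendsto _).comp
        (hp.tendsto_modulation_apply j nhdsWithin_le_nhds ?_)
      have : Continuous fun s : ℝ => Complex.I • ((2 : ℂ) • p τ + (s : ℂ) • flow Φ τ a) := by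
        fun_prop
      have h := (this.tendsto 0).mono_left (nhdsWithin_le_nhds (s := {0}ᶜ))
      simpa using h
  rw [hp.mem_position_iff, ← _root_.map_smul, smul_add, ← intervalIntegral.integral_smul]
  have h1 := ((hp.mem_position_iff j a x).1 hax).add hlim
  refine (((flow Φ t).continuous.tendsto _).comp h1).congr' ?_
  filter_upwards [self_mem_nhdsWithin] with s hs
  exact (hint s hs).symm

/-- The energy `⟨H a, a⟩` and the norm are conserved, and energy differs from kinetic energy by at
most `v‖a‖²`; comparing at time `t` and at time `0` costs this twice. -/
theorem sum_norm_momentum_flow_sq_le (hp : PhaseSpace H S X P M T v)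
    (hΦ : IsBorelFunctionalCalculus H Φ) {a b : K} (hab : (a, b) ∈ H.graph) {p q : Fin d → K}
    (hap : ∀ j, (a, p j) ∈ (P j).graph) {t : ℝ} (haq : ∀ j, (flow Φ t a, q j) ∈ (P j).graph) :
    ∑ j, ‖q j‖ ^ 2 ≤ ∑ j, ‖p j‖ ^ 2 + 2 * v * ‖a‖ ^ 2 := by
  have h1 := hp.sum_norm_momentum_sq_le (hΦ.flow_mem_graph t hab) haq
  have h2 := hp.le_sum_norm_momentum_sq hab hap
  rw [hΦ.inner_flow_flow, hΦ.norm_flow] at h1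
  linarith

/-- Only momenta of `a` are needed, not `a ∈ D(H)`. With `φ = J_r a`, the energy of `φ` equals `Re⟨H
φ, a⟩`, which is `∑ Re⟨q j, p j⟩` up to `v‖a‖²`; half of the squares `‖q j‖²` is then absorbed. -/
theorem sum_norm_momentum_yosida_sq_le (hp : PhaseSpace H S X P M T v) (hv : 0 ≤ v)
    (hΦ : IsBorelFunctionalCalculus H Φ) {r : ℝ} (hr : r ≠ 0) {a : K} {p q : Fin d → K}
    (hap : ∀ j, (a, p j) ∈ (P j).graph) (haq : ∀ j, (yosida Φ r a, q j) ∈ (P j).graph) :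
    ∑ j, ‖q j‖ ^ 2 ≤ ∑ j, ‖p j‖ ^ 2 + 4 * v * ‖a‖ ^ 2 := by
  have hH := hΦ.yosida_mem_graph hr a
  have hn := hΦ.norm_yosida_le hr a
  set φ := yosida Φ r a
  set b := (-(r * Complex.I)) • (a - φ) with hb
  have h1 := hp.sum_norm_momentum_sq_le hH haq
  -- Since `b = -ir(a - φ)`, the product `⟨b, a - φ⟩` is purely imaginary.
  have h2 : (⟪b, φ⟫ : ℂ).re = (⟪b, a⟫ : ℂ).re := by
    have h3 : (⟪b, a - φ⟫ : ℂ).re = 0 := by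
      rw [hb, inner_smul_left, inner_self_eq_norm_sq_to_K]
      simp [← Complex.ofReal_pow]
    rw [inner_sub_right, Complex.sub_re] at h3
    linarith
  have h3 := (le_abs_self _).trans ((Complex.abs_re_le_norm _).trans
    (hp.energy _ _ _ _ _ hH haq hap))
  rw [Complex.sub_re, Complex.re_sum] at h3
  have h4 : ∑ j, (⟪q j, p j⟫ : ℂ).re ≤ ∑ j, (‖q j‖ ^ 2 / 2 + ‖p j‖ ^ 2 / 2) := by
    refine Finset.sum_le_sum fun j _ => ?_
    have : (⟪q j, p j⟫ : ℂ).re ≤ ‖q j‖ * ‖p j‖ :=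
      (Complex.re_le_norm _).trans (norm_inner_le_norm _ _)
    nlinarith [sq_nonneg (‖q j‖ - ‖p j‖)]
  rw [Finset.sum_add_distrib, ← Finset.sum_div, ← Finset.sum_div] at h4
  have h5 : v * ‖φ‖ * ‖a‖ ≤ v * ‖a‖ ^ 2 := by
    rw [pow_two, ← mul_assoc]
    gcongr
  have h6 : v * ‖φ‖ ^ 2 ≤ v * ‖a‖ ^ 2 := by gcongr
  linarith

/-- If `f'' ≥ m` then `f` lies above a parabola. -/
theorem _root_.add_mul_add_le_of_hasDerivAt {f g g' : ℝ → ℝ} {m : ℝ}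
    (hf : ∀ t, HasDerivAt f (g t) t) (hg : ∀ t, HasDerivAt g (g' t) t) (hm : ∀ t, m ≤ g' t)
    {t : ℝ} (ht : 0 ≤ t) : f 0 + t * g 0 + m * t ^ 2 / 2 ≤ f t := by
  have h1 : Monotone fun t => g t - m * t := by
    have hd : ∀ t, HasDerivAt (fun t => g t - m * t) (g' t - m * 1) t := fun t =>
      (hg t).sub ((hasDerivAt_id t).const_mul m)
    refine monotone_of_deriv_nonneg (fun t => (hd t).differentiableAt) fun t => ?_
    rw [(hd t).deriv]
    linarith [hm t]
  have h2 : MonotoneOn (fun t => f t - t * g 0 - m * t ^ 2 / 2) (Set.Ici 0) := by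
    have hd : ∀ t, HasDerivAt (fun t => f t - t * g 0 - m * t ^ 2 / 2)
        (g t - 1 * g 0 - m * (((2 : ℕ) : ℝ) * t ^ (2 - 1)) / 2) t := fun t =>
      ((hf t).sub ((hasDerivAt_id t).mul_const _)).sub
        (((hasDerivAt_pow 2 t).const_mul m).div_const 2)
    refine monotoneOn_of_deriv_nonneg (convex_Ici 0)
      (fun t _ => (hd t).continuousAt.continuousWithinAt)
      (fun t _ => (hd t).differentiableAt.differentiableWithinAt) fun t ht => ?_
    rw [interior_Ici] at ht
    rw [(hd t).deriv]
    have := h1 (Set.mem_Ioi.1 ht).le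
    norm_num at this ⊢
    linarith
  have h3 := h2 (Set.self_mem_Ici) (Set.mem_Ici.2 ht) ht
  norm_num at h3
  linarith

/-- The core computation: the second derivative of `∑ ‖X_j φ_t‖²` is the commutator form, here
bounded below by `m`. Since `a` lies in `D(H)` and in every `D(X_j)`, its evolution stays in every
`D(X_j)`. Hence `φ_t`, a resolvent of a multiple of that evolution, lies in the domain of the closed
commutator at all times. -/
theorem growth_of_commutator_bound (hp : PhaseSpace H S X P M T v)
    (hΦ : IsBorelFunctionalCalculus H Φ) {r : ℝ} (hr : r ≠ 0) {a b : K} {x ξ p : Fin d → K}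
    (hab : (a, b) ∈ H.graph) (hax : ∀ j, (a, x j) ∈ (X j).graph)
    (hφξ : ∀ j, (yosida Φ r a, ξ j) ∈ (X j).graph) (hφp : ∀ j, (yosida Φ r a, p j) ∈ (P j).graph)
    {m : ℝ} (hm : ∀ t h e, (flow Φ t (yosida Φ r a), h) ∈ H.graph →
      (flow Φ t (yosida Φ r a), e) ∈ (opCommutator S H).closure.graph →
      m ≤ (⟪h, e⟫ + ⟪e, h⟫).re)
    {t : ℝ} (ht : 0 ≤ t) {y : Fin d → K}
    (hy : ∀ j, (flow Φ t (yosida Φ r a), y j) ∈ (X j).graph) :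
    ∑ j, ‖ξ j‖ ^ 2 + t * (∑ j, 4 * (⟪ξ j, p j⟫).re) + m * t ^ 2 / 2 ≤ ∑ j, ‖y j‖ ^ 2 := by
  set φ := yosida Φ r a with hφ
  set η := (-(r * Complex.I)) • a with hη
  have hφη : φ = res Φ r η := by rw [hφ, hη, _root_.map_smul]; rfl
  have hφH := hΦ.yosida_mem_graph hr a
  -- the evolution of the position of `η`
  choose pa hpa using fun t => hp.exists_momentum (hΦ.flow_mem_graph t hab)
  have hpac := fun j => hp.continuous_momentum_flow hΦ hab (fun t => hpa t j)
  set xa : ℝ → Fin d → K := fun t j =>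
    flow Φ t (x j + ∫ τ in (0 : ℝ)..t, (2 : ℂ) • flow Φ (-τ) (pa τ j)) with hxa
  have hxac : ∀ j, Continuous fun t => xa t j := by
    intro j
    refine hΦ.continuous_flow_apply continuous_id (continuous_const.add ?_)
    refine intervalIntegral.continuous_primitive (fun u w => ?_) 0
    exact ((hΦ.continuous_flow_apply continuous_neg (hpac j)).const_smul _).intervalIntegrable _ _
  have hηx : ∀ t j, (flow Φ t η, (-(r * Complex.I)) • xa t j) ∈ (X j).graph := by
    intro t j
    rw [hη, _root_.map_smul]
    exact (X j).graph.smul_mem _ (hp.flow_mem_position hΦ hab (hax j) (fun t => hpa t j) t)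
  -- the evolution of `φ`
  have hφt : ∀ t, flow Φ t φ = res Φ r (flow Φ t η) := fun t => by rw [hφη, hΦ.res_flow hr]
  choose q hq using fun t => hp.exists_momentum (hΦ.res_mem_graph hr (flow Φ t η))
  have hqc : ∀ j, Continuous fun t => q t j := fun j =>
    hp.continuous_momentum_flow hΦ hφH (p := fun t => q t j)
      fun t => by rw [← hφ, hφt]; exact hq t j
  choose w hw using fun t j => hp.exists_momentum
    (hΦ.res_mem_graph hr ((-(r * Complex.I)) • xa t j - (2 * Complex.I) • q t j)) j
  have hwc : ∀ j, Continuous fun t => w t j := fun j =>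
    continuous_iff_continuousAt.2 fun t => hp.tendsto_momentum_res hΦ hr (fun τ => hw τ j) (hw t j)
      ((((hxac j).const_smul _).sub ((hqc j).const_smul _)).tendsto t)
  -- The value of the closed commutator at `φ_t`; its continuity is what `hasDerivAt_inner_flow`
  -- asks for.
  set e : ℝ → K := fun t => ∑ j, ((4 * Complex.I) • w t j - (2 : ℂ) • flow Φ t φ) with he
  have hec : Continuous e := continuous_finsetSum _ fun j _ =>
    ((hwc j).const_smul _).sub ((hΦ.continuous_flow φ).const_smul _)
  have hφe : ∀ t, (flow Φ t φ, e t) ∈ (opCommutator S H).closure.graph := by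
    intro t
    rw [he]
    dsimp only
    rw [hφt]
    exact hp.closure_commutator_of_res hΦ hr (hηx t) (hq t) (hw t)
  have hX : ∀ t j, (flow Φ t φ,
      res Φ r ((-(r * Complex.I)) • xa t j - (2 * Complex.I) • q t j)) ∈ (X j).graph := by
    intro t j
    rw [hφt]
    exact hp.res_mem_position hΦ hr (hηx t j) (hq t j)
  -- the second moment of `φ`
  set Y : ℝ → Fin d → K := fun t j =>
    ξ j + ∫ τ in (0 : ℝ)..t, (2 : ℂ) • flow Φ (-τ) (q τ j) with hY
  have hqφ : ∀ t j, (flow Φ t φ, q t j) ∈ (P j).graph := fun t j => by rw [hφt]; exact hq t j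
  have hYX : ∀ t j, (flow Φ t φ, flow Φ t (Y t j)) ∈ (X j).graph := fun t j =>
    hp.flow_mem_position hΦ hφH (hφξ j) (fun t => hqφ t j) t
  have hYd : ∀ t j, HasDerivAt (fun t => Y t j) ((2 : ℂ) • flow Φ (-t) (q t j)) t := by
    intro t j
    have hc : Continuous fun τ => (2 : ℂ) • flow Φ (-τ) (q τ j) :=
      (hΦ.continuous_flow_apply continuous_neg (hqc j)).const_smul _
    exact (intervalIntegral.integral_hasDerivAt_right (hc.intervalIntegrable _ _)
      (hc.stronglyMeasurableAtFilter _ _) hc.continuousAt).const_add _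
  -- The term `-2‖φ‖²` of the commutator is real, so after multiplication by `-i` it drops out of
  -- the real part. What remains is the derivative of the second moment.
  have hg : ∀ t, (-Complex.I * ⟪flow Φ t φ, e t⟫).re =
      ∑ j, 4 * (⟪flow Φ t (Y t j), q t j⟫ : ℂ).re := by
    intro t
    rw [he]
    dsimp only
    rw [inner_sum, Finset.mul_sum, Complex.re_sum]
    refine Finset.sum_congr rfl fun j _ => ?_
    have h1 := (X j).mem_graph_snd_inj (hYX t j) (hX t j) rfl
    have h2 := hp.adjoint_momentum j _ _ _ _ (hqφ t j) (hw t j)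
    rw [← h1, one_mul] at h2
    rw [inner_sub_right, inner_smul_right, inner_smul_right, ← h2, inner_self_eq_norm_sq_to_K,
      ← inner_conj_symm]
    have h3 : -Complex.I * (4 * Complex.I * (starRingEnd ℂ) ⟪flow Φ t (Y t j), q t j⟫ -
        2 * ((‖flow Φ t φ‖ : ℝ) : ℂ) ^ 2) =
        ((4 : ℝ) : ℂ) * (starRingEnd ℂ) ⟪flow Φ t (Y t j), q t j⟫ +
          ((2 * ‖flow Φ t φ‖ ^ 2 : ℝ) : ℂ) * Complex.I := by
      push_cast
      linear_combination (-4 * (starRingEnd ℂ) ⟪flow Φ t (Y t j), q t j⟫) * Complex.I_sq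
    refine (congrArg Complex.re h3).trans ?_
    rw [Complex.add_re, Complex.re_ofReal_mul, Complex.re_ofReal_mul, Complex.conj_re]
    simp
  have hfd : ∀ t, HasDerivAt (fun t => ∑ j, ‖Y t j‖ ^ 2) (-Complex.I * ⟪flow Φ t φ, e t⟫).re t := by
    intro t
    rw [hg]
    refine HasDerivAt.fun_sum fun j _ => ?_
    have h1 := (hYd t j).inner ℂ (hYd t j)
    have h2 := Complex.reCLM.hasFDerivAt.comp_hasDerivAt t h1
    have h3 : Complex.reCLM (⟪Y t j, (2 : ℂ) • flow Φ (-t) (q t j)⟫ +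
        ⟪(2 : ℂ) • flow Φ (-t) (q t j), Y t j⟫) = 4 * (⟪flow Φ t (Y t j), q t j⟫ : ℂ).re := by
      rw [← inner_conj_symm ((2 : ℂ) • flow Φ (-t) (q t j)), inner_smul_right,
        ← hΦ.inner_flow_flow t (Y t j), hΦ.flow_flow_neg]
      have h4 : (⟪q t j, flow Φ t (Y t j)⟫ : ℂ).re = (⟪flow Φ t (Y t j), q t j⟫ : ℂ).re :=
        inner_re_symm (𝕜 := ℂ) _ _
      simp [h4]
      ring
    rw [h3] at h2
    convert! h2 using 1
    ext s
    exact (inner_self_eq_norm_sq (𝕜 := ℂ) (Y s j)).symm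
  have hgd : ∀ t, HasDerivAt (fun t => (-Complex.I * ⟪flow Φ t φ, e t⟫).re)
      (⟪flow Φ t ((-(r * Complex.I)) • (a - φ)), e t⟫ +
        ⟪e t, flow Φ t ((-(r * Complex.I)) • (a - φ))⟫).re t := fun t =>
    Complex.reCLM.hasFDerivAt.comp_hasDerivAt t
      (hΦ.hasDerivAt_inner_flow (hp.graphAdjoint_closure hΦ) hφH hec hφe t)
  have key := add_mul_add_le_of_hasDerivAt hfd hgd
    (fun t => hm t _ _ (hΦ.flow_mem_graph t hφH) (hφe t)) ht
  have h0 : ∀ j, q 0 j = p j := fun j =>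
    (P j).mem_graph_snd_inj (hqφ 0 j) (hφp j) (hΦ.flow_zero φ)
  rw [hg 0] at key
  have hY0 : ∀ j, Y 0 j = ξ j := fun j => by simp [hY]
  have hYt : ∀ j, ‖Y t j‖ = ‖y j‖ := fun j => by
    rw [← hΦ.norm_flow t, (X j).mem_graph_snd_inj (hYX t j) (hy j) rfl]
  simpa only [hY0, h0, hYt, hΦ.flow_zero] using key

end PhaseSpace

end Dynamics

/-! ### Ballistic bounds in the abstract setting -/

section Ballistic

variable {K : Type*} [NormedAddCommGroup K] [InnerProductSpace ℂ K] [CompleteSpace K] {d : ℕ}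

/-- The strict Mourre estimate for a commutator form, on the range of a projection `Q`. -/
def MourreBound (H A : K →ₗ.[ℂ] K) (Q : K →L[ℂ] K) (α : ℝ) : Prop :=
  ∀ φ h e, Q φ = φ → (φ, h) ∈ H.graph → (φ, e) ∈ A.graph → α * ‖φ‖ ^ 2 ≤ (⟪h, e⟫ + ⟪e, h⟫).re

namespace IsBorelFunctionalCalculus

variable {H : K →ₗ.[ℂ] K} {Φ : (ℝ → ℂ) → K →L[ℂ] K}

theorem res_eq_smul_yosida {r : ℝ} (hr : r ≠ 0) (a : K) :
    res Φ r a = (-(r * Complex.I) : ℂ)⁻¹ • yosida Φ r a := by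
  have : (-(r * Complex.I) : ℂ) ≠ 0 := by simpa using hr
  rw [yosida, smul_apply, inv_smul_smul₀ this]

theorem norm_res_le (h : IsBorelFunctionalCalculus H Φ) {r : ℝ} (hr : 0 < r) (a : K) :
    ‖res Φ r a‖ ≤ r⁻¹ * ‖a‖ := by
  rw [res_eq_smul_yosida hr.ne', norm_smul, norm_inv, norm_neg, norm_mul, Complex.norm_I, mul_one,
    Complex.norm_real, Real.norm_eq_abs, abs_of_pos hr]
  gcongr
  exact h.norm_yosida_le hr.ne' a

theorem tendsto_yosida_yosida (h : IsBorelFunctionalCalculus H Φ) (a : K) :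
    Tendsto (fun n : ℕ => yosida Φ ((n : ℝ) + 1) (yosida Φ ((n : ℝ) + 1) a)) atTop (𝓝 a) := by
  have h1 := h.tendsto_yosida a
  have h2 : Tendsto (fun n : ℕ => yosida Φ ((n : ℝ) + 1) (yosida Φ ((n : ℝ) + 1) a - a)) atTop
      (𝓝 0) := by
    refine squeeze_zero_norm (fun n => h.norm_yosida_le (by positivity) _) ?_
    exact tendsto_iff_norm_sub_tendsto_zero.1 h1
  have h3 := h2.add h1
  rw [zero_add] at h3
  refine h3.congr fun n => ?_
  simp

end IsBorelFunctionalCalculus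

namespace PhaseSpace

variable {H S : K →ₗ.[ℂ] K} {X P : Fin d → K →ₗ.[ℂ] K} {M : Fin d → ℝ → K →L[ℂ] K}
  {T : ℕ → K →L[ℂ] K} {v : ℝ} {Φ : (ℝ → ℂ) → K →L[ℂ] K}

/-- The identity behind the bound is `X_j J_r a = J_r X_j a - 2i (H - ir)⁻¹ P_j J_r a`, where the
last resolvent has norm at most `1/r`. -/
theorem exists_position_yosida (hp : PhaseSpace H S X P M T v)
    (hΦ : IsBorelFunctionalCalculus H Φ) {r : ℝ} (hr : 0 < r) {a b p : K} {j : Fin d}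
    (hab : (a, b) ∈ (X j).graph) (hap : (yosida Φ r a, p) ∈ (P j).graph) :
    ∃ c, (yosida Φ r a, c) ∈ (X j).graph ∧ ‖c‖ ≤ ‖b‖ + 2 * r⁻¹ * ‖p‖ := by
  have h1 : yosida Φ r a = res Φ r ((-(r * Complex.I)) • a) := by
    rw [_root_.map_smul]; rfl
  have h2 := (X j).graph.smul_mem (-(r * Complex.I) : ℂ) hab
  rw [h1] at hap ⊢
  refine ⟨_, hp.res_mem_position hΦ hr.ne' h2 hap, ?_⟩
  rw [_root_.map_sub, _root_.map_smul, _root_.map_smul]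
  refine (norm_sub_le _ _).trans (add_le_add (hΦ.norm_yosida_le hr.ne' b) ?_)
  rw [norm_smul, mul_assoc]
  simp only [Complex.norm_mul, Complex.norm_ofNat, Complex.norm_I, mul_one]
  gcongr
  exact hΦ.norm_res_le hr p

theorem norm_le_sqrt_of_sum_le {E : ℝ} {q : Fin d → K} (h : ∑ j, ‖q j‖ ^ 2 ≤ E) (j : Fin d) :
    ‖q j‖ ≤ √E :=
  Real.le_sqrt_of_sq_le ((Finset.single_le_sum (f := fun j => ‖q j‖ ^ 2)
    (fun _ _ => sq_nonneg _) (Finset.mem_univ j)).trans h)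

/-- The position grows at most linearly in time. -/
theorem exists_position_flow_le (hp : PhaseSpace H S X P M T v) (hv : 0 ≤ v)
    (hΦ : IsBorelFunctionalCalculus H Φ) {ψ : K} {x p : Fin d → K}
    (hx : ∀ j, (ψ, x j) ∈ (X j).graph) (hψp : ∀ j, (ψ, p j) ∈ (P j).graph) :
    ∃ C, 0 ≤ C ∧ ∀ t, 0 ≤ t → ∀ j, ∃ y, (flow Φ t ψ, y) ∈ (X j).graph ∧ ‖y‖ ≤ C * (1 + t) := by
  -- The coefficient is `4` for one Yosida regularisation plus `2` for the flow.
  set E := ∑ j, ‖p j‖ ^ 2 + 6 * v * ‖ψ‖ ^ 2 with hE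
  have hvψ : 0 ≤ v * ‖ψ‖ ^ 2 := by positivity
  refine ⟨∑ j, ‖x j‖ + 2 * √E, by positivity, fun t ht j => ?_⟩
  -- A bound on `‖M_s a - a‖` is closed under strong limits. It therefore suffices to prove it for
  -- the regularised vectors with a constant independent of `n`.
  refine hp.position_of_bound j _ _ fun s => ?_
  have h2 : Tendsto (fun n : ℕ => ‖M j s (flow Φ t (yosida Φ ((n : ℝ) + 1) ψ)) -
      flow Φ t (yosida Φ ((n : ℝ) + 1) ψ)‖) atTop (𝓝 ‖M j s (flow Φ t ψ) - flow Φ t ψ‖) := by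
    have hc : Continuous fun a => ‖M j s (flow Φ t a) - flow Φ t a‖ := by fun_prop
    exact (hc.tendsto ψ).comp (hΦ.tendsto_yosida ψ)
  refine le_of_tendsto' h2 fun n => ?_
  have hr : 0 < (n : ℝ) + 1 := by positivity
  have hr1 : ((n : ℝ) + 1)⁻¹ ≤ 1 := inv_le_one_of_one_le₀ (by linarith [n.cast_nonneg (α := ℝ)])
  set r := (n : ℝ) + 1
  have hH := hΦ.yosida_mem_graph hr.ne' ψ
  have hn := hΦ.norm_yosida_le hr.ne' ψ
  set φ := yosida Φ r ψ
  choose q hq using fun τ => hp.exists_momentum (hΦ.flow_mem_graph τ hH)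
  have hq0 : ∀ j, (φ, q 0 j) ∈ (P j).graph := fun j => by
    simpa only [hΦ.flow_zero] using hq 0 j
  have e0 := hp.sum_norm_momentum_yosida_sq_le hv hΦ hr.ne' hψp hq0
  have e1 : ∀ τ, ∑ j, ‖q τ j‖ ^ 2 ≤ E := by
    intro τ
    have := hp.sum_norm_momentum_flow_sq_le hΦ hH hq0 (hq τ)
    have h3 : v * ‖φ‖ ^ 2 ≤ v * ‖ψ‖ ^ 2 := by gcongr
    linarith
  obtain ⟨ξ, hξ, hξn⟩ := hp.exists_position_yosida hΦ hr (hx j) (hq0 j)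
  have h4 := hp.flow_mem_position hΦ hH hξ (fun τ => hq τ j) t
  refine (hp.norm_modulation_sub_le j _ _ h4 s).trans ?_
  gcongr
  rw [hΦ.norm_flow]
  have h5 := intervalIntegral.norm_integral_le_of_norm_le_const (a := 0) (b := t)
    (f := fun τ => (2 : ℂ) • flow Φ (-τ) (q τ j)) (C := 2 * √E) (fun τ _ => by
      rw [norm_smul, hΦ.norm_flow, Complex.norm_ofNat]
      gcongr
      exact norm_le_sqrt_of_sum_le (e1 τ) j)
  rw [sub_zero, abs_of_nonneg ht] at h5
  have h6 := norm_le_sqrt_of_sum_le (e1 0) j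
  have h7 : ‖x j‖ ≤ ∑ j, ‖x j‖ :=
    Finset.single_le_sum (f := fun j => ‖x j‖) (fun i _ => norm_nonneg _) (Finset.mem_univ j)
  have h8 : 2 * r⁻¹ * ‖q 0 j‖ ≤ 2 * 1 * √E := by gcongr
  refine (norm_add_le _ _).trans ?_
  have h9 : 0 ≤ t * ∑ j, ‖x j‖ := by positivity
  linarith

/-- The strict Mourre estimate makes the second moment of the position grow quadratically. -/
theorem exists_quadratic_lower_bound (hp : PhaseSpace H S X P M T v) (hv : 0 ≤ v)
    (hΦ : IsBorelFunctionalCalculus H Φ) {ψ : K} {x p : Fin d → K}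
    (hx : ∀ j, (ψ, x j) ∈ (X j).graph) (hψp : ∀ j, (ψ, p j) ∈ (P j).graph) {f : ℝ → ℂ}
    (hf : IsBoundedBorel f) (hfψ : Φ f ψ = ψ) :
    ∃ B, 0 ≤ B ∧ ∀ α, MourreBound H (opCommutator S H).closure (Φ f) α → ∀ t, 0 ≤ t →
      ∀ y : Fin d → K, (∀ j, (flow Φ t ψ, y j) ∈ (X j).graph) →
        α * ‖ψ‖ ^ 2 * t ^ 2 / 2 - B * t ≤ ∑ j, ‖y j‖ ^ 2 := by
  -- Two Yosida regularisations cost `4` each and the flow costs `2`.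
  set E := ∑ j, ‖p j‖ ^ 2 + 10 * v * ‖ψ‖ ^ 2 with hE
  have hvψ : 0 ≤ v * ‖ψ‖ ^ 2 := by positivity
  -- The constant bounds the initial derivative `4 ∑ Re⟨x₂ j, p₂ j⟩` uniformly in `r`, and it is
  -- chosen before `α`.
  refine ⟨∑ j, 4 * ((‖x j‖ + 4 * √E) * √E), by positivity, fun α hα t ht y hy => ?_⟩
  have hlim1 : Tendsto (fun n : ℕ =>
      α * ‖yosida Φ ((n : ℝ) + 1) (yosida Φ ((n : ℝ) + 1) ψ)‖ ^ 2 * t ^ 2 / 2 -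
        (∑ j, 4 * ((‖x j‖ + 4 * √E) * √E)) * t) atTop
      (𝓝 (α * ‖ψ‖ ^ 2 * t ^ 2 / 2 - (∑ j, 4 * ((‖x j‖ + 4 * √E) * √E)) * t)) := by
    have hc : Continuous fun a : K => α * ‖a‖ ^ 2 * t ^ 2 / 2 -
      (∑ j, 4 * ((‖x j‖ + 4 * √E) * √E)) * t := by fun_prop
    exact (hc.tendsto ψ).comp (hΦ.tendsto_yosida_yosida ψ)
  have hlim2 : Tendsto (fun n : ℕ => ∑ j, (‖y j‖ + 4 * √E * (1 / ((n : ℝ) + 1))) ^ 2) atTop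
      (𝓝 (∑ j, (‖y j‖ + 4 * √E * 0) ^ 2)) := by
    have hc : Continuous fun a : ℝ => ∑ j, (‖y j‖ + 4 * √E * a) ^ 2 := by fun_prop
    exact (hc.tendsto 0).comp (tendsto_one_div_add_atTop_nhds_zero_nat (𝕜 := ℝ))
  simp only [mul_zero, add_zero] at hlim2
  refine le_of_tendsto_of_tendsto' hlim1 hlim2 fun n => ?_
  have hr : 0 < (n : ℝ) + 1 := by positivity
  have hr1 : ((n : ℝ) + 1)⁻¹ ≤ 1 := inv_le_one_of_one_le₀ (by linarith [n.cast_nonneg (α := ℝ)])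
  set r := (n : ℝ) + 1
  -- Regularisation and flow commute with `Φ f`, so the Mourre bound applies along the whole
  -- regularised orbit.
  have hfJ : ∀ a, Φ f a = a → Φ f (yosida Φ r a) = yosida Φ r a := fun a ha => by
    rw [yosida, smul_apply, _root_.map_smul]
    congr 1
    refine (hΦ.comm hf (isBoundedBorel_res hr.ne') a).trans ?_
    rw [ha]
    rfl
  have hfU : ∀ t a, Φ f a = a → Φ f (flow Φ t a) = flow Φ t a := fun t a ha => by
    refine (hΦ.comm hf (isBoundedBorel_exp t) a).trans ?_
    rw [ha]
    rfl
  have hH := hΦ.yosida_mem_graph hr.ne' ψ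
  have hn := hΦ.norm_yosida_le hr.ne' ψ
  have hfa := hfJ ψ hfψ
  have hUa := hΦ.yosida_flow hr.ne' t ψ
  set a := yosida Φ r ψ
  have hH' := hΦ.yosida_mem_graph hr.ne' a
  have hn' := hΦ.norm_yosida_le hr.ne' a
  have hfφ := hfJ a hfa
  have hUφ := hΦ.yosida_flow hr.ne' t a
  choose p₁ hp₁ using hp.exists_momentum hH
  choose p₂ hp₂ using hp.exists_momentum hH'
  choose q₁ hq₁ using hp.exists_momentum (hΦ.flow_mem_graph t hH)
  choose q₂ hq₂ using hp.exists_momentum (hΦ.flow_mem_graph t hH')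
  have e1 := hp.sum_norm_momentum_yosida_sq_le hv hΦ hr.ne' hψp hp₁
  have e2 := hp.sum_norm_momentum_yosida_sq_le hv hΦ hr.ne' hp₁ hp₂
  have e3 := hp.sum_norm_momentum_flow_sq_le hΦ hH hp₁ hq₁
  have e4 := hp.sum_norm_momentum_flow_sq_le hΦ hH' hp₂ hq₂
  have hva : v * ‖a‖ ^ 2 ≤ v * ‖ψ‖ ^ 2 := by gcongr
  have hvφ : v * ‖yosida Φ r a‖ ^ 2 ≤ v * ‖ψ‖ ^ 2 := by gcongr; exact hn'.trans hn
  have b1 := norm_le_sqrt_of_sum_le (show ∑ j, ‖p₁ j‖ ^ 2 ≤ E by linarith)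
  have b2 := norm_le_sqrt_of_sum_le (show ∑ j, ‖p₂ j‖ ^ 2 ≤ E by linarith)
  have b3 := norm_le_sqrt_of_sum_le (show ∑ j, ‖q₁ j‖ ^ 2 ≤ E by linarith)
  have b4 := norm_le_sqrt_of_sum_le (show ∑ j, ‖q₂ j‖ ^ 2 ≤ E by linarith)
  choose x₁ hx₁ hx₁n using fun j => hp.exists_position_yosida hΦ hr (hx j) (hp₁ j)
  choose x₂ hx₂ hx₂n using fun j => hp.exists_position_yosida hΦ hr (hx₁ j) (hp₂ j)
  have hq₁' : ∀ j, (yosida Φ r (flow Φ t ψ), q₁ j) ∈ (P j).graph := fun j => hUa ▸ hq₁ j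
  choose y₁ hy₁ hy₁n using fun j => hp.exists_position_yosida hΦ hr (hy j) (hq₁' j)
  rw [hUa] at hy₁
  have hq₂' : ∀ j, (yosida Φ r (flow Φ t a), q₂ j) ∈ (P j).graph := fun j => hUφ ▸ hq₂ j
  choose y₂ hy₂ hy₂n using fun j => hp.exists_position_yosida hΦ hr (hy₁ j) (hq₂' j)
  rw [hUφ] at hy₂
  have key := hp.growth_of_commutator_bound hΦ hr.ne' hH hx₁ hx₂ hp₂
    (m := α * ‖yosida Φ r a‖ ^ 2) (fun t h e hh he => by
      rw [← hΦ.norm_flow t]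
      exact hα _ h e (hfU t _ hfφ) hh he) ht hy₂
  have c1 : 0 ≤ ∑ j, ‖x₂ j‖ ^ 2 := by positivity
  have hrE : 2 * r⁻¹ * √E ≤ 2 * 1 * √E := by gcongr
  have c2 : -(∑ j, 4 * ((‖x j‖ + 4 * √E) * √E)) ≤ ∑ j, 4 * (⟪x₂ j, p₂ j⟫ : ℂ).re := by
    rw [← Finset.sum_neg_distrib]
    refine Finset.sum_le_sum fun j _ => ?_
    have d1 : -(⟪x₂ j, p₂ j⟫ : ℂ).re ≤ ‖x₂ j‖ * ‖p₂ j‖ :=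
      (neg_le_abs _).trans ((Complex.abs_re_le_norm _).trans (norm_inner_le_norm _ _))
    have d2 : 2 * r⁻¹ * ‖p₁ j‖ ≤ 2 * r⁻¹ * √E := by gcongr; exact b1 j
    have d3 : 2 * r⁻¹ * ‖p₂ j‖ ≤ 2 * r⁻¹ * √E := by gcongr; exact b2 j
    have d4 : ‖x₂ j‖ ≤ ‖x j‖ + 4 * √E := by linarith [hx₁n j, hx₂n j]
    have d5 : ‖x₂ j‖ * ‖p₂ j‖ ≤ (‖x j‖ + 4 * √E) * √E := by gcongr; exact b2 j
    linarith
  -- Regularisation commutes with the flow, so the positions of the regularised orbit exceed those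
  -- of `flow Φ t ψ` by at most `4√E / r`, which vanishes in the limit.
  have c3 : ∑ j, ‖y₂ j‖ ^ 2 ≤ ∑ j, (‖y j‖ + 4 * √E * (1 / r)) ^ 2 := by
    refine Finset.sum_le_sum fun j _ => ?_
    have d2 : 2 * r⁻¹ * ‖q₁ j‖ ≤ 2 * r⁻¹ * √E := by gcongr; exact b3 j
    have d3 : 2 * r⁻¹ * ‖q₂ j‖ ≤ 2 * r⁻¹ * √E := by gcongr; exact b4 j
    have d4 : ‖y₂ j‖ ≤ ‖y j‖ + 4 * √E * (1 / r) := by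
      rw [one_div]
      linarith [hy₁n j, hy₂n j]
    gcongr
  have c4 := mul_le_mul_of_nonneg_left c2 ht
  linarith

/-- The operator `G` is a bounded, injective lower bound for the position. It replaces the Mourre
estimate at small times, where the linear loss `B t` may dominate. -/
theorem exists_ballistic_bounds (hp : PhaseSpace H S X P M T v) (hv : 0 ≤ v)
    (hΦ : IsBorelFunctionalCalculus H Φ) {ψ : K} (hψ : ψ ≠ 0) {x p : Fin d → K}
    (hx : ∀ j, (ψ, x j) ∈ (X j).graph) (hψp : ∀ j, (ψ, p j) ∈ (P j).graph) {f : ℝ → ℂ}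
    (hf : IsBoundedBorel f) (hfψ : Φ f ψ = ψ)
    (hG : 0 < d → ∃ G : K →L[ℂ] K, (∀ a, G a = 0 → a = 0) ∧
      ∀ a (y : Fin d → K), (∀ j, (a, y j) ∈ (X j).graph) → ‖G a‖ ^ 2 ≤ ∑ j, ‖y j‖ ^ 2)
    (hM : ∃ α, 0 < α ∧ MourreBound H (opCommutator S H).closure (Φ f) α) :
    ∃ c C, 0 < c ∧ 0 < C ∧ ∀ t, 0 ≤ t →
      ∃ y : Fin d → K, (∀ j, (flow Φ t ψ, y j) ∈ (X j).graph) ∧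
        c * t ^ 2 ≤ ∑ j, ‖y j‖ ^ 2 ∧ ∑ j, ‖y j‖ ^ 2 ≤ C * (1 + t) ^ 2 ∧
        ∀ α, 0 < α → MourreBound H (opCommutator S H).closure (Φ f) α →
          (c * α * t) ^ 2 ≤ ∑ j, ‖y j‖ ^ 2 := by
  obtain ⟨C, hC, hup⟩ := hp.exists_position_flow_le hv hΦ hx hψp
  obtain ⟨B, hB, hlow⟩ := hp.exists_quadratic_lower_bound hv hΦ hx hψp hf hfψ
  obtain ⟨α₀, hα₀, hM₀⟩ := hM
  have hN : 0 < ‖ψ‖ ^ 2 := by positivity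
  set N := ‖ψ‖ ^ 2
  have hup' : ∀ t, 0 ≤ t → ∀ y : Fin d → K, (∀ j, (flow Φ t ψ, y j) ∈ (X j).graph) →
      ∑ j, ‖y j‖ ^ 2 ≤ (d * C ^ 2) * (1 + t) ^ 2 := by
    intro t ht y hy
    have h1 : ∀ j, ‖y j‖ ^ 2 ≤ (C * (1 + t)) ^ 2 := by
      intro j
      obtain ⟨y', hy', hn⟩ := hup t ht j
      rw [(X j).mem_graph_snd_inj (hy j) hy' rfl]
      gcongr
    refine (Finset.sum_le_sum fun j _ => h1 j).trans (le_of_eq ?_)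
    simp
    ring
  -- From this time on, `B t` is at most half of the quadratic term `α₀ N t² / 2`.
  set Tm := 4 * B / (α₀ * N) with hTm
  have hTm0 : 0 ≤ Tm := by positivity
  have hfar : ∀ t, Tm ≤ t → ∀ y : Fin d → K, (∀ j, (flow Φ t ψ, y j) ∈ (X j).graph) →
      α₀ * N / 4 * t ^ 2 ≤ ∑ j, ‖y j‖ ^ 2 := by
    intro t ht y hy
    have ht0 := hTm0.trans ht
    have h1 := hlow α₀ hM₀ t ht0 y hy
    rw [hTm, div_le_iff₀ (by positivity)] at ht
    nlinarith
  -- In dimension zero the second moment is an empty sum, which contradicts the growth just proved.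
  have hd : 0 < d := by
    rcases Nat.eq_zero_or_pos d with rfl | h
    · exfalso
      have h1 := hfar (Tm + 1) (by linarith) (fun j => j.elim0) (fun j => j.elim0)
      have h2 : 0 < α₀ * N / 4 * (Tm + 1) ^ 2 := by positivity
      simp only [Finset.univ_eq_empty, Finset.sum_empty] at h1
      linarith
    · exact h
  obtain ⟨G, hG0, hGle⟩ := hG hd
  -- Compactness of `[0, Tm]`: the continuous function `‖G ψ_t‖²` attains its minimum, and this is
  -- positive since `G` is injective and `ψ_t ≠ 0`.
  obtain ⟨δ, hδ, hnear⟩ : ∃ δ, 0 < δ ∧ ∀ t, 0 ≤ t → t ≤ Tm → δ ≤ ‖G (flow Φ t ψ)‖ ^ 2 := by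
    have hc : Continuous fun t => ‖G (flow Φ t ψ)‖ ^ 2 := by
      have := hΦ.continuous_flow ψ
      fun_prop
    obtain ⟨t₀, -, ht₀⟩ := isCompact_Icc.exists_isMinOn (Set.nonempty_Icc.2 hTm0)
      hc.continuousOn
    refine ⟨‖G (flow Φ t₀ ψ)‖ ^ 2, ?_, fun t h0 h1 => ht₀ ⟨h0, h1⟩⟩
    have : G (flow Φ t₀ ψ) ≠ 0 := fun h0 => hψ (by
      rw [← norm_eq_zero, ← hΦ.norm_flow t₀, hG0 _ h0, norm_zero])
    positivity
  set c₀ := min (α₀ * N / 4) (δ / (Tm + 1) ^ 2) with hc₀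
  have hc₀pos : 0 < c₀ := lt_min (by positivity) (by positivity)
  have hall : ∀ t, 0 ≤ t → ∀ y : Fin d → K, (∀ j, (flow Φ t ψ, y j) ∈ (X j).graph) →
      c₀ * t ^ 2 ≤ ∑ j, ‖y j‖ ^ 2 := by
    intro t ht y hy
    rcases le_total Tm t with h | h
    · exact (mul_le_mul_of_nonneg_right (min_le_left _ _) (sq_nonneg t)).trans (hfar t h y hy)
    · refine (mul_le_mul_of_nonneg_right (min_le_right _ _) (sq_nonneg t)).trans ?_
      refine le_trans ?_ ((hnear t ht h).trans (hGle _ y hy))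
      rw [div_mul_eq_mul_div, div_le_iff₀ (by positivity)]
      gcongr
      linarith
  -- At `t = 1` the lower bound `α N / 2 - B` cannot exceed the upper bound `4 d C²`, which caps
  -- every `α` for which the Mourre bound holds.
  set αm := 2 * (B + 4 * (d * C ^ 2)) / N with hαm
  have hαm0 : 0 ≤ αm := by positivity
  have hαle : ∀ α, MourreBound H (opCommutator S H).closure (Φ f) α → α ≤ αm := by
    intro α hα
    choose y hy _ using hup 1 zero_le_one
    have h1 := hlow α hα 1 zero_le_one y hy
    have h2 := hup' 1 zero_le_one y hy
    rw [hαm, le_div_iff₀ hN]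
    linarith
  -- The first entry of the minimum serves the bound `c t²`. The second makes `c α ≤ √c₀` for all `α
  -- ≤ αm`; the `+ 1` keeps the denominator positive.
  refine ⟨min c₀ (√c₀ / (αm + 1)), d * C ^ 2 + 1, lt_min hc₀pos (by positivity), by positivity,
    fun t ht => ?_⟩
  choose y hy _ using hup t ht
  have h1 := hall t ht y hy
  refine ⟨y, hy, ?_, ?_, fun α hα hαM => ?_⟩
  · exact (mul_le_mul_of_nonneg_right (min_le_left _ _) (sq_nonneg t)).trans h1
  · refine (hup' t ht y hy).trans ?_
    gcongr
    linarith
  · refine le_trans ?_ h1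
    have h2 : min c₀ (√c₀ / (αm + 1)) * α ≤ √c₀ := by
      have h3 : min c₀ (√c₀ / (αm + 1)) * α ≤ √c₀ / (αm + 1) * (αm + 1) := by
        gcongr
        · exact min_le_right _ _
        · linarith [hαle α hαM]
      rwa [div_mul_cancel₀ _ (by positivity)] at h3
    have h4 : 0 ≤ min c₀ (√c₀ / (αm + 1)) * α := by positivity
    rw [mul_pow]
    gcongr
    calc (min c₀ (√c₀ / (αm + 1)) * α) ^ 2 ≤ √c₀ ^ 2 := by gcongr
      _ = c₀ := Real.sq_sqrt hc₀pos.le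

end PhaseSpace

end Ballistic

/-! ### Multiplication operators on `L²(ℝ^d)` -/

section Multiplication

variable {d : ℕ}

theorem L2.norm_sq_eq_integral (a : L2 d) : ‖a‖ ^ 2 = ∫ x, ‖a x‖ ^ 2 := by
  have h1 := inner_self_eq_norm_sq_to_K (𝕜 := ℂ) a
  rw [MeasureTheory.L2.inner_def] at h1
  have h2 : ∀ x, ⟪a x, a x⟫ = ((‖a x‖ ^ 2 : ℝ) : ℂ) := fun x => by
    rw [inner_self_eq_norm_sq_to_K]
    push_cast
    rfl
  simp only [h2] at h1
  have h3 : ((∫ x, ‖a x‖ ^ 2 : ℝ) : ℂ) = ((‖a‖ ^ 2 : ℝ) : ℂ) := by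
    rw [← integral_complex_ofReal, h1]
    push_cast
    rfl
  exact (Complex.ofReal_injective h3).symm

theorem L2.integrable_norm_sq (a : L2 d) :
    Integrable (fun x => ‖a x‖ ^ 2) (volume : Measure (EuclideanSpace ℝ (Fin d))) :=
  (Lp.memLp a).integrable_norm_pow (by norm_num)

/-- Dominated convergence in `L²`. -/
theorem L2.tendsto_of_dominated {ι : Type*} {l : Filter ι} [l.IsCountablyGenerated]
    {F : ι → L2 d} {u : ι → EuclideanSpace ℝ (Fin d) → ℂ} {f g : L2 d}
    (hF : ∀ i, F i =ᵐ[volume] u i) (hb : ∀ i, ∀ᵐ x, ‖u i x‖ ≤ ‖g x‖)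
    (hl : ∀ᵐ x, Tendsto (fun i => u i x) l (𝓝 (f x))) : Tendsto F l (𝓝 f) := by
  have hFf : ∀ i, (F i - f : L2 d) =ᵐ[volume] fun x => u i x - f x := fun i => by
    filter_upwards [hF i, Lp.coeFn_sub (F i) f] with x h1 h2
    rw [h2, Pi.sub_apply, h1]
  have h1 : Tendsto (fun i => ∫ x, ‖(F i - f : L2 d) x‖ ^ 2) l
      (𝓝 (∫ _, (0 : ℝ) ∂(volume : Measure (EuclideanSpace ℝ (Fin d))))) := by
    have h2 : ∀ i, ∫ x, ‖(F i - f : L2 d) x‖ ^ 2 = ∫ x, ‖u i x - f x‖ ^ 2 := fun i =>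
      integral_congr_ae ((hFf i).mono fun x hx => by simp only [hx])
    simp only [h2]
    refine tendsto_integral_filter_of_dominated_convergence
      (fun x => 2 * ‖g x‖ ^ 2 + 2 * ‖f x‖ ^ 2) ?_ ?_ ?_ ?_
    · refine Eventually.of_forall fun i => ?_
      exact (((Lp.aestronglyMeasurable (F i - f)).congr (hFf i)).norm.pow 2)
    · refine Eventually.of_forall fun i => ?_
      filter_upwards [hb i] with x hx
      rw [Real.norm_of_nonneg (sq_nonneg _)]
      have h3 := norm_sub_le (u i x) (f x)
      nlinarith [norm_nonneg (u i x - f x), norm_nonneg (u i x), sq_nonneg (‖u i x‖ - ‖f x‖),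
        norm_nonneg (f x)]
    · exact ((L2.integrable_norm_sq g).const_mul 2).add ((L2.integrable_norm_sq f).const_mul 2)
    · filter_upwards [hl] with x hx
      have h3 : Tendsto (fun i => ‖u i x - f x‖ ^ 2) l (𝓝 (‖f x - f x‖ ^ 2)) :=
        ((hx.sub tendsto_const_nhds).norm).pow 2
      simpa using h3
  rw [integral_zero] at h1
  simp only [← L2.norm_sq_eq_integral] at h1
  rw [tendsto_iff_norm_sub_tendsto_zero]
  have h4 := (Real.continuous_sqrt.tendsto 0).comp h1
  rw [Real.sqrt_zero] at h4
  refine h4.congr fun i => ?_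
  simp [Real.sqrt_sq]

theorem mem_graph_mulOp {g : EuclideanSpace ℝ (Fin d) → ℝ} {a b : L2 d} :
    (a, b) ∈ (mulOp g).graph ↔ b =ᵐ[volume] fun x => (g x : ℂ) * a x := by
  constructor
  · intro h
    obtain ⟨⟨a', ha'⟩, ha, hb⟩ := (LinearPMap.mem_graph_iff _).1 h
    dsimp only at ha hb
    subst ha
    rw [← hb]
    exact MemLp.coeFn_toLp ha'
  · intro h
    have ha : MemLp (fun x => (g x : ℂ) * a x) 2 volume := (memLp_congr_ae h).1 (Lp.memLp b)
    refine (LinearPMap.mem_graph_iff _).2 ⟨⟨a, ha⟩, rfl, ?_⟩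
    apply Lp.ext
    exact (MemLp.coeFn_toLp ha).trans h.symm

theorem graphAdjoint_mulOp (g : EuclideanSpace ℝ (Fin d) → ℝ) :
    GraphAdjoint 1 (mulOp g).graph := by
  intro a b a' b' h h'
  rw [mem_graph_mulOp] at h h'
  rw [one_mul, MeasureTheory.L2.inner_def, MeasureTheory.L2.inner_def]
  refine integral_congr_ae ?_
  filter_upwards [h, h'] with x hx hx'
  rw [hx, hx', RCLike.inner_apply, RCLike.inner_apply, _root_.map_mul, Complex.conj_ofReal]
  ring

theorem memLp_bounded_mul {m : EuclideanSpace ℝ (Fin d) → ℂ} (hm : Measurable m) {C : ℝ}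
    (hC : ∀ x, ‖m x‖ ≤ C) (a : L2 d) : MemLp (fun x => m x * a x) 2 volume := by
  refine MemLp.of_le_mul (c := C) (Lp.memLp a)
    (hm.aestronglyMeasurable.mul (Lp.aestronglyMeasurable a)) (Eventually.of_forall fun x => ?_)
  rw [norm_mul]
  gcongr
  exact hC x

/-- Multiplication by a bounded measurable function. -/
noncomputable def boundedMul (m : EuclideanSpace ℝ (Fin d) → ℂ) (hm : Measurable m) (C : ℝ)
    (hC : ∀ x, ‖m x‖ ≤ C) : L2 d →L[ℂ] L2 d :=
  LinearMap.mkContinuous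
    { toFun := fun a => (memLp_bounded_mul hm hC a).toLp _
      map_add' := by
        intro a b
        rw [← MemLp.toLp_add, MemLp.toLp_eq_toLp_iff]
        filter_upwards [Lp.coeFn_add a b] with x hx
        rw [hx, Pi.add_apply, Pi.add_apply, mul_add]
      map_smul' := by
        intro c a
        rw [RingHom.id_apply, ← MemLp.toLp_const_smul, MemLp.toLp_eq_toLp_iff]
        filter_upwards [Lp.coeFn_smul c a] with x hx
        rw [hx, Pi.smul_apply, Pi.smul_apply, smul_eq_mul, smul_eq_mul, mul_left_comm] }
    C (by
      intro a
      refine Lp.norm_le_mul_norm_of_ae_le_mul ?_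
      filter_upwards [MemLp.coeFn_toLp (memLp_bounded_mul hm hC a)] with x hx
      rw [LinearMap.coe_mk, AddHom.coe_mk, hx, norm_mul]
      gcongr
      exact hC x)

theorem coeFn_boundedMul {m : EuclideanSpace ℝ (Fin d) → ℂ} (hm : Measurable m) {C : ℝ}
    (hC : ∀ x, ‖m x‖ ≤ C) (a : L2 d) :
    boundedMul m hm C hC a =ᵐ[volume] fun x => m x * a x :=
  MemLp.coeFn_toLp (memLp_bounded_mul hm hC a)

/-- The modulation `e^{i s x_j}`. -/
noncomputable def modulation (j : Fin d) (s : ℝ) : L2 d →L[ℂ] L2 d :=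
  boundedMul (fun x => Complex.exp (Complex.I * (s * x j : ℝ))) (by fun_prop) 1 fun x => by
    rw [mul_comm, Complex.norm_exp_ofReal_mul_I]

theorem coeFn_modulation (j : Fin d) (s : ℝ) (a : L2 d) :
    modulation j s a =ᵐ[volume] fun x => Complex.exp (Complex.I * (s * x j : ℝ)) * a x :=
  coeFn_boundedMul _ _ a

/-- The cut-off to the ball of radius `n`. -/
noncomputable def cutoff (d n : ℕ) : L2 d →L[ℂ] L2 d :=
  boundedMul ((Metric.closedBall 0 n).indicator fun _ => 1)
    (measurable_const.indicator Metric.isClosed_closedBall.measurableSet) 1 fun x =>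
      (norm_indicator_le_norm_self _ _).trans (by simp)

theorem coeFn_cutoff (n : ℕ) (a : L2 d) :
    cutoff d n a =ᵐ[volume] fun x => (Metric.closedBall 0 n).indicator (fun _ => 1) x * a x :=
  coeFn_boundedMul _ _ a

/-- Multiplication by `min (‖x‖, 1)`. -/
noncomputable def truncatedNorm (d : ℕ) : L2 d →L[ℂ] L2 d :=
  boundedMul (fun x => (min ‖x‖ 1 : ℝ)) (by fun_prop) 1 fun x => by
    rw [Complex.norm_real, Real.norm_of_nonneg (by positivity)]
    exact min_le_right _ _

theorem coeFn_truncatedNorm (a : L2 d) :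
    truncatedNorm d a =ᵐ[volume] fun x => ((min ‖x‖ 1 : ℝ) : ℂ) * a x :=
  coeFn_boundedMul _ _ a

/-- The multiplier vanishes only at the origin, a null set in positive dimension. -/
theorem truncatedNorm_injective (hd : 0 < d) {a : L2 d} (ha : truncatedNorm d a = 0) : a = 0 := by
  have : Nonempty (Fin d) := ⟨⟨0, hd⟩⟩
  rw [Lp.eq_zero_iff_ae_eq_zero] at ha ⊢
  have h0 : ∀ᵐ x : EuclideanSpace ℝ (Fin d), x ≠ 0 := by
    rw [ae_iff]
    simp
  filter_upwards [ha, coeFn_truncatedNorm a, h0] with x h1 h2 h3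
  rw [h2, Pi.zero_apply] at h1
  have h4 : ((min ‖x‖ 1 : ℝ) : ℂ) ≠ 0 := by
    have : 0 < min ‖x‖ 1 := lt_min (norm_pos_iff.2 h3) one_pos
    exact_mod_cast this.ne'
  exact (mul_eq_zero.1 h1).resolve_left h4

/-! ### Modulation groups and the domain of position. -/

theorem norm_modulation (j : Fin d) (s : ℝ) (a : L2 d) : ‖modulation j s a‖ = ‖a‖ := by
  have h : ∀ᵐ x, ‖modulation j s a x‖ = ‖a x‖ := by
    filter_upwards [coeFn_modulation j s a] with x hx
    rw [hx, norm_mul, mul_comm Complex.I, Complex.norm_exp_ofReal_mul_I, one_mul]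
  exact le_antisymm (Lp.norm_le_norm_of_ae_le (h.mono fun x hx => hx.le))
    (Lp.norm_le_norm_of_ae_le (h.mono fun x hx => hx.ge))

theorem tendsto_modulation (j : Fin d) (a : L2 d) :
    Tendsto (fun s => modulation j s a) (𝓝 0) (𝓝 a) := by
  refine L2.tendsto_of_dominated (g := a) (fun s => coeFn_modulation j s a) (fun s => ?_) ?_
  · refine Eventually.of_forall fun x => ?_
    rw [norm_mul, mul_comm Complex.I, Complex.norm_exp_ofReal_mul_I, one_mul]
  · refine Eventually.of_forall fun x => ?_
    have hc : Continuous fun s : ℝ => Complex.exp (Complex.I * (s * x j : ℝ)) * a x := by fun_prop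
    simpa using hc.tendsto 0

theorem norm_exp_sub_one_mul_le (u : ℝ) (c : ℂ) :
    ‖Complex.exp (Complex.I * u) * c - c‖ ≤ ‖(u : ℂ) * c‖ := by
  rw [← sub_one_mul, norm_mul, norm_mul, Complex.norm_real]
  gcongr
  exact Real.norm_exp_I_mul_ofReal_sub_one_le

theorem norm_modulation_sub_le {j : Fin d} {a b : L2 d}
    (h : (a, b) ∈ (mulOp fun x => x j).graph) (s : ℝ) : ‖modulation j s a - a‖ ≤ |s| * ‖b‖ := by
  rw [mem_graph_mulOp] at h
  refine Lp.norm_le_mul_norm_of_ae_le_mul ?_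
  filter_upwards [h, coeFn_modulation j s a, Lp.coeFn_sub (modulation j s a) a] with x h1 h2 h3
  rw [h3, Pi.sub_apply, h2, h1]
  refine (norm_exp_sub_one_mul_le _ _).trans (le_of_eq ?_)
  rw [norm_mul, norm_mul, Complex.norm_real, Complex.norm_real, norm_mul, Real.norm_eq_abs]
  ring

theorem tendsto_slope_exp (u : ℝ) (c : ℂ) :
    Tendsto (fun s : ℝ => (s : ℂ)⁻¹ * (Complex.exp (Complex.I * (s * u : ℝ)) * c - c)) (𝓝[≠] 0)
      (𝓝 (Complex.I * (u * c))) := by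
  have h1 : HasDerivAt (fun s : ℝ => Complex.exp (Complex.I * (s * u : ℝ)) * c)
      (Complex.I * (u * c)) 0 := by
    have h2 : HasDerivAt (fun s : ℝ => Complex.I * (s * u : ℝ)) (Complex.I * u) 0 := by
      have := (Complex.ofRealCLM.hasDerivAt (x := (0 : ℝ))).mul_const (u : ℂ)
      simpa using this.const_mul Complex.I
    have h3 := h2.cexp.mul_const c
    simpa [mul_assoc] using h3
  rw [hasDerivAt_iff_tendsto_slope] at h1
  refine h1.congr fun s => ?_
  simp [slope_def_module, mul_sub]

theorem coeFn_modulation_slope (j : Fin d) (s : ℝ) (a : L2 d) :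
    ((s : ℂ)⁻¹ • (modulation j s a - a) : L2 d) =ᵐ[volume]
      fun x => (s : ℂ)⁻¹ * (Complex.exp (Complex.I * (s * x j : ℝ)) * a x - a x) := by
  filter_upwards [coeFn_modulation j s a, Lp.coeFn_sub (modulation j s a) a,
    Lp.coeFn_smul (s : ℂ)⁻¹ (modulation j s a - a)] with x h1 h2 h3
  rw [h3, Pi.smul_apply, h2, Pi.sub_apply, h1, smul_eq_mul]

theorem tendsto_modulation_slope {j : Fin d} {a b : L2 d}
    (h : (a, b) ∈ (mulOp fun x => x j).graph) :
    Tendsto (fun s : ℝ => (s : ℂ)⁻¹ • (modulation j s a - a)) (𝓝[≠] 0) (𝓝 (Complex.I • b)) := by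
  rw [mem_graph_mulOp] at h
  refine L2.tendsto_of_dominated (g := b) (fun s => coeFn_modulation_slope j s a) (fun s => ?_) ?_
  · filter_upwards [h] with x hx
    rw [hx, norm_mul, norm_inv, Complex.norm_real]
    by_cases hs : s = 0
    · rw [hs, norm_zero, inv_zero, zero_mul]
      positivity
    · rw [inv_mul_le_iff₀ (norm_pos_iff.2 hs)]
      refine (norm_exp_sub_one_mul_le _ _).trans (le_of_eq ?_)
      rw [norm_mul, norm_mul, Complex.norm_real, Complex.norm_real, norm_mul]
      ring
  · filter_upwards [h, Lp.coeFn_smul Complex.I b] with x hx hx'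
    rw [hx', Pi.smul_apply, hx, smul_eq_mul]
    exact tendsto_slope_exp _ _

/-- Fatou's lemma: the difference quotients are bounded by `C` in `L²` and converge pointwise to `i
x_j a`. -/
theorem exists_of_norm_modulation_sub_le {j : Fin d} {a : L2 d} {C : ℝ}
    (h : ∀ s, ‖modulation j s a - a‖ ≤ |s| * C) :
    ∃ b, (a, b) ∈ (mulOp fun x => x j).graph ∧ ‖b‖ ≤ C := by
  have hC : 0 ≤ C := by simpa using (norm_nonneg _).trans (h 1)
  have h1 : eLpNorm (fun x => Complex.I * (((x j : ℝ) : ℂ) * a x)) 2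
      (volume : Measure (EuclideanSpace ℝ (Fin d))) ≤ ENNReal.ofReal C := by
    refine Lp.eLpNorm_le_of_ae_tendsto (u := 𝓝[≠] (0 : ℝ))
      (f := fun s x => (s : ℂ)⁻¹ * (Complex.exp (Complex.I * (s * x j : ℝ)) * a x - a x)) ?_ ?_ ?_
    · refine Eventually.of_forall fun s => ?_
      rw [← eLpNorm_congr_ae (coeFn_modulation_slope j s a), ← Lp.enorm_def, ← ofReal_norm]
      refine ENNReal.ofReal_le_ofReal ?_
      rw [norm_smul, norm_inv, Complex.norm_real]
      by_cases hs : s = 0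
      · simp [hs, hC]
      · rw [inv_mul_le_iff₀ (norm_pos_iff.2 hs)]
        exact h s
    · exact fun s => (Lp.aestronglyMeasurable _).congr (coeFn_modulation_slope j s a)
    · exact Eventually.of_forall fun x => tendsto_slope_exp _ _
  have h2 : ∀ x : EuclideanSpace ℝ (Fin d), ‖((x j : ℝ) : ℂ) * a x‖ =
      ‖Complex.I * (((x j : ℝ) : ℂ) * a x)‖ := fun x => by
    rw [norm_mul Complex.I, Complex.norm_I, one_mul]
  have h3 : eLpNorm (fun x => ((x j : ℝ) : ℂ) * a x) 2
      (volume : Measure (EuclideanSpace ℝ (Fin d))) ≤ ENNReal.ofReal C := by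
    rwa [eLpNorm_congr_norm_ae (Eventually.of_forall h2)]
  have hm : MemLp (fun x : EuclideanSpace ℝ (Fin d) => ((x j : ℝ) : ℂ) * a x) 2 volume :=
    ⟨(by fun_prop : Measurable fun x : EuclideanSpace ℝ (Fin d) =>
      ((x j : ℝ) : ℂ)).aestronglyMeasurable.mul (Lp.aestronglyMeasurable a),
      h3.trans_lt ENNReal.ofReal_lt_top⟩
  refine ⟨hm.toLp _, mem_graph_mulOp.2 hm.coeFn_toLp, ?_⟩
  rw [Lp.norm_toLp]
  exact ENNReal.toReal_le_of_le_ofReal hC h3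

/-- For the converse, convergence bounds the quotients for small `s` and `‖M_s a - a‖ ≤ 2‖a‖` does
so for large `s`. Hence `a` is in the domain, and uniqueness of limits identifies the value. -/
theorem mem_graph_position_iff {j : Fin d} {a b : L2 d} :
    (a, b) ∈ (mulOp fun x => x j).graph ↔
      Tendsto (fun s : ℝ => (s : ℂ)⁻¹ • (modulation j s a - a)) (𝓝[≠] 0)
        (𝓝 (Complex.I • b)) := by
  refine ⟨tendsto_modulation_slope, fun h => ?_⟩
  obtain ⟨ε, hε, hb⟩ : ∃ ε > 0, ∀ s : ℝ, |s| < ε → ‖modulation j s a - a‖ ≤ |s| * (‖b‖ + 1) := by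
    have h1 : ∀ᶠ s : ℝ in 𝓝[≠] 0, ‖(s : ℂ)⁻¹ • (modulation j s a - a)‖ < ‖b‖ + 1 := by
      refine h.norm.eventually_lt_const ?_
      rw [norm_smul, Complex.norm_I, one_mul]
      linarith
    rw [eventually_nhdsWithin_iff, Metric.eventually_nhds_iff] at h1
    obtain ⟨ε, hε, h2⟩ := h1
    refine ⟨ε, hε, fun s hs => ?_⟩
    by_cases hs0 : s = 0
    · subst hs0
      have : modulation j 0 a = a := by
        apply Lp.ext
        filter_upwards [coeFn_modulation j 0 a] with x hx
        rw [hx]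
        simp
      simp [this]
    · have h3 := (h2 (by simpa using hs) hs0).le
      rwa [norm_smul, norm_inv, Complex.norm_real, inv_mul_le_iff₀ (norm_pos_iff.2 hs0)] at h3
  obtain ⟨c, hc, -⟩ := exists_of_norm_modulation_sub_le (j := j) (a := a)
    (C := max (‖b‖ + 1) (2 * ‖a‖ / ε)) fun s => by
      rcases lt_or_ge |s| ε with hs | hs
      · exact (hb s hs).trans (by gcongr; exact le_max_left _ _)
      · have h4 : ‖modulation j s a - a‖ ≤ 2 * ‖a‖ := by
          refine (norm_sub_le _ _).trans ?_
          rw [norm_modulation]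
          linarith
        refine h4.trans ?_
        have h5 : ε * (2 * ‖a‖ / ε) ≤ |s| * max (‖b‖ + 1) (2 * ‖a‖ / ε) := by
          gcongr
          exact le_max_right _ _
        rwa [mul_div_cancel₀ _ hε.ne'] at h5
  have h5 := tendsto_nhds_unique (tendsto_modulation_slope hc) h
  rwa [smul_right_injective _ Complex.I_ne_zero h5] at hc

/-! ### Cut-offs and the modulus of the position. -/

theorem tendsto_cutoff (a : L2 d) : Tendsto (fun n => cutoff d n a) atTop (𝓝 a) := by
  refine L2.tendsto_of_dominated (g := a) (fun n => coeFn_cutoff n a) (fun n => ?_) ?_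
  · refine Eventually.of_forall fun x => ?_
    by_cases hx : x ∈ Metric.closedBall (0 : EuclideanSpace ℝ (Fin d)) n <;> simp [hx]
  · refine Eventually.of_forall fun x => ?_
    refine tendsto_const_nhds.congr' ?_
    filter_upwards [eventually_ge_atTop ⌈‖x‖⌉₊] with n hn
    have hx : x ∈ Metric.closedBall (0 : EuclideanSpace ℝ (Fin d)) n := by
      rw [mem_closedBall_zero_iff]
      exact Nat.ceil_le.1 hn
    simp [hx]

theorem cutoff_mem_graph {g : EuclideanSpace ℝ (Fin d) → ℝ} (n : ℕ) {a b : L2 d}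
    (h : (a, b) ∈ (mulOp g).graph) : (cutoff d n a, cutoff d n b) ∈ (mulOp g).graph := by
  rw [mem_graph_mulOp] at h ⊢
  filter_upwards [h, coeFn_cutoff n a, coeFn_cutoff n b] with x h1 h2 h3
  rw [h2, h3, h1]
  ring

theorem cutoff_mem_domain (n : ℕ) (j : Fin d) (a : L2 d) :
    ∃ b c, (cutoff d n a, b) ∈ (mulOp fun x => x j).graph ∧
      (b, c) ∈ (mulOp fun x => x j).graph := by
  have hB := (Metric.isClosed_closedBall (x := (0 : EuclideanSpace ℝ (Fin d)))
    (ε := n)).measurableSet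
  have h1 : ∀ x : EuclideanSpace ℝ (Fin d), ‖(Metric.closedBall 0 (n : ℝ)).indicator
      (fun x : EuclideanSpace ℝ (Fin d) => ((x j : ℝ) : ℂ)) x‖ ≤ n := by
    intro x
    by_cases hx : x ∈ Metric.closedBall (0 : EuclideanSpace ℝ (Fin d)) n
    · rw [Set.indicator_of_mem hx, Complex.norm_real]
      exact (PiLp.norm_apply_le x j).trans (mem_closedBall_zero_iff.1 hx)
    · rw [Set.indicator_of_notMem hx, norm_zero]
      positivity
  set B := boundedMul _ ((by fun_prop : Measurable fun x : EuclideanSpace ℝ (Fin d) =>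
    ((x j : ℝ) : ℂ)).indicator hB) _ h1
  have hBa : ∀ a, B a =ᵐ[volume] fun x => (Metric.closedBall 0 (n : ℝ)).indicator
      (fun x : EuclideanSpace ℝ (Fin d) => ((x j : ℝ) : ℂ)) x * a x := coeFn_boundedMul _ h1
  refine ⟨B a, B (B a), mem_graph_mulOp.2 ?_, mem_graph_mulOp.2 ?_⟩
  · filter_upwards [hBa a, coeFn_cutoff n a] with x h2 h3
    rw [h2, h3]
    by_cases hx : x ∈ Metric.closedBall (0 : EuclideanSpace ℝ (Fin d)) n <;> simp [hx]
  · filter_upwards [hBa a, hBa (B a)] with x h2 h3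
    rw [h3, h2]
    by_cases hx : x ∈ Metric.closedBall (0 : EuclideanSpace ℝ (Fin d)) n <;> simp [hx]

theorem sum_mem_graph_normSq {a : L2 d} {b c : Fin d → L2 d}
    (hb : ∀ j, (a, b j) ∈ (mulOp fun x => x j).graph)
    (hc : ∀ j, (b j, c j) ∈ (mulOp fun x => x j).graph) :
    (a, ∑ j, c j) ∈ (mulOp fun x : EuclideanSpace ℝ (Fin d) => ‖x‖ ^ 2).graph := by
  simp only [mem_graph_mulOp] at hb hc ⊢
  filter_upwards [ae_all_iff.2 hb, ae_all_iff.2 hc, Lp.coeFn_finsetSum Finset.univ c]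
    with x h1 h2 h3
  rw [h3, Finset.sum_apply, EuclideanSpace.real_norm_sq_eq, Complex.ofReal_sum, Finset.sum_mul]
  refine Finset.sum_congr rfl fun j _ => ?_
  rw [h2, h1]
  push_cast
  ring

theorem exists_mem_graph_norm {a : L2 d} {y : Fin d → L2 d}
    (hy : ∀ j, (a, y j) ∈ (mulOp fun x => x j).graph) :
    ∃ b, (a, b) ∈ (mulOp fun x : EuclideanSpace ℝ (Fin d) => ‖x‖).graph ∧
      ‖b‖ ^ 2 = ∑ j, ‖y j‖ ^ 2 := by
  simp only [mem_graph_mulOp] at hy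
  have h1 : ∀ᵐ x, ‖((‖x‖ : ℝ) : ℂ) * a x‖ ^ 2 = ∑ j, ‖y j x‖ ^ 2 := by
    filter_upwards [ae_all_iff.2 hy] with x hx
    simp only [hx, norm_mul, mul_pow, Complex.norm_real, norm_norm]
    rw [← Finset.sum_mul, EuclideanSpace.real_norm_sq_eq]
    simp
  have hm : MemLp (fun x => ((‖x‖ : ℝ) : ℂ) * a x) 2 volume := by
    have h2 : AEStronglyMeasurable (fun x : EuclideanSpace ℝ (Fin d) => ((‖x‖ : ℝ) : ℂ) * a x)
      volume := (by fun_prop : Measurable fun x : EuclideanSpace ℝ (Fin d) =>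
        ((‖x‖ : ℝ) : ℂ)).aestronglyMeasurable.mul (Lp.aestronglyMeasurable a)
    rw [← memLp_norm_iff h2, memLp_two_iff_integrable_sq h2.norm]
    refine (integrable_congr h1).2 ?_
    exact integrable_finsetSum _ fun j _ => L2.integrable_norm_sq (y j)
  refine ⟨hm.toLp _, mem_graph_mulOp.2 hm.coeFn_toLp, ?_⟩
  simp only [L2.norm_sq_eq_integral]
  rw [← integral_finsetSum _ fun j _ => L2.integrable_norm_sq (y j)]
  refine integral_congr_ae ?_
  filter_upwards [h1, hm.coeFn_toLp] with x h2 h3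
  rw [h3, h2]

theorem norm_truncatedNorm_sq_le {a : L2 d} {y : Fin d → L2 d}
    (hy : ∀ j, (a, y j) ∈ (mulOp fun x => x j).graph) :
    ‖truncatedNorm d a‖ ^ 2 ≤ ∑ j, ‖y j‖ ^ 2 := by
  obtain ⟨b, hb, hn⟩ := exists_mem_graph_norm hy
  rw [← hn]
  gcongr
  rw [mem_graph_mulOp] at hb
  refine Lp.norm_le_norm_of_ae_le ?_
  filter_upwards [hb, coeFn_truncatedNorm a] with x h1 h2
  rw [h1, h2, norm_mul, norm_mul, Complex.norm_real, Complex.norm_real,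
    Real.norm_of_nonneg (by positivity), norm_norm]
  gcongr
  exact min_le_left _ _

end Multiplication

/-! ### The Fourier transform -/

section Fourier

open FourierTransform TemperedDistribution

variable {d : ℕ}

/-- The Fourier transform on `L²(ℝ^d)`. -/
noncomputable def fourierL2 (d : ℕ) : L2 d ≃ₗᵢ[ℂ] L2 d :=
  Lp.fourierTransformₗᵢ (EuclideanSpace ℝ (Fin d)) ℂ

theorem toTemperedDistribution_fourierL2 (a : L2 d) :
    Lp.toTemperedDistribution (fourierL2 d a) = 𝓕 (Lp.toTemperedDistribution a) :=
  (Lp.fourier_toTemperedDistribution_eq a).symm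

theorem locallyIntegrable_continuous_mul {g : EuclideanSpace ℝ (Fin d) → ℂ} (hg : Continuous g)
    (a : L2 d) : LocallyIntegrable (fun x => g x * a x) volume := by
  have h := (Lp.memLp a).locallyIntegrable (by norm_num)
  exact locallyIntegrable_iff.2 fun k hk =>
    (locallyIntegrable_iff.1 h k hk).continuousOn_mul hg.continuousOn hk

/-- Multiplication of tempered distributions given by `L²` functions. -/
theorem toTemperedDistribution_eq_smulLeftCLM_iff {g : EuclideanSpace ℝ (Fin d) → ℂ}
    (hg : g.HasTemperateGrowth) {a b : L2 d} :
    Lp.toTemperedDistribution b = smulLeftCLM ℂ g (Lp.toTemperedDistribution a) ↔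
      b =ᵐ[volume] fun x => g x * a x := by
  constructor
  · intro h
    refine ae_eq_of_integral_contDiff_smul_eq ((Lp.memLp b).locallyIntegrable (by norm_num))
      (locallyIntegrable_continuous_mul hg.1.continuous a) fun u hu hu' => ?_
    have hg₁ : HasCompactSupport (Complex.ofRealCLM ∘ u) := hu'.comp_left rfl
    have hg₂ : ContDiff ℝ ((⊤ : ℕ∞) : WithTop ℕ∞) (Complex.ofRealCLM ∘ u) := by fun_prop
    have h1 := congrArg (fun T => T (hg₁.toSchwartzMap hg₂)) h
    simp only [smulLeftCLM_apply_apply, Lp.toTemperedDistribution_apply] at h1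
    rw [SchwartzMap.smulLeftCLM_apply hg] at h1
    simp only [HasCompactSupport.toSchwartzMap_toFun, Function.comp_apply, smul_eq_mul] at h1
    have h2 : ∀ x, u x • b x = Complex.ofRealCLM (u x) * b x := fun x => Complex.real_smul
    have h3 : ∀ x, u x • (g x * a x) = g x * Complex.ofRealCLM (u x) * a x := fun x => by
      rw [Complex.real_smul, Complex.ofRealCLM_apply]
      ring
    exact (integral_congr_ae (Eventually.of_forall h2)).trans
      (h1.trans (integral_congr_ae (Eventually.of_forall h3)).symm)
  · intro h
    ext u
    simp only [smulLeftCLM_apply_apply, Lp.toTemperedDistribution_apply]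
    refine integral_congr_ae ?_
    filter_upwards [h] with x hx
    rw [hx, SchwartzMap.smulLeftCLM_apply_apply hg]
    simp only [smul_eq_mul]
    ring

theorem toTemperedDistribution_eq_neg_laplacian_iff {a b : L2 d} :
    Lp.toTemperedDistribution b = -Δ (Lp.toTemperedDistribution a) ↔
      fourierL2 d b =ᵐ[volume]
        fun x => (((2 * Real.pi) ^ 2 * ‖x‖ ^ 2 : ℝ) : ℂ) * fourierL2 d a x := by
  have hg : (fun x : EuclideanSpace ℝ (Fin d) =>
      (((2 * Real.pi) ^ 2 * ‖x‖ ^ 2 : ℝ) : ℂ)).HasTemperateGrowth := by fun_prop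
  have hg' : (fun x : EuclideanSpace ℝ (Fin d) =>
      ((‖x‖ ^ 2 : ℝ) : ℂ)).HasTemperateGrowth := by fun_prop
  rw [← toTemperedDistribution_eq_smulLeftCLM_iff hg, toTemperedDistribution_fourierL2,
    toTemperedDistribution_fourierL2]
  have h1 : -Δ (Lp.toTemperedDistribution a) = 𝓕⁻ (smulLeftCLM ℂ (fun x =>
      (((2 * Real.pi) ^ 2 * ‖x‖ ^ 2 : ℝ) : ℂ)) (𝓕 (Lp.toTemperedDistribution a))) := by
    have h2 := fourierMultiplierCLM_smul (F := ℂ) hg' (((2 * Real.pi) ^ 2 : ℝ) : ℂ)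
    have h3 : ((((2 * Real.pi) ^ 2 : ℝ) : ℂ) • fun x : EuclideanSpace ℝ (Fin d) =>
        ((‖x‖ ^ 2 : ℝ) : ℂ)) = fun x => (((2 * Real.pi) ^ 2 * ‖x‖ ^ 2 : ℝ) : ℂ) := by
      ext x
      simp
    rw [h3] at h2
    rw [← fourierMultiplierCLM_apply, h2, laplacian_eq_fourierMultiplierCLM, neg_smul, neg_neg]
    rfl
  rw [h1]
  constructor
  · intro h
    rw [h, FourierTransform.fourier_fourierInv_eq]
  · intro h
    rw [← h, FourierTransform.fourierInv_fourier_eq]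

/-- The Fourier transform is normalised with `e^{-2πi⟨x, ξ⟩}`, hence the factor `(2π)²`. The point
of the converse is that an `L²` right-hand side already forces `a ∈ H²`. -/
theorem mem_graph_freeHamiltonian {a b : L2 d} :
    (a, b) ∈ (freeHamiltonian d).graph ↔
      fourierL2 d b =ᵐ[volume]
        fun x => (((2 * Real.pi) ^ 2 * ‖x‖ ^ 2 : ℝ) : ℂ) * fourierL2 d a x := by
  rw [← toTemperedDistribution_eq_neg_laplacian_iff]
  constructor
  · intro h
    obtain ⟨⟨a', ha'⟩, ha, hb⟩ := (LinearPMap.mem_graph_iff _).1 h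
    dsimp only at ha hb
    subst ha hb
    exact (exists_neg_laplacian ⟨a', ha'⟩).choose_spec
  · intro h
    have ha : a ∈ sobolevSpace d 2 := by
      -- The Sobolev weight `1 + ‖ξ‖²` times the transform of `a` is this `L²` function, by the
      -- equation for `b`.
      refine memSobolev_iff_exists_smulLeftCLM_fourier.2
        ⟨fourierL2 d a + (((2 * Real.pi) ^ 2 : ℝ) : ℂ)⁻¹ • fourierL2 d b, ?_⟩
      rw [toTemperedDistribution_eq_neg_laplacian_iff] at h
      have h1 := toTemperedDistribution_fourierL2 a
      rw [Lp.toTemperedDistributionCLM_apply, ← h1]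
      symm
      rw [toTemperedDistribution_eq_smulLeftCLM_iff (by fun_prop)]
      filter_upwards [h, Lp.coeFn_add (fourierL2 d a)
        ((((2 * Real.pi) ^ 2 : ℝ) : ℂ)⁻¹ • fourierL2 d b),
        Lp.coeFn_smul (((2 * Real.pi) ^ 2 : ℝ) : ℂ)⁻¹ (fourierL2 d b)] with x h2 h3 h4
      rw [h3, Pi.add_apply, h4, Pi.smul_apply, h2, smul_eq_mul]
      have h5 : (((2 * Real.pi) ^ 2 : ℝ) : ℂ) ≠ 0 := by
        have := Real.pi_pos
        exact_mod_cast (by positivity : ((2 * Real.pi) ^ 2 : ℝ) ≠ 0)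
      rw [div_self two_ne_zero, Real.rpow_one, Complex.ofReal_mul, mul_assoc,
        inv_mul_cancel_left₀ h5]
      push_cast
      ring
    refine (LinearPMap.mem_graph_iff _).2 ⟨⟨a, ha⟩, rfl, ?_⟩
    apply toTemperedDistribution_injective d
    exact (exists_neg_laplacian ⟨a, ha⟩).choose_spec.trans h.symm

theorem fourierL2_mem_mulDomain_of_mem_sobolevSpace_one {a : L2 d} (ha : a ∈ sobolevSpace d 1)
    (j : Fin d) :
    fourierL2 d a ∈ mulDomain fun x : EuclideanSpace ℝ (Fin d) => 2 * Real.pi * x j := by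
  obtain ⟨f, hf⟩ := memSobolev_iff_exists_smulLeftCLM_fourier.1 ha
  have h1 := toTemperedDistribution_fourierL2 a
  rw [Lp.toTemperedDistributionCLM_apply, ← h1] at hf
  have h2 := (toTemperedDistribution_eq_smulLeftCLM_iff (by fun_prop)).1 hf.symm
  refine MemLp.of_le_mul (c := 2 * Real.pi) (Lp.memLp f) ?_ ?_
  · exact (by fun_prop : Measurable fun x : EuclideanSpace ℝ (Fin d) =>
      ((2 * Real.pi * x j : ℝ) : ℂ)).aestronglyMeasurable.mul (Lp.aestronglyMeasurable _)
  · filter_upwards [h2] with x hx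
    have hpi := Real.pi_pos
    have h3 : |x j| ≤ (1 + ‖x‖ ^ 2) ^ ((1 : ℝ) / 2) := by
      rw [← Real.sqrt_eq_rpow]
      refine Real.le_sqrt_of_sq_le ?_
      have := PiLp.norm_apply_le x j
      rw [Real.norm_eq_abs] at this
      nlinarith [abs_nonneg (x j)]
    rw [hx, norm_mul, norm_mul, Complex.norm_real, Complex.norm_real, norm_mul,
      Real.norm_of_nonneg (by positivity : 0 ≤ 2 * Real.pi), Real.norm_eq_abs, mul_assoc,
      Real.norm_of_nonneg (by positivity)]
    gcongr

/-- Translation on `L²`. -/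
noncomputable def translation (w : EuclideanSpace ℝ (Fin d)) : L2 d →ₗᵢ[ℂ] L2 d :=
  Lp.compMeasurePreservingₗᵢ ℂ (fun x => x - w) (measurePreserving_sub_right volume w)

theorem coeFn_translation (w : EuclideanSpace ℝ (Fin d)) (a : L2 d) :
    translation w a =ᵐ[volume] fun x => a (x - w) :=
  Lp.coeFn_compMeasurePreserving a (measurePreserving_sub_right volume w)

/-- By continuity it suffices to take Schwartz functions, where a change of variables in the inverse
Fourier integral produces the phase. The shift is `s / (2π)` because of the `2π` in the exponent. -/
theorem fourierL2_symm_translation (j : Fin d) (s : ℝ) (a : L2 d) :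
    (fourierL2 d).symm (translation (EuclideanSpace.single j (s / (2 * Real.pi))) a) =
      modulation j s ((fourierL2 d).symm a) := by
  set w : EuclideanSpace ℝ (Fin d) := EuclideanSpace.single j (s / (2 * Real.pi)) with hw
  have hF : ∀ φ : 𝓢(EuclideanSpace ℝ (Fin d), ℂ),
      (fourierL2 d).symm (φ.toLp 2) = (𝓕⁻ φ).toLp 2 := SchwartzMap.toLp_fourierInv_eq
  refine DenseRange.induction_on (p := fun a => (fourierL2 d).symm (translation w a) =
      modulation j s ((fourierL2 d).symm a)) (SchwartzMap.denseRange_toLpCLM (p := 2)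
      (F := ℂ) (E := EuclideanSpace ℝ (Fin d)) (μ := volume) ENNReal.ofNat_ne_top) a ?_ ?_
  · refine isClosed_eq ?_ ?_
    · exact (fourierL2 d).symm.continuous.comp (translation w).continuous
    · exact (modulation j s).continuous.comp (fourierL2 d).symm.continuous
  intro φ
  have h1 : translation w (φ.toLp 2) = (φ.compSubConstCLM ℂ w).toLp 2 := by
    apply Lp.ext
    filter_upwards [coeFn_translation w (φ.toLp 2),
      SchwartzMap.coeFn_toLp (φ.compSubConstCLM ℂ w) 2 volume,
      (measurePreserving_sub_right volume w).quasiMeasurePreserving.ae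
        (SchwartzMap.coeFn_toLp φ 2 volume)] with x h2 h3 h4
    rw [h2, h3, h4]
    rfl
  rw [SchwartzMap.toLpCLM_apply, h1, hF, hF]
  apply Lp.ext
  filter_upwards [SchwartzMap.coeFn_toLp (𝓕⁻ (φ.compSubConstCLM ℂ w)) 2 volume,
    coeFn_modulation j s ((𝓕⁻ φ).toLp 2), SchwartzMap.coeFn_toLp (𝓕⁻ φ) 2 volume] with x h2 h3 h4
  rw [h2, h3, h4, SchwartzMap.fourierInv_coe, SchwartzMap.fourierInv_coe, Real.fourierInv_eq',
    Real.fourierInv_eq']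
  rw [← integral_const_mul, ← integral_add_right_eq_self _ w]
  congr 1
  ext y
  have h5 : inner ℝ w x = s / (2 * Real.pi) * x j := by
    rw [hw, EuclideanSpace.inner_single_left]
    simp
  have hpi : (2 * Real.pi) ≠ 0 := by
    have := Real.pi_pos
    positivity
  have h6 : 2 * Real.pi * (inner ℝ (y + w) x) = 2 * Real.pi * inner ℝ y x + s * x j := by
    rw [inner_add_left, h5]
    field_simp
  rw [SchwartzMap.compSubConstCLM_apply, add_sub_cancel_right, h6, Complex.ofReal_add, add_mul,
    Complex.exp_add, smul_eq_mul, smul_eq_mul, mul_comm Complex.I]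
  ring

theorem fourierL2_modulation (j : Fin d) (s : ℝ) (a : L2 d) :
    fourierL2 d (modulation j s a) =ᵐ[volume]
      fun x => fourierL2 d a (x - EuclideanSpace.single j (s / (2 * Real.pi))) := by
  have h := fourierL2_symm_translation j s (fourierL2 d a)
  rw [LinearIsometryEquiv.symm_apply_apply] at h
  rw [← h, LinearIsometryEquiv.apply_symm_apply]
  exact coeFn_translation _ _

end Fourier

/-! ### The phase space of a Schrödinger operator -/

section Schroedinger

variable {d : ℕ}

/-- The momentum operator `-i ∂_j`. -/
noncomputable def momentum (j : Fin d) : L2 d →ₗ.[ℂ] L2 d :=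
  ((mulOp fun x : EuclideanSpace ℝ (Fin d) => 2 * Real.pi * x j).graph.comap
    ((fourierL2 d).toLinearEquiv.toLinearMap.prodMap
      (fourierL2 d).toLinearEquiv.toLinearMap)).toLinearPMap

theorem mem_graph_momentum {j : Fin d} {a p : L2 d} :
    (a, p) ∈ (momentum j).graph ↔ fourierL2 d p =ᵐ[volume]
      fun x => ((2 * Real.pi * x j : ℝ) : ℂ) * fourierL2 d a x := by
  rw [momentum, Submodule.toLinearPMap_graph_eq]
  · exact mem_graph_mulOp
  · rintro ⟨b, q⟩ h (rfl : b = 0)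
    have h1 : (fourierL2 d 0, fourierL2 d q) ∈
      (mulOp fun x : EuclideanSpace ℝ (Fin d) => 2 * Real.pi * x j).graph := h
    have h2 := LinearPMap.graph_fst_eq_zero_snd _ h1 (_root_.map_zero _)
    exact (LinearIsometryEquiv.map_eq_zero_iff _).1 h2

theorem exists_momentum_of_mem_sobolevSpace_one {a : L2 d} (ha : a ∈ sobolevSpace d 1)
    (j : Fin d) : ∃ p, (a, p) ∈ (momentum j).graph := by
  have h := fourierL2_mem_mulDomain_of_mem_sobolevSpace_one ha j
  refine ⟨(fourierL2 d).symm (MemLp.toLp _ h), mem_graph_momentum.2 ?_⟩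
  rw [LinearIsometryEquiv.apply_symm_apply]
  exact MemLp.coeFn_toLp h

theorem graphAdjoint_momentum (j : Fin d) : GraphAdjoint 1 (momentum j).graph := by
  intro a b a' b' h h'
  rw [mem_graph_momentum, ← mem_graph_mulOp] at h h'
  have := graphAdjoint_mulOp _ _ _ _ _ h h'
  rwa [LinearIsometryEquiv.inner_map_map, LinearIsometryEquiv.inner_map_map] at this

theorem norm_le_of_mem_graph_mulOp {V : EuclideanSpace ℝ (Fin d) → ℝ} (hV : MemLp V ∞ volume)
    {a b : L2 d} (h : (a, b) ∈ (mulOp V).graph) :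
    ‖b‖ ≤ (eLpNorm V ∞ volume).toReal * ‖a‖ := by
  rw [mem_graph_mulOp] at h
  refine Lp.norm_le_mul_norm_of_ae_le_mul ?_
  have h1 : ∀ᵐ x, ‖V x‖ₑ ≤ eLpNorm V ∞ volume := by
    rw [eLpNorm_exponent_top]
    exact enorm_ae_le_eLpNormEssSup V volume
  filter_upwards [h, h1] with x h2 h3
  rw [h2, norm_mul, Complex.norm_real]
  gcongr
  rw [← toReal_enorm]
  exact ENNReal.toReal_mono hV.2.ne h3

theorem mulOp_modulation {V : EuclideanSpace ℝ (Fin d) → ℝ} (j : Fin d) (s : ℝ) {a b : L2 d}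
    (h : (a, b) ∈ (mulOp V).graph) : (modulation j s a, modulation j s b) ∈ (mulOp V).graph := by
  rw [mem_graph_mulOp] at h ⊢
  filter_upwards [h, coeFn_modulation j s a, coeFn_modulation j s b] with x h1 h2 h3
  rw [h2, h3, h1]
  ring

/-- On the Fourier side modulation is translation by `w = (s / 2π) e_j`, and completing the square
gives `(2π)²‖ξ - w‖² + 2s · 2π(ξ - w)_j + s² = (2π)²‖ξ‖²`. -/
theorem freeHamiltonian_modulation {j : Fin d} {a b p : L2 d}
    (hab : (a, b) ∈ (freeHamiltonian d).graph) (hap : (a, p) ∈ (momentum j).graph) (s : ℝ) :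
    (modulation j s a, modulation j s (b + (2 * s : ℂ) • p + (s ^ 2 : ℂ) • a)) ∈
      (freeHamiltonian d).graph := by
  rw [mem_graph_freeHamiltonian] at hab ⊢
  rw [mem_graph_momentum] at hap
  set w : EuclideanSpace ℝ (Fin d) := EuclideanSpace.single j (s / (2 * Real.pi)) with hw
  have hq := (measurePreserving_sub_right (volume : Measure (EuclideanSpace ℝ (Fin d))) w)
    |>.quasiMeasurePreserving
  have h0 : fourierL2 d (b + (2 * s : ℂ) • p + (s ^ 2 : ℂ) • a) =ᵐ[volume] fun x =>
      (((2 * Real.pi) ^ 2 * ‖x‖ ^ 2 + 2 * s * (2 * Real.pi * x j) + s ^ 2 : ℝ) : ℂ) *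
        fourierL2 d a x := by
    rw [_root_.map_add, _root_.map_add, _root_.map_smul, _root_.map_smul]
    filter_upwards [hab, hap,
      Lp.coeFn_add (fourierL2 d b + (2 * s : ℂ) • fourierL2 d p) ((s ^ 2 : ℂ) • fourierL2 d a),
      Lp.coeFn_add (fourierL2 d b) ((2 * s : ℂ) • fourierL2 d p),
      Lp.coeFn_smul (2 * s : ℂ) (fourierL2 d p), Lp.coeFn_smul (s ^ 2 : ℂ) (fourierL2 d a)]
      with x h1 h2 h3 h4 h5 h6
    rw [h3, Pi.add_apply, h4, Pi.add_apply, h5, h6, Pi.smul_apply, Pi.smul_apply, h1, h2,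
      smul_eq_mul, smul_eq_mul]
    push_cast
    ring
  filter_upwards [hq.ae h0, fourierL2_modulation j s a,
    fourierL2_modulation j s (b + (2 * s : ℂ) • p + (s ^ 2 : ℂ) • a)] with x h1 h2 h3
  rw [h3, h2, h1]
  congr 2
  have hpi := Real.pi_pos
  have h4 : ‖x - w‖ ^ 2 = ‖x‖ ^ 2 - 2 * (x j * (s / (2 * Real.pi))) + (s / (2 * Real.pi)) ^ 2 := by
    rw [norm_sub_sq_real, hw, EuclideanSpace.inner_single_right, PiLp.norm_single,
      Real.norm_eq_abs, sq_abs]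
    simp [mul_comm]
  have h5 : (x - w) j = x j - s / (2 * Real.pi) := by
    simp [hw]
  rw [h4, h5]
  field_simp
  ring

theorem momentum_modulation {i j : Fin d} {a p : L2 d} (hap : (a, p) ∈ (momentum i).graph)
    (s : ℝ) : (modulation j s a, modulation j s (p + if i = j then (s : ℂ) • a else 0)) ∈
      (momentum i).graph := by
  rw [mem_graph_momentum] at hap ⊢
  set w : EuclideanSpace ℝ (Fin d) := EuclideanSpace.single j (s / (2 * Real.pi)) with hw
  have hq := (measurePreserving_sub_right (volume : Measure (EuclideanSpace ℝ (Fin d))) w)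
    |>.quasiMeasurePreserving
  have h0 : fourierL2 d (p + if i = j then (s : ℂ) • a else 0) =ᵐ[volume] fun x =>
      ((2 * Real.pi * x i + if i = j then s else 0 : ℝ) : ℂ) * fourierL2 d a x := by
    split_ifs
    · rw [_root_.map_add, _root_.map_smul]
      filter_upwards [hap, Lp.coeFn_add (fourierL2 d p) ((s : ℂ) • fourierL2 d a),
        Lp.coeFn_smul (s : ℂ) (fourierL2 d a)] with x h1 h2 h3
      rw [h2, Pi.add_apply, h3, Pi.smul_apply, h1, smul_eq_mul]
      push_cast
      ring
    · simpa using hap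
  filter_upwards [hq.ae h0, fourierL2_modulation j s a,
    fourierL2_modulation j s (p + if i = j then (s : ℂ) • a else 0)] with x h1 h2 h3
  rw [h3, h2, h1]
  congr 2
  have hpi := Real.pi_pos
  have h5 : (x - w) i = x i - if i = j then s / (2 * Real.pi) else 0 := by
    simp [hw]
  rw [h5]
  split_ifs
  · field_simp
    ring
  · ring

theorem exists_momentum_of_mem_graph_freeHamiltonian {a b : L2 d}
    (hab : (a, b) ∈ (freeHamiltonian d).graph) (j : Fin d) :
    ∃ p, (a, p) ∈ (momentum j).graph := by
  rw [mem_graph_freeHamiltonian] at hab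
  have h : MemLp (fun x : EuclideanSpace ℝ (Fin d) =>
      ((2 * Real.pi * x j : ℝ) : ℂ) * fourierL2 d a x) 2 volume := by
    refine MemLp.of_le ((Lp.memLp (fourierL2 d a)).norm.add (Lp.memLp (fourierL2 d b)).norm) ?_ ?_
    · exact (by fun_prop : Measurable fun x : EuclideanSpace ℝ (Fin d) =>
        ((2 * Real.pi * x j : ℝ) : ℂ)).aestronglyMeasurable.mul (Lp.aestronglyMeasurable _)
    · filter_upwards [hab] with x hx
      have hpi := Real.pi_pos
      have h1 : |x j| ≤ ‖x‖ := by simpa using PiLp.norm_apply_le x j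
      have h2 : 2 * Real.pi * |x j| ≤ 1 + (2 * Real.pi) ^ 2 * ‖x‖ ^ 2 := by
        have h3 : 2 * Real.pi * |x j| ≤ 2 * Real.pi * ‖x‖ := by gcongr
        nlinarith [sq_nonneg (2 * Real.pi * ‖x‖ - 1)]
      rw [Pi.add_apply, hx, norm_mul, norm_mul, Complex.norm_real, Complex.norm_real, norm_mul,
        Real.norm_of_nonneg (by positivity : 0 ≤ 2 * Real.pi), Real.norm_eq_abs,
        Real.norm_of_nonneg (by positivity : 0 ≤ (2 * Real.pi) ^ 2 * ‖x‖ ^ 2),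
        Real.norm_of_nonneg (by positivity)]
      have h4 := mul_le_mul_of_nonneg_right h2 (norm_nonneg (fourierL2 d a x))
      linarith
  refine ⟨(fourierL2 d).symm h.toLp, mem_graph_momentum.2 ?_⟩
  rw [LinearIsometryEquiv.apply_symm_apply]
  exact h.coeFn_toLp

/-- Plancherel together with `‖ξ‖² = ∑ ξ_j²`. The vector `c` needs momenta only, which lets `energy`
be used for states that are merely in `H¹`. -/
theorem inner_freeHamiltonian {a b c : L2 d} {p q : Fin d → L2 d}
    (hab : (a, b) ∈ (freeHamiltonian d).graph) (hp : ∀ j, (a, p j) ∈ (momentum j).graph)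
    (hq : ∀ j, (c, q j) ∈ (momentum j).graph) : ⟪b, c⟫ = ∑ j, ⟪p j, q j⟫ := by
  simp only [mem_graph_momentum] at hp hq
  rw [mem_graph_freeHamiltonian] at hab
  rw [← (fourierL2 d).inner_map_map b c]
  simp only [← (fourierL2 d).inner_map_map (p _)]
  simp only [MeasureTheory.L2.inner_def]
  rw [← integral_finsetSum _ fun j _ => MeasureTheory.L2.integrable_inner _ _]
  refine integral_congr_ae ?_
  filter_upwards [hab, ae_all_iff.2 hp, ae_all_iff.2 hq] with x h1 h2 h3
  simp only [h1, h2, h3, RCLike.inner_apply, _root_.map_mul, Complex.conj_ofReal]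
  rw [EuclideanSpace.real_norm_sq_eq, Finset.mul_sum, Complex.ofReal_sum, Finset.sum_mul,
    Finset.mul_sum]
  refine Finset.sum_congr rfl fun j _ => ?_
  push_cast
  ring

/-- The phase space relations for the Schrödinger operator `-Δ + V` with bounded `V`. -/
theorem phaseSpace_hamiltonian {V : EuclideanSpace ℝ (Fin d) → ℝ} (hV : MemLp V ∞ volume) :
    PhaseSpace (hamiltonian V) (mulOp fun x => ‖x‖ ^ 2) (fun j => mulOp fun x => x j) momentum
      modulation (cutoff d) (eLpNorm V ∞ volume).toReal where
  norm_modulation := norm_modulation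
  tendsto_modulation := tendsto_modulation
  mem_position_iff _ _ _ := mem_graph_position_iff
  norm_modulation_sub_le _ _ _ h s := norm_modulation_sub_le h s
  position_of_bound _ _ _ h := exists_of_norm_modulation_sub_le h
  hamiltonian_modulation j a b p hab hap s := by
    obtain ⟨b₀, b₁, h0, h1, rfl⟩ := exists_of_mem_graph_add hab
    have h2 := mem_graph_add (freeHamiltonian_modulation h0 hap s) (mulOp_modulation j s h1)
    rw [← _root_.map_add] at h2
    convert! h2 using 3
    abel
  momentum_modulation _ _ _ _ h s := momentum_modulation h s
  domain_le j a ha := by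
    obtain ⟨b, hb⟩ := LinearPMap.mem_domain_iff.1 ha
    obtain ⟨b₀, b₁, h0, -, -⟩ := exists_of_mem_graph_add hb
    exact LinearPMap.mem_domain_iff.2 (exists_momentum_of_mem_graph_freeHamiltonian h0 j)
  adjoint_momentum := graphAdjoint_momentum
  energy a b c p q hab hp hq := by
    obtain ⟨b₀, b₁, h0, h1, rfl⟩ := exists_of_mem_graph_add hab
    rw [inner_add_left, inner_freeHamiltonian h0 hp hq, add_sub_cancel_left]
    refine (norm_inner_le_norm _ _).trans ?_
    gcongr
    exact norm_le_of_mem_graph_mulOp hV h1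
  tendsto_cutoff := tendsto_cutoff
  cutoff_position n _ _ _ h := cutoff_mem_graph n h
  cutoff_domain n j a := cutoff_mem_domain n j a
  square _ _ _ hb hc := sum_mem_graph_normSq hb hc
  adjoint_square := graphAdjoint_mulOp _

theorem StrictMourre.mourreBound {V : EuclideanSpace ℝ (Fin d) → ℝ} {I : Set ℝ} {α : ℝ}
    (h : StrictMourre V I α) :
    MourreBound (hamiltonian V) (conjugateOp V) (spectralProj (hamiltonian V) I) α := by
  intro φ b e hφ hb he
  have hH := LinearPMap.mem_domain_of_mem_graph hb
  have hA := LinearPMap.mem_domain_of_mem_graph he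
  rw [← hφ] at hH hA
  have h1 := h φ hH hA
  have h2 := LinearPMap.mem_graph_snd_inj _ (LinearPMap.mem_graph _ ⟨_, hH⟩) hb hφ
  have h3 := LinearPMap.mem_graph_snd_inj _ (LinearPMap.mem_graph _ ⟨_, hA⟩) he hφ
  rw [h2, h3, hφ] at h1
  have h4 : (⟪φ, φ⟫ : ℂ).re = ‖φ‖ ^ 2 := inner_self_eq_norm_sq (𝕜 := ℂ) φ
  rwa [h4] at h1

theorem heisenberg_apply_of_mem_graph {K : Type*} [NormedAddCommGroup K] [InnerProductSpace ℂ K]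
    [CompleteSpace K] {H B : K →ₗ.[ℂ] K} {t : ℝ} {a b : K} (h : (propagator H t a, b) ∈ B.graph) :
    ∃ ha : a ∈ (heisenberg H B t).domain, heisenberg H B t ⟨a, ha⟩ = propagator H (-t) b := by
  have ha : propagator H t a ∈ B.domain := LinearPMap.mem_domain_of_mem_graph h
  refine ⟨ha, ?_⟩
  rw [← LinearPMap.mem_graph_snd_inj _ (LinearPMap.mem_graph _ ⟨_, ha⟩) h rfl]
  rfl

end Schroedinger

theorem mainTheorem4 (d : ℕ) (V : EuclideanSpace ℝ (Fin d) → ℝ) (hV : MemLp V ∞ volume)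
    (I : Set ℝ) (hI : I.OrdConnected) (hM : ∃ α : ℝ, 0 < α ∧ StrictMourre V I α)
    (ψ : L2 d) (hψI : ψ ∈ Set.range (spectralProj (hamiltonian V) I))
    (hψQ : ψ ∈ (position d).domain) (hψ1 : ψ ∈ sobolevSpace d 1) (hψ0 : ψ ≠ 0) :
    (∃ C : ℝ, 0 < C ∧ ∀ α : ℝ, 0 < α → StrictMourre V I α → ∀ t : ℝ, 0 ≤ t →
      ∃ h : ψ ∈ (positionAt V t).domain, C * α * t ≤ ‖positionAt V t ⟨ψ, h⟩‖) ∧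
    NormGrowthBallistic V ψ := by
  -- Existence of the calculus costs nothing here: without one `borelCalc` is `0` by convention, and
  -- a nonzero `ψ` could not lie in the range of `spectralProj`.
  obtain ⟨Φ, hΦ, hcalc⟩ : ∃ Φ, IsBorelFunctionalCalculus (hamiltonian V) Φ ∧
      ∀ f, borelCalc (hamiltonian V) f = Φ f := by
    by_cases h : ∃ Φ, IsBorelFunctionalCalculus (hamiltonian V) Φ
    · exact ⟨h.choose, h.choose_spec, fun f => by rw [borelCalc, dif_pos h]⟩
    · obtain ⟨θ, rfl⟩ := hψI
      exact absurd (by rw [spectralProj, borelCalc, dif_neg h]; rfl) hψ0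
  have hprop : ∀ t, propagator (hamiltonian V) t = flow Φ t := fun t => hcalc _
  have hproj : spectralProj (hamiltonian V) I = Φ (I.indicator fun _ => 1) := hcalc _
  have hf := isBoundedBorel_indicator hI.measurableSet
  have hfψ : Φ (I.indicator fun _ => 1) ψ = ψ := by
    obtain ⟨θ, rfl⟩ := hψI
    rw [hproj, ← mul_apply_eq_comp, ← hΦ.map_mul _ _ hf hf]
    congr 2
    ext x
    by_cases hx : x ∈ I <;> simp [hx]
  have hps := phaseSpace_hamiltonian hV
  have hMourre : ∀ α, StrictMourre V I α → MourreBound (hamiltonian V)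
      (opCommutator (mulOp fun x => ‖x‖ ^ 2) (hamiltonian V)).closure
      (Φ (I.indicator fun _ => 1)) α := fun α hα => hproj ▸ hα.mourreBound
  choose x hx using fun j => LinearPMap.mem_domain_iff.1 ((Submodule.mem_iInf _).1 hψQ j)
  choose p hp using exists_momentum_of_mem_sobolevSpace_one hψ1
  obtain ⟨c, C, hc, hC, hbounds⟩ := hps.exists_ballistic_bounds ENNReal.toReal_nonneg hΦ hψ0 hx hp
    hf hfψ (fun hd => ⟨truncatedNorm d, fun a => truncatedNorm_injective hd,
      fun a y hy => norm_truncatedNorm_sq_le hy⟩) (hM.imp fun α hα => ⟨hα.1, hMourre α hα.2⟩)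
  -- The factor `4` comes from `(1 + t)² ≤ 4 t²` for `t ≥ 1`.
  refine ⟨⟨c, hc, fun α hα hαM t ht => ?_⟩, c, C * 4, hc, by positivity, fun t ht => ?_⟩
  · obtain ⟨y, hy, -, -, h1⟩ := hbounds t ht
    choose hdom hval using fun j =>
      heisenberg_apply_of_mem_graph (H := hamiltonian V) (t := t) (a := ψ) (b := y j)
        (B := mulOp fun x => x j) (by rw [hprop]; exact hy j)
    refine ⟨(Submodule.mem_iInf _).2 hdom, ?_⟩
    refine le_of_sq_le_sq ((h1 α hα (hMourre α hαM)).trans (le_of_eq ?_)) (norm_nonneg _)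
    rw [PiLp.norm_sq_eq_of_L2]
    refine Finset.sum_congr rfl fun j _ => ?_
    -- The outer factor `e^{itH}` is isometric, so each component of `Q(t) ψ` has the norm of `y j`.
    rw [← hΦ.norm_flow (-t) (y j), ← hprop, ← hval j]
    rfl
  · have ht0 : 0 ≤ t := zero_le_one.trans ht
    obtain ⟨y, hy, h1, h2, -⟩ := hbounds t ht0
    obtain ⟨b, hb, hbn⟩ := exists_mem_graph_norm hy
    rw [← hprop] at hb
    obtain ⟨hdom, hval⟩ := heisenberg_apply_of_mem_graph hb
    refine ⟨hdom, ?_⟩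
    rw [hval, hprop, hΦ.norm_flow, hbn]
    refine ⟨h1, h2.trans ?_⟩
    rw [mul_assoc]
    gcongr
    nlinarith
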